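/- Let $\mathrm{Cat}$ be the category of small categories, $p:\mathrm{Cat}\to\mathrm{Set}$ the functor of isomorphism classes of objects, and $\Delta_{mono}\subset\Delta$ the subcategory of injective maps. \textbf{Fair 2-categories.} Let $\underline{\Delta}$ (the "fat delta") be the category of coloured finite non-empty semi-ordinals: an object is a finite non-empty chain of dots $0<1<\cdots<n$ with a set of coloured edges (links) among the edges $\{i,i+1\}$; an arrow $i<j$ is coloured if all edges between $i$ and $j$ are links; a morphism is a strictly increasing map of dots sending coloured arrows to coloured arrows. Contracting links gives a functor $\pi:\underline{\Delta}\to\Delta$; a morphism is vertical if $\pi$ sends it to an identity. Ordinals without links give an embedding $\Delta_{mono}\subset\underline{\Delta}$; write $\bullet=[0]$. For $\underline m,\underline n\in\underline\Delta$ let $\underline m+_{\bullet}\underline n$ be their concatenation, i.e. the pushout of $\underline m\leftarrow\bullet\to\underline n$ along the last dot of $\underline m$ and the first dot of $\underline n$. A fair 2-category is a functor $X:\underline{\Delta}^{op}\to\mathrm{Cat}$ such that (a) vertical morphisms are sent to equivalences of categories; (b) $X_{\bullet}$ is discrete; (c) for all $\underline m,\underline n$ the canonical functor $X_{\underline m+_{\bullet}\underline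 n}\to X_{\underline m}\times_{X_\bullet}X_{\underline n}$ is an isomorphism. Let $\mathrm{Fair}^2$ be the full subcategory of $[\underline{\Delta}^{op},\mathrm{Cat}]$ on the fair 2-categories. \textbf{Tamsamani 2-categories.} A Tamsamani 2-category is a functor $X:\Delta^{op}\to\mathrm{Cat}$ such that $X_0$ is discrete and, for all $k\ge 2$, the Segal map $X_k\to X_1\times_{X_0}\overset{k}{\cdots}\times_{X_0}X_1$ is an equivalence of categories. Let $\mathrm{Ta}^2$ be the full subcategory of $[\Delta^{op},\mathrm{Cat}]$ on the Tamsamani 2-categories. \textbf{2-equivalences.} For $X$ in $\mathrm{Fair}^2$ or $\mathrm{Ta}^2$ and $a,b\in X_0$ (where $X_0=X_\bullet$ in the fair case), let $X(a,b)$ be the fibre at $(a,b)$ of the source-and-target functor $X_1\to X_0\times X_0$, and let $p^{(1)}X$ be the category with $(p^{(1)}X)_n=p(X_n)$; that is, the category whose nerve is $n\mapsto p(X_n)$ for $X\in\mathrm{Ta}^2$, and whose nerve restricted to $\Delta_{mono}$ is $n\mapsto p(X_n)$ for $X\in\mathrm{Fair}^2$. A morphism $f:X\to Y$ in $\mathrm{Fair}^2$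 (respectively in $\mathrm{Ta}^2$) is a 2-equivalence if $f_{(a,b)}:X(a,b)\to Y(fa,fb)$ is an equivalence of categories for all $a,b\in X_0$, and $p^{(1)}f:p^{(1)}X\to p^{(1)}Y$ is an equivalence of categories. \textbf{Claim.} The localizations of $\mathrm{Fair}^2$ and of $\mathrm{Ta}^2$ at their classes of 2-equivalences are equivalent categories: \[ \mathrm{Fair}^2/\!\sim\;\;\simeq\;\;\mathrm{Ta}^2/\!\sim . \] -/

import Mathlib

open CategoryTheory Opposite Simplicial

universe u

/-! ### Coloured finite non-empty semi-ordinals and the fat delta -/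

/-- A coloured finite non-empty semi-ordinal: the linear order of dots `0 < 1 < ⋯ < len`, in which
some of the `len` edges between consecutive dots (edge `e` joins the dots `e.castSucc` and `e.succ`)
are coloured; a coloured edge is called a link. -/
@[ext]
structure FatDelta : Type where
  len : ℕ
  links : Set (Fin len)

namespace FatDelta

/-- The dots of a coloured semi-ordinal. -/
abbrev Dot (m : FatDelta) : Type := Fin (m.len + 1)

/-- For `i < j`, the arrow `i ⟶ j` of the free coloured semi-category on the coloured linear graph
is coloured iff every edge between `i` and `j` is a link. (For `j ≤ i` there is no such edge and
the condition is empty.) -/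
def Coloured (m : FatDelta) (i j : m.Dot) : Prop :=
  ∀ e : Fin m.len, i ≤ e.castSucc → e.succ ≤ j → e ∈ m.links

/-- Morphisms are colour-preserving semi-functors: strictly increasing maps on dots that send
coloured arrows to coloured arrows (links may be set but not broken). -/
@[ext]
structure Hom (m n : FatDelta) : Type where
  toFun : m.Dot → n.Dot
  strictMono : StrictMono toFun
  coloured : ∀ i j : m.Dot, i < j → m.Coloured i j → n.Coloured (toFun i) (toFun j)

instance : Category.{0} FatDelta where
  Hom := Hom
  id m := ⟨id, strictMono_id, fun _ _ _ h => h⟩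
  comp f g := ⟨g.toFun ∘ f.toFun, g.strictMono.comp f.strictMono,
    fun i j hij h => g.coloured _ _ (f.strictMono hij) (f.coloured i j hij h)⟩

/-- Two dots are equiconnected if all the edges between them are links. -/
def equiconnected (m : FatDelta) : Setoid m.Dot where
  r i j := m.Coloured i j ∧ m.Coloured j i
  iseqv :=
    { refl := fun i => by
        have h : m.Coloured i i := fun e h₁ h₂ => by
          have := Fin.le_def.1 (h₂.trans h₁)
          simp at this
        exact ⟨h, h⟩
      symm := fun h => ⟨h.2, h.1⟩
      trans := by
        have key : ∀ {i j k : m.Dot}, m.Coloured i j → m.Coloured j k → m.Coloured i k := by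
          intro i j k h₁ h₂ e hi hk
          rcases le_or_gt e.succ j with h | h
          · exact h₁ e hi h
          · refine h₂ e ?_ hk
            rw [Fin.lt_def] at h
            rw [Fin.le_def]
            simp only [Fin.val_succ, Fin.val_castSucc] at *
            omega
        intro i j k h h'
        exact ⟨key h.1 h'.1, key h'.2 h.2⟩ }

/-- The ordinal obtained by contracting all the links, as the set of equiconnected components. -/
def Components (m : FatDelta) : Type := Quotient m.equiconnected

lemma Hom.equiconnected_map {m n : FatDelta} (f : m ⟶ n) (i j : m.Dot)
    (h : m.equiconnected i j) : n.equiconnected (f.toFun i) (f.toFun j) := by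
  have key : ∀ i j : m.Dot, m.Coloured i j → n.Coloured (f.toFun i) (f.toFun j) := by
    intro i j hij
    rcases lt_or_ge i j with h | h
    · exact f.coloured i j h hij
    · intro e h₁ h₂
      have h₃ := h₂.trans ((f.strictMono.monotone h).trans h₁)
      have := Fin.le_def.1 h₃
      simp at this
  exact ⟨key i j h.1, key j i h.2⟩

/-- The map induced by a morphism on equiconnected components. -/
def Hom.mapComponents {m n : FatDelta} (f : m ⟶ n) : m.Components → n.Components :=
  Quotient.map f.toFun (Hom.equiconnected_map f)

/-- The coloured arrows of the category `FatDelta` are the vertical ones: the morphisms that become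
invertible (that is, identities of ordinals) after contracting all the links. Since the induced
maps of ordinals are monotone, this means that they are bijective. -/
def vertical : MorphismProperty FatDelta :=
  fun _ _ f => Function.Bijective (Hom.mapComponents f)

/-- The one-dot semi-ordinal. -/
def pt : FatDelta := ⟨0, ∅⟩

/-- The semi-ordinal with two dots and no link. -/
def arrow : FatDelta := ⟨1, ∅⟩

/-- The morphism from the one-dot semi-ordinal that picks out a given dot. -/
def dot (m : FatDelta) (i : m.Dot) : pt ⟶ m where
  toFun _ := i
  strictMono a b h := by
    exact absurd h (by rw [Subsingleton.elim (α := Fin 1) a b]; exact lt_irrefl _)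
  coloured a b h := by
    exact absurd h (by rw [Subsingleton.elim (α := Fin 1) a b]; exact lt_irrefl _)

/-- The concatenation of `m` and `n`, identifying the last dot of `m` with the first dot of `n`;
it is the pushout of `m ← pt → n` along these two dots. -/
def concat (m n : FatDelta) : FatDelta where
  len := m.len + n.len
  links := Fin.castAdd n.len '' m.links ∪ Fin.natAdd m.len '' n.links

/-- The inclusion of the left summand of a concatenation. -/
def inl (m n : FatDelta) : m ⟶ concat m n where
  toFun i := ⟨i.1, by have := i.2; simp only [concat]; omega⟩
  strictMono i j h := h
  coloured i j _ h e h₁ h₂ := by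
    have h₁' : i.1 ≤ e.1 := h₁
    have h₂' : e.1 + 1 ≤ j.1 := h₂
    have hj := j.2
    exact Or.inl ⟨⟨e.1, by omega⟩, h _ h₁' h₂', rfl⟩

/-- The inclusion of the right summand of a concatenation. -/
def inr (m n : FatDelta) : n ⟶ concat m n where
  toFun j := ⟨m.len + j.1, by have := j.2; simp only [concat]; omega⟩
  strictMono i j h := Nat.add_lt_add_left (Fin.lt_def.1 h) _
  coloured i j _ h e h₁ h₂ := by
    have h₁' : m.len + i.1 ≤ e.1 := h₁
    have h₂' : e.1 + 1 ≤ m.len + j.1 := h₂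
    have hj := j.2
    refine Or.inr ⟨⟨e.1 - m.len, by omega⟩, h _ ?_ ?_, ?_⟩
    · change i.1 ≤ e.1 - m.len
      omega
    · change e.1 - m.len + 1 ≤ j.1
      omega
    · apply Fin.ext
      change m.len + (e.1 - m.len) = e.1
      omega

/-- The embedding in the fat delta of the category of finite non-empty ordinals and injective
monotone maps, as the semi-ordinals without links. -/
def ofSemiSimplex : SemiSimplexCategory ⥤ FatDelta where
  obj n := ⟨n.len, ∅⟩
  map f :=
    { toFun := SemiSimplexCategory.homEquiv f
      strictMono := (SemiSimplexCategory.homEquiv f).strictMono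
      coloured := fun i j hij h => by
        have hij' : i.1 < j.1 := hij
        have hj := j.2
        exact absurd (h ⟨i.1, by omega⟩ (le_refl i.1) hij') (Set.notMem_empty _) }

end FatDelta

/-! ### Hom-categories, and equivalences of truncations -/

section HomCategories

variable {J : Type} [Category.{0} J]

/-- For a diagram `X : Jᵒᵖ ⥤ Cat` and two morphisms `s t : o ⟶ e` of `J`, the objects in the fibre
over `(a, b)` of the functor `(s, t) : X_e ⥤ X_o × X_o`. When `X_o` is discrete, every morphism of
`X_e` between such objects lies over the identity of `(a, b)`, so that the fibre is the full
subcategory of `X_e` on these objects. -/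
def homObjects (X : Jᵒᵖ ⥤ Cat.{u, u}) {o e : J} (s t : o ⟶ e) (a b : X.obj (op o)) :
    ObjectProperty (X.obj (op e)) :=
  fun x => (X.map s.op).toFunctor.obj x = a ∧ (X.map t.op).toFunctor.obj x = b

/-- The hom-category `X(a, b)`. -/
abbrev HomCat (X : Jᵒᵖ ⥤ Cat.{u, u}) {o e : J} (s t : o ⟶ e) (a b : X.obj (op o)) : Type u :=
  (homObjects X s t a b).FullSubcategory

lemma homObjects_map {X Y : Jᵒᵖ ⥤ Cat.{u, u}} (f : X ⟶ Y) {o e : J} (s t : o ⟶ e)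
    (a b : X.obj (op o)) (x : HomCat X s t a b) :
    homObjects Y s t ((f.app (op o)).toFunctor.obj a) ((f.app (op o)).toFunctor.obj b)
      ((f.app (op e)).toFunctor.obj x.obj) := by
  have h : ∀ r : o ⟶ e, (Y.map r.op).toFunctor.obj ((f.app (op e)).toFunctor.obj x.obj) =
      (f.app (op o)).toFunctor.obj ((X.map r.op).toFunctor.obj x.obj) := fun r =>
    (Functor.congr_obj (congrArg Cat.Hom.toFunctor (f.naturality r.op)) x.obj).symm
  exact ⟨by rw [h, x.property.1], by rw [h, x.property.2]⟩

/-- The functor `X(a, b) ⥤ Y(fa, fb)` induced by a morphism of diagrams `f : X ⟶ Y`. -/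
def homCatMap {X Y : Jᵒᵖ ⥤ Cat.{u, u}} (f : X ⟶ Y) {o e : J} (s t : o ⟶ e)
    (a b : X.obj (op o)) :
    HomCat X s t a b ⥤
      HomCat Y s t ((f.app (op o)).toFunctor.obj a) ((f.app (op o)).toFunctor.obj b) :=
  ObjectProperty.lift _ ((homObjects X s t a b).ι ⋙ (f.app (op e)).toFunctor)
    (homObjects_map f s t a b)

end HomCategories

/-! ### Fair 2-categories -/

/-- A fair 2-category: a functor from the opposite of the fat delta to `Cat` that preserves colours
(vertical morphisms go to equivalences of categories), discrete objects (the only discrete object of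
the fat delta being `pt`) and pullbacks over discrete objects (the Segal condition). -/
structure IsFairTwoCategory (X : FatDeltaᵒᵖ ⥤ Cat.{u, u}) : Prop where
  colours : ∀ {m n : FatDelta} (f : m ⟶ n), FatDelta.vertical f →
    (X.map f.op).toFunctor.IsEquivalence
  discrete : IsDiscrete (X.obj (op FatDelta.pt))
  segal : ∀ m n : FatDelta, IsPullback
    (X.map (FatDelta.inl m n).op) (X.map (FatDelta.inr m n).op)
    (X.map (m.dot (Fin.last m.len)).op) (X.map (n.dot 0).op)

/-- The category of fair 2-categories, a full subcategory of the category of diagrams. -/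
abbrev FairTwoCat : Type (u + 1) :=
  ObjectProperty.FullSubcategory (IsFairTwoCategory : ObjectProperty (FatDeltaᵒᵖ ⥤ Cat.{u, u}))

/-- The truncation `(p₁ X)_n = p (X_n)`, where `p` is the set of isomorphism classes of objects;
`n` runs over the ordinals without links and injective monotone maps. -/
def fairTruncation : (FatDeltaᵒᵖ ⥤ Cat.{u, u}) ⥤ (SemiSimplexCategoryᵒᵖ ⥤ Type u) :=
  (Functor.whiskeringLeft _ _ _).obj FatDelta.ofSemiSimplex.op ⋙
    (Functor.whiskeringRight _ _ _).obj isomorphismClasses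

/-- The nerve of a category, restricted to the injective monotone maps. It is faithful and
injective on isomorphism classes, since the identities of a category are determined by its
composition; through it categories are identified with certain semi-simplicial sets. -/
def semiNerve : Cat.{u, u} ⥤ (SemiSimplexCategoryᵒᵖ ⥤ Type u) :=
  nerveFunctor ⋙ (Functor.whiskeringLeft _ _ _).obj SemiSimplexCategory.toSimplexCategory.op

/-- 2-equivalences of fair 2-categories: all functors between hom-categories are equivalences, and
so is the functor between the truncations (identified with a functor between small categories). -/
structure IsFairTwoEquivalence {X Y : FatDeltaᵒᵖ ⥤ Cat.{u, u}} (f : X ⟶ Y) : Prop where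
  hom : ∀ a b : X.obj (op FatDelta.pt),
    (homCatMap f (FatDelta.arrow.dot 0) (FatDelta.arrow.dot 1) a b).IsEquivalence
  truncation : ∃ (C D : Cat.{u, u}) (F : C ⟶ D), F.toFunctor.IsEquivalence ∧
    Nonempty (Arrow.mk (fairTruncation.map f) ≅ Arrow.mk (semiNerve.map F))

/-- The class of 2-equivalences in the category of fair 2-categories. -/
def fairTwoEquivalences : MorphismProperty FairTwoCat.{u} :=
  fun _ _ f => IsFairTwoEquivalence f.hom

/-! ### Tamsamani 2-categories -/

section Tamsamani

variable (X : SimplexCategoryᵒᵖ ⥤ Cat.{u, u})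

/-- The objects `(x_1, …, x_k)` of the iterated fibre product `X_1 ×_{X_0} ⋯ ×_{X_0} X_1`: the
target of each `x_i` is the source of `x_{i+1}`. When `X_0` is discrete, the compatibility
condition on morphisms is automatic, so that the fibre product is the full subcategory of
`X_1 × ⋯ × X_1` on these objects. -/
def chainObjects (k : ℕ) : ObjectProperty (Fin k → X.obj (op ⦋1⦌)) :=
  fun x => ∀ i j : Fin k, i.1 + 1 = j.1 →
    (X.map (SimplexCategory.δ (n := 0) 0).op).toFunctor.obj (x i) =
      (X.map (SimplexCategory.δ (n := 0) 1).op).toFunctor.obj (x j)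

/-- The iterated fibre product `X_1 ×_{X_0} ⋯ ×_{X_0} X_1` of `k` factors (for discrete `X_0`). -/
abbrev ChainCat (k : ℕ) : Type u := (chainObjects X k).FullSubcategory

lemma chainObjects_spine (k : ℕ) (x : X.obj (op ⦋k⦌)) :
    chainObjects X k
      (fun i => (X.map (SimplexCategory.mkOfSucc i).op).toFunctor.obj x) := by
  intro i j hij
  have h : ∀ (d : ⦋0⦌ ⟶ ⦋1⦌) (i : Fin k),
      (X.map d.op).toFunctor.obj ((X.map (SimplexCategory.mkOfSucc i).op).toFunctor.obj x) =
        (X.map (d ≫ SimplexCategory.mkOfSucc i).op).toFunctor.obj x := by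
    intro d i
    rw [op_comp, X.map_comp]
    rfl
  have hij' : i.succ = j.castSucc := Fin.ext hij
  change (X.map _).toFunctor.obj ((X.map _).toFunctor.obj x) =
    (X.map _).toFunctor.obj ((X.map _).toFunctor.obj x)
  rw [h, h, SimplexCategory.δ_zero_mkOfSucc, SimplexCategory.δ_one_mkOfSucc, hij']

/-- The `k`-th Segal map, with components induced by the maps `[1] ⟶ [k]` with image
`{i, i + 1}`. -/
def segalMap (k : ℕ) : X.obj (op ⦋k⦌) ⥤ ChainCat X k :=
  ObjectProperty.lift _
    (Functor.pi' fun i : Fin k => (X.map (SimplexCategory.mkOfSucc i).op).toFunctor)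
    (chainObjects_spine X k)

/-- A Tamsamani 2-category: a simplicial object in `Cat` with `X_0` discrete, all of whose Segal
maps are equivalences of categories. -/
structure IsTamsamaniTwoCategory : Prop where
  discrete : IsDiscrete (X.obj (op ⦋0⦌))
  segal : ∀ k : ℕ, 2 ≤ k → (segalMap X k).IsEquivalence

end Tamsamani

/-- The category of Tamsamani 2-categories, a full subcategory of the simplicial objects in
`Cat`. -/
abbrev TamsamaniTwoCat : Type (u + 1) :=
  ObjectProperty.FullSubcategory
    (IsTamsamaniTwoCategory : ObjectProperty (SimplexCategoryᵒᵖ ⥤ Cat.{u, u}))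

/-- The truncation `(p₁ X)_n = p (X_n)`. -/
def tamsamaniTruncation : (SimplexCategoryᵒᵖ ⥤ Cat.{u, u}) ⥤ SSet.{u} :=
  (Functor.whiskeringRight _ _ _).obj isomorphismClasses

/-- 2-equivalences of Tamsamani 2-categories: all functors between hom-categories are equivalences,
and so is the functor between the truncations (simplicial sets that are identified, through the
nerve functor, with small categories). -/
structure IsTamsamaniTwoEquivalence {X Y : SimplexCategoryᵒᵖ ⥤ Cat.{u, u}} (f : X ⟶ Y) : Prop where
  hom : ∀ a b : X.obj (op ⦋0⦌),
    (homCatMap f (SimplexCategory.δ (n := 0) 1) (SimplexCategory.δ (n := 0) 0) a b).IsEquivalence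
  truncation : ∃ (C D : Cat.{u, u}) (F : C ⟶ D), F.toFunctor.IsEquivalence ∧
    Nonempty (Arrow.mk (tamsamaniTruncation.map f) ≅ Arrow.mk (nerveFunctor.{u, u}.map F))

/-- The class of 2-equivalences in the category of Tamsamani 2-categories. -/
def tamsamaniTwoEquivalences : MorphismProperty TamsamaniTwoCat.{u} :=
  fun _ _ f => IsTamsamaniTwoEquivalence f.hom

/-!
A fair 2-category composes its cells strictly but has no strict identities; a Tamsamani 2-category
has strict identities but composes only up to equivalence. Both are special cases of the *weak
2-categories* over the fat delta (`FatDelta.IsWeakTwoCategory`): the diagrams with a discrete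
category of objects in which the vertical morphisms and the Segal maps are only required to be
equivalences. Fair 2-categories are weak because iterated concatenations of the edge compute the
spines (`FatDelta.isWeakTwoCategory_of_isFairTwoCategory`). As for Tamsamani 2-categories, the
contraction of links exhibits `Δ` as the localization of the fat delta at the vertical morphisms
(`FatDelta.contract_isLocalization`), and so they are, up to isomorphism, the weak 2-categories that
send the vertical morphisms to isomorphisms (`FatDelta.InvertsVertical`).

The heart of the argument is a functorial strictification `FatDelta.strictify` of a weak 2-category
`X` that is fair and inverts the vertical morphisms at the same time. Let `P X` be the free category
on the objects and the 1-cells of `X`. A composable sequence in the nerve of `P X`, indexed by the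
contraction of a semi-ordinal `m`, is called a pasting over `m`. Attaching to `m` the chain of all
the 1-cells of a pasting (as a cograph, in which a dot of `m` is linked to its place on the chain)
yields a semi-ordinal that contains the chain vertically. The weak Segal condition fills the chain,
uniquely up to unique isomorphism, and the restriction of the filler to `m` is an object of `X_m`.
These objects form a family that is pseudo-natural in both `m` and `X`
(`FatDelta.pastedFamily`). Every object of `X_m` is isomorphic to one of them
(`FatDelta.exists_pasting`), and so the categories with the pastings as objects and with the
morphisms of `X_m` form a diagram that is levelwise equivalent to `X`. Its objects satisfy the
strict Segal condition and depend only on the contraction of `m`, by construction. The diagram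
`FatDelta.presentedCells` of cells with a presentation as a pasting provides a zigzag of levelwise
equivalences between `X` and its strictification. It is fair if `X` is, and inverts the vertical
morphisms if `X` does.

The truncation of a weak 2-category is the nerve of a category (`FatDelta.exists_iso_semiNerve`), so
that levelwise equivalences are 2-equivalences. Hence the zigzags show that the fair 2-categories
and the Tamsamani 2-categories each have the same localization as all the weak 2-categories
(`FatDelta.nonempty_localization_equivalence_weak`). The two notions of 2-equivalence agree since a
category is determined by its semi-simplicial nerve, identities included
(`isEquivalence_of_semiNerve`).
-/

/-! ### Classes of dots and the contraction of links -/

namespace FatDelta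

open Classical in
/-- The number of edges before the dot `i` that are not links. Two dots are equiconnected iff they
have the same class, so that the classes are the elements of the ordinal obtained by contracting the
links. -/
noncomputable def cls (m : FatDelta) (i : m.Dot) : ℕ :=
  (Finset.univ.filter fun e : Fin m.len => e ∉ m.links ∧ e.castSucc < i).card

open Classical in
/-- The number of edges that are not links. -/
noncomputable def rank (m : FatDelta) : ℕ :=
  (Finset.univ.filter fun e : Fin m.len => e ∉ m.links).card

lemma cls_mono (m : FatDelta) : Monotone m.cls := fun _ _ h =>
  Finset.card_le_card fun e he => by
    simp only [Finset.mem_filter, Finset.mem_univ, true_and] at he ⊢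
    exact ⟨he.1, he.2.trans_le h⟩

lemma cls_le_rank (m : FatDelta) (i : m.Dot) : m.cls i ≤ m.rank :=
  Finset.card_le_card fun e he => by
    simp only [Finset.mem_filter, Finset.mem_univ, true_and] at he ⊢
    exact he.1

lemma cls_zero (m : FatDelta) : m.cls 0 = 0 := by
  simp [cls]

lemma cls_last (m : FatDelta) : m.cls (Fin.last m.len) = m.rank := by
  classical
  exact congrArg Finset.card (Finset.filter_congr fun e _ => by simp [Fin.castSucc_lt_last])

lemma cls_succ_le (m : FatDelta) (e : Fin m.len) : m.cls e.succ ≤ m.cls e.castSucc + 1 := by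
  classical
  refine (Finset.card_le_card (t := insert e _) ?_).trans (Finset.card_insert_le _ _)
  intro e' he'
  simp only [Finset.mem_filter, Finset.mem_univ, true_and, Finset.mem_insert, Fin.lt_def,
    Fin.val_succ, Fin.val_castSucc, Fin.ext_iff] at he' ⊢
  by_cases h : e'.1 = e.1
  · exact Or.inl h
  · exact Or.inr ⟨he'.1, by omega⟩

lemma cls_eq_iff (m : FatDelta) {i j : m.Dot} (h : i ≤ j) :
    m.cls i = m.cls j ↔ m.Coloured i j := by
  classical
  have hsub : (Finset.univ.filter fun e : Fin m.len => e ∉ m.links ∧ e.castSucc < i) ⊆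
      Finset.univ.filter fun e : Fin m.len => e ∉ m.links ∧ e.castSucc < j := fun e he => by
    simp only [Finset.mem_filter, Finset.mem_univ, true_and] at he ⊢
    exact ⟨he.1, he.2.trans_le h⟩
  constructor
  · intro heq e h₁ h₂
    by_contra hl
    have := (Finset.eq_of_subset_of_card_le hsub heq.ge).ge
      (show e ∈ _ by
        simp only [Finset.mem_filter, Finset.mem_univ, true_and]
        exact ⟨hl, Fin.castSucc_lt_iff_succ_le.2 h₂⟩)
    simp only [Finset.mem_filter, Finset.mem_univ, true_and] at this
    exact absurd this.2 (not_lt.2 h₁)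
  · intro hc
    refine congrArg Finset.card (hsub.antisymm fun e he => ?_)
    simp only [Finset.mem_filter, Finset.mem_univ, true_and] at he ⊢
    refine ⟨he.1, ?_⟩
    by_contra hl
    exact he.1 (hc e (not_lt.1 hl) (Fin.castSucc_lt_iff_succ_le.1 he.2))

lemma cls_eq_iff_equiconnected (m : FatDelta) (i j : m.Dot) :
    m.cls i = m.cls j ↔ m.equiconnected i j := by
  have key : ∀ i j : m.Dot, j ≤ i → m.Coloured i j := fun i j h e h₁ h₂ => by
    have := Fin.le_def.1 (h₂.trans (h.trans h₁))
    simp at this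
  rcases le_total i j with h | h
  · exact (m.cls_eq_iff h).trans ⟨fun hc => ⟨hc, key _ _ h⟩, fun hc => hc.1⟩
  · exact (eq_comm.trans (m.cls_eq_iff h)).trans ⟨fun hc => ⟨key _ _ h, hc⟩, fun hc => hc.2⟩

lemma exists_cls_eq (m : FatDelta) (c : ℕ) (hc : c ≤ m.rank) : ∃ i, m.cls i = c := by
  by_contra! hne
  have key : ∀ i : ℕ, ∀ h : i < m.len + 1, m.cls ⟨i, h⟩ < c := by
    intro i
    induction i with
    | zero =>
      intro h
      have h₀ := hne 0
      have h₁ : m.cls ⟨0, h⟩ = 0 := m.cls_zero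
      rw [m.cls_zero] at h₀
      omega
    | succ i ih =>
      intro h
      have h₁ := ih (by omega)
      have h₂ : m.cls ⟨i + 1, h⟩ ≤ m.cls ⟨i, by omega⟩ + 1 := m.cls_succ_le ⟨i, by omega⟩
      have h₃ := hne ⟨i + 1, h⟩
      omega
  have h := key m.len (by omega)
  have h' : m.cls ⟨m.len, by omega⟩ = m.rank := m.cls_last
  omega

lemma hom_cls {m n : FatDelta} (f : m ⟶ n) {i j : m.Dot} (h : m.cls i = m.cls j) :
    n.cls (f.toFun i) = n.cls (f.toFun j) := by
  rw [cls_eq_iff_equiconnected] at h ⊢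
  exact Hom.equiconnected_map f i j h

lemma hom_cls_le {m n : FatDelta} (f : m ⟶ n) {i j : m.Dot} (h : m.cls i ≤ m.cls j) :
    n.cls (f.toFun i) ≤ n.cls (f.toFun j) := by
  rcases h.eq_or_lt with h | h
  · exact (hom_cls f h).le
  · exact n.cls_mono (f.strictMono.monotone (le_of_not_ge fun h' => (m.cls_mono h').not_gt h))

/-- Constructor for morphisms in terms of classes. -/
def homMk {m n : FatDelta} (f : m.Dot → n.Dot) (hf : StrictMono f)
    (hc : ∀ i j, i < j → m.cls i = m.cls j → n.cls (f i) = n.cls (f j)) : m ⟶ n where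
  toFun := f
  strictMono := hf
  coloured i j h h' := (n.cls_eq_iff (hf h).le).1 (hc i j h ((m.cls_eq_iff h.le).2 h'))

lemma hom_ext {m n : FatDelta} {f g : m ⟶ n} (h : ∀ i, f.toFun i = g.toFun i) : f = g :=
  Hom.ext (funext h)

lemma vertical_iff {m n : FatDelta} (f : m ⟶ n) :
    vertical f ↔ (∀ i j, n.cls (f.toFun i) = n.cls (f.toFun j) → m.cls i = m.cls j) ∧
      ∀ y, ∃ x, n.cls (f.toFun x) = n.cls y := by
  refine and_congr ⟨fun h i j hij => ?_, fun h => ?_⟩ ⟨fun h y => ?_, fun h => ?_⟩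
  · rw [cls_eq_iff_equiconnected] at hij ⊢
    exact Quotient.exact (h (a₁ := Quotient.mk _ i) (a₂ := Quotient.mk _ j) (Quotient.sound hij))
  · rintro ⟨i⟩ ⟨j⟩ hij
    refine Quotient.sound ((cls_eq_iff_equiconnected _ _ _).1 (h i j ?_))
    exact (cls_eq_iff_equiconnected _ _ _).2 (Quotient.exact hij)
  · obtain ⟨⟨x⟩, hx⟩ := h (Quotient.mk _ y)
    exact ⟨x, (cls_eq_iff_equiconnected _ _ _).2 (Quotient.exact hx)⟩
  · rintro ⟨y⟩
    obtain ⟨x, hx⟩ := h y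
    exact ⟨Quotient.mk _ x, Quotient.sound ((cls_eq_iff_equiconnected _ _ _).1 hx)⟩

/-- The semi-ordinal with `k` edges and no link. -/
abbrev ord (k : ℕ) : FatDelta := ⟨k, ∅⟩

lemma cls_of_links_eq_empty (m : FatDelta) (h : m.links = ∅) (i : m.Dot) : m.cls i = i.1 := by
  classical
  simp only [cls, h, Set.mem_empty_iff_false, not_false_eq_true, true_and]
  rw [Finset.card_eq_of_equiv_fin (n := i.1)]
  refine ⟨fun e => ⟨e.1.1, ?_⟩, fun j => ⟨⟨j.1, ?_⟩, ?_⟩, fun _ => rfl, fun _ => rfl⟩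
  · exact (Finset.mem_filter.1 e.2).2
  · have := j.2; have := i.2; omega
  · simp [Fin.lt_def]

@[simp] lemma cls_ord (k : ℕ) (i : (ord k).Dot) : (ord k).cls i = i.1 :=
  cls_of_links_eq_empty _ rfl i

@[simp] lemma rank_ord (k : ℕ) : (ord k).rank = k := by
  rw [← cls_last, cls_ord]; rfl

/-- The semi-ordinal on a finite linear order, whose links join the consecutive elements with the
same value under a monotone map `c`. -/
noncomputable def ofOrder (P : Type) [Fintype P] [LinearOrder P] [Nonempty P] (c : P → ℕ) :
    FatDelta where
  len := Fintype.card P - 1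
  links := {e | ∀ h : Fintype.card P = Fintype.card P - 1 + 1,
    c ((Fintype.orderIsoFinOfCardEq P h) e.castSucc) =
      c ((Fintype.orderIsoFinOfCardEq P h) e.succ)}

section ofOrder

variable {P : Type} [Fintype P] [LinearOrder P] [Nonempty P] {c : P → ℕ}

/-- The dots of `ofOrder P c` are the elements of `P`. -/
noncomputable def ofOrderDot (c : P → ℕ) : P ≃o (ofOrder P c).Dot :=
  (Fintype.orderIsoFinOfCardEq P (by
    have := Fintype.card_pos (α := P)
    simp only [ofOrder]
    omega)).symm

lemma coloured_ofOrder (hc : Monotone c) {x y : P} (h : x ≤ y) :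
    (ofOrder P c).Coloured (ofOrderDot c x) (ofOrderDot c y) ↔ c x = c y := by
  have hcard : Fintype.card P = Fintype.card P - 1 + 1 := by
    have := Fintype.card_pos (α := P); omega
  have hl : ∀ e : Fin (ofOrder P c).len, e ∈ (ofOrder P c).links ↔
      c ((ofOrderDot c).symm e.castSucc) = c ((ofOrderDot c).symm e.succ) :=
    fun e => ⟨fun h => h hcard, fun h _ => h⟩
  constructor
  · intro hcol
    have key : ∀ d : ℕ, ∀ h : (ofOrderDot c x).1 + d < (ofOrder P c).len + 1,
        (ofOrderDot c x).1 + d ≤ (ofOrderDot c y).1 →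
        c x = c ((ofOrderDot c).symm ⟨(ofOrderDot c x).1 + d, h⟩) := by
      intro d
      induction d with
      | zero => intro h _; simp
      | succ d ih =>
        intro h hle
        rw [ih (by omega) (by omega)]
        exact (hl ⟨(ofOrderDot c x).1 + d, by omega⟩).1 (hcol _ (by simp [Fin.le_def])
          (Fin.le_def.2 (by simp only [Fin.val_succ]; omega)))
    have hxy : (ofOrderDot c x).1 ≤ (ofOrderDot c y).1 := (ofOrderDot c).monotone h
    have h₁ := key ((ofOrderDot c y).1 - (ofOrderDot c x).1) (by omega) (by omega)
    rw [h₁]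
    congr 1
    rw [OrderIso.symm_apply_eq]
    exact Fin.ext (by simp only []; omega)
  · intro hxy e h₁ h₂
    rw [hl]
    have a₁ := hc ((ofOrderDot c).le_symm_apply.2 h₁)
    have a₂ := hc ((ofOrderDot c).symm_apply_le.2 h₂)
    have a₃ := hc ((ofOrderDot c).symm.monotone (Fin.castSucc_lt_succ (i := e)).le)
    omega

lemma cls_ofOrder (hc : Monotone c) (x y : P) :
    (ofOrder P c).cls (ofOrderDot c x) = (ofOrder P c).cls (ofOrderDot c y) ↔ c x = c y := by
  rcases le_total x y with h | h
  · rw [cls_eq_iff _ ((ofOrderDot c).monotone h), coloured_ofOrder hc h]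
  · rw [eq_comm, cls_eq_iff _ ((ofOrderDot c).monotone h), coloured_ofOrder hc h, eq_comm]

end ofOrder

/-! ### The cograph of a map to an ordinal -/

/-- The dots of the cograph of a map `φ` from the dots of `m` to `{0, …, k}`: the dots of `m`
together with the base dots `0, …, k`. -/
inductive CographDot (m : FatDelta) (φ : m.Dot → ℕ) (k : ℕ) : Type where
  | dot (i : m.Dot)
  | base (j : Fin (k + 1))

namespace CographDot

variable {m : FatDelta} {φ : m.Dot → ℕ} {k : ℕ}

/-- The value of a dot of the cograph in `{0, …, k}`. -/
def val (x : CographDot m φ k) : ℕ :=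
  match x with
  | dot i => φ i
  | base j => j.1

/-- The dots of `m` over the base dot `j` come in their order just before `j`. -/
def key (x : CographDot m φ k) : ℕ ×ₗ ℕ :=
  match x with
  | dot i => toLex (φ i, i.1)
  | base j => toLex (j.1, m.len + 1)

lemma key_injective : Function.Injective (key (m := m) (φ := φ) (k := k)) := by
  rintro (i | j) (i' | j') h <;> have h := congrArg ofLex h <;>
    simp only [key, ofLex_toLex, Prod.mk.injEq] at h
  · rw [Fin.ext h.2]
  · have := i.2; omega
  · have := i'.2; omega
  · rw [Fin.ext h.1]

noncomputable instance : LinearOrder (CographDot m φ k) :=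
  LinearOrder.lift' key key_injective

instance : Nonempty (CographDot m φ k) := ⟨base 0⟩

noncomputable instance : Fintype (CographDot m φ k) :=
  Fintype.ofSurjective (Sum.elim dot base) (by
    rintro (i | j)
    · exact ⟨Sum.inl i, rfl⟩
    · exact ⟨Sum.inr j, rfl⟩)

lemma lt_iff (x y : CographDot m φ k) : x < y ↔ key x < key y := Iff.rfl

lemma le_iff (x y : CographDot m φ k) : x ≤ y ↔ key x ≤ key y := Iff.rfl

lemma val_mono : Monotone (val (m := m) (φ := φ) (k := k)) := by
  intro x y h
  rw [le_iff, Prod.Lex.le_iff] at h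
  rcases x with i | j <;> rcases y with i' | j' <;>
    simp only [key, ofLex_toLex, val] at h ⊢ <;> omega

end CographDot

/-- The cograph of a map `φ` from the dots of `m` to `{0, …, k}`. The edges between dots with the
same value are links. Both `m` and the base `[k]` embed in it, the latter by a vertical morphism, so
that the cograph represents `φ` as a zigzag of morphisms of the fat delta. -/
noncomputable def cograph (m : FatDelta) (φ : m.Dot → ℕ) (k : ℕ) : FatDelta :=
  ofOrder (CographDot m φ k) CographDot.val

/-- A map from the dots of `m` to `{0, …, k}` that is monotone and constant on the classes. -/
structure IsClassMap (m : FatDelta) (φ : m.Dot → ℕ) (k : ℕ) : Prop where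
  mono : Monotone φ
  cls : ∀ i j, m.cls i = m.cls j → φ i = φ j
  le : ∀ i, φ i ≤ k

lemma IsClassMap.of_mono {k : ℕ} (φ : (ord k).Dot → ℕ) (hφ : Monotone φ) {l : ℕ}
    (h : ∀ i, φ i ≤ l) : IsClassMap (ord k) φ l :=
  ⟨hφ, fun i j h => by
    rw [cls_ord, cls_ord] at h
    rw [Fin.ext h], h⟩

lemma IsClassMap.comp {m n : FatDelta} {φ : n.Dot → ℕ} {k : ℕ} (h : IsClassMap n φ k)
    (f : m ⟶ n) : IsClassMap m (fun i => φ (f.toFun i)) k :=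
  ⟨h.mono.comp f.strictMono.monotone, fun _ _ hij => h.cls _ _ (hom_cls f hij), fun _ => h.le _⟩

section cograph

variable {m : FatDelta} {φ : m.Dot → ℕ} {k : ℕ}

lemma cls_cograph (x y : CographDot m φ k) :
    (cograph m φ k).cls (ofOrderDot _ x) = (cograph m φ k).cls (ofOrderDot _ y) ↔
      x.val = y.val :=
  cls_ofOrder CographDot.val_mono x y

/-- The inclusion of `m` in the cograph. -/
noncomputable def toCograph (h : IsClassMap m φ k) : m ⟶ cograph m φ k :=
  homMk (fun i => ofOrderDot _ (CographDot.dot i))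
    (fun i j hij => (ofOrderDot _).strictMono (by
      rw [CographDot.lt_iff, Prod.Lex.lt_iff]
      simp only [CographDot.key, ofLex_toLex]
      have := h.mono hij.le
      have : i.1 < j.1 := hij
      omega))
    (fun i j _ hc => (cls_cograph _ _).2 (h.cls i j hc))

/-- The inclusion of the base in the cograph. -/
noncomputable def base (m : FatDelta) (φ : m.Dot → ℕ) (k : ℕ) : ord k ⟶ cograph m φ k :=
  homMk (fun j => ofOrderDot _ (CographDot.base j))
    (fun i j hij => (ofOrderDot _).strictMono (by
      rw [CographDot.lt_iff, Prod.Lex.lt_iff]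
      simp only [CographDot.key, ofLex_toLex]
      have : i.1 < j.1 := hij
      omega))
    (fun i j hij hc => by
      rw [cls_ord, cls_ord] at hc
      exact absurd hc (Nat.ne_of_lt hij))

lemma cls_toCograph (h : IsClassMap m φ k) (i : m.Dot) :
    (cograph m φ k).cls ((toCograph h).toFun i) =
      (cograph m φ k).cls ((base m φ k).toFun ⟨φ i, Nat.lt_succ_of_le (h.le i)⟩) :=
  (cls_cograph _ _).2 rfl

lemma vertical_base (h : IsClassMap m φ k) : vertical (base m φ k) := by
  rw [vertical_iff]
  refine ⟨fun i j hij => ?_, fun y => ?_⟩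
  · rw [cls_ord, cls_ord]
    exact (cls_cograph _ _).1 hij
  · obtain ⟨x, rfl⟩ := (ofOrderDot _).surjective y
    rcases x with i | j
    · exact ⟨_, (cls_toCograph h i).symm⟩
    · exact ⟨j, rfl⟩

/-- If `φ` is bijective on the classes, the inclusion of `m` in the cograph is vertical. -/
lemma vertical_toCograph (h : IsClassMap m φ k) (hi : ∀ i j, φ i = φ j → m.cls i = m.cls j)
    (hs : ∀ c ≤ k, ∃ i, φ i = c) : vertical (toCograph h) := by
  rw [vertical_iff]
  refine ⟨fun i j hij => hi i j ((cls_cograph _ _).1 hij), fun y => ?_⟩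
  obtain ⟨x, rfl⟩ := (ofOrderDot _).surjective y
  rcases x with i | j
  · exact ⟨i, rfl⟩
  · obtain ⟨i, hj⟩ := hs j.1 (Nat.lt_succ_iff.1 j.2)
    exact ⟨i, (cls_cograph _ _).2 hj⟩

/-- The map on dots of cographs induced by a map of semi-ordinals and the translation by `d`. -/
def CographDot.map {m n : FatDelta} {φ : m.Dot → ℕ} {ψ : n.Dot → ℕ} {k l : ℕ} (f : m ⟶ n) (d : ℕ)
    (hd : k + d ≤ l) (x : CographDot m φ k) : CographDot n ψ l :=
  match x with
  | .dot i => .dot (f.toFun i)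
  | .base j => .base ⟨j.1 + d, by omega⟩

/-- The functoriality of the cograph with respect to translations of the base. -/
noncomputable def cographMap {m n : FatDelta} {φ : m.Dot → ℕ} {ψ : n.Dot → ℕ} {k l : ℕ} (f : m ⟶ n)
    (d : ℕ) (hd : k + d ≤ l) (h : ∀ i, ψ (f.toFun i) = φ i + d) :
    cograph m φ k ⟶ cograph n ψ l :=
  homMk (fun x => ofOrderDot _ (CographDot.map f d hd ((ofOrderDot _).symm x)))
    (fun x y hxy => (ofOrderDot _).strictMono (by
      have hlt := (ofOrderDot (CographDot.val (m := m) (φ := φ) (k := k))).symm.strictMono hxy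
      revert hlt
      generalize (ofOrderDot _).symm x = x
      generalize (ofOrderDot _).symm y = y
      simp only [CographDot.lt_iff, Prod.Lex.lt_iff]
      rcases x with i | j <;> rcases y with i' | j' <;>
        simp only [CographDot.key, ofLex_toLex, CographDot.map, h]
      · have : i.1 < i'.1 → (f.toFun i).1 < (f.toFun i').1 := fun h => f.strictMono h
        omega
      · have := (f.toFun i).2
        omega
      · have := i'.2
        omega
      · omega))
    (fun x y _ hc => by
      obtain ⟨x, rfl⟩ := (ofOrderDot _).surjective x
      obtain ⟨y, rfl⟩ := (ofOrderDot _).surjective y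
      refine (cls_cograph _ _).2 ?_
      have := (cls_cograph x y).1 hc
      simp only [OrderIso.symm_apply_apply]
      rcases x with i | j <;> rcases y with i' | j' <;>
        simp only [CographDot.val, CographDot.map, h] at this ⊢ <;> omega)

@[simp] lemma cographMap_toFun {m n : FatDelta} {φ : m.Dot → ℕ} {ψ : n.Dot → ℕ} {k l : ℕ}
    (f : m ⟶ n) (d : ℕ) (hd : k + d ≤ l) (h : ∀ i, ψ (f.toFun i) = φ i + d)
    (x : CographDot m φ k) :
    (cographMap f d hd h).toFun (ofOrderDot _ x) =
      ofOrderDot _ (CographDot.map f d hd x) := by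
  change ofOrderDot _ (CographDot.map f d hd ((ofOrderDot _).symm (ofOrderDot _ x))) = _
  rw [OrderIso.symm_apply_apply]

lemma toCograph_cographMap {m n : FatDelta} {φ : m.Dot → ℕ} {ψ : n.Dot → ℕ} {k l : ℕ}
    (f : m ⟶ n) (d : ℕ) (hd : k + d ≤ l) (h : ∀ i, ψ (f.toFun i) = φ i + d)
    (hφ : IsClassMap m φ k) (hψ : IsClassMap n ψ l) :
    toCograph hφ ≫ cographMap f d hd h = f ≫ toCograph hψ :=
  hom_ext fun _ => cographMap_toFun f d hd h _

lemma base_cographMap {m n : FatDelta} {φ : m.Dot → ℕ} {ψ : n.Dot → ℕ} {k : ℕ}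
    (f : m ⟶ n) (h : ∀ i, ψ (f.toFun i) = φ i) :
    base m φ k ≫ cographMap f 0 le_rfl h = base n ψ k :=
  hom_ext fun _ => cographMap_toFun f 0 le_rfl h _

end cograph

end FatDelta

/-! ### The contraction of links is a localization -/

namespace FatDelta

/-- The projection of the dots of `m` to the ordinal obtained by contracting the links. -/
noncomputable def proj (m : FatDelta) (i : m.Dot) : Fin (m.rank + 1) :=
  ⟨m.cls i, Nat.lt_succ_of_le (m.cls_le_rank i)⟩

lemma proj_surjective (m : FatDelta) : Function.Surjective m.proj := fun c => by
  obtain ⟨i, hi⟩ := m.exists_cls_eq c.1 (Nat.lt_succ_iff.1 c.2)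
  exact ⟨i, Fin.ext hi⟩

/-- A dot in a given class. -/
noncomputable def sec (m : FatDelta) (c : Fin (m.rank + 1)) : m.Dot :=
  (m.proj_surjective c).choose

@[simp] lemma proj_sec (m : FatDelta) (c : Fin (m.rank + 1)) : m.proj (m.sec c) = c :=
  (m.proj_surjective c).choose_spec

@[simp] lemma cls_sec (m : FatDelta) (c : Fin (m.rank + 1)) : m.cls (m.sec c) = c.1 :=
  congrArg Fin.val (m.proj_sec c)

/-- The contraction of links. -/
noncomputable def contract : FatDelta ⥤ SimplexCategory where
  obj m := ⦋m.rank⦌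
  map {m n} f := SimplexCategory.Hom.mk
    ⟨fun c => n.proj (f.toFun (m.sec c)), fun c c' h => hom_cls_le f (by simpa using h)⟩
  map_id m := by
    ext c : 3
    exact m.proj_sec c
  map_comp {m n p} f g := by
    ext c : 3
    exact Fin.ext (hom_cls g (by simp [proj]))

lemma contract_map_proj {m n : FatDelta} (f : m ⟶ n) (i : m.Dot) :
    (contract.map f).toOrderHom (m.proj i) = n.proj (f.toFun i) :=
  Fin.ext (hom_cls f (by rw [cls_sec]; rfl))

lemma contract_hom_ext {m : FatDelta} {n : SimplexCategory} {f g : contract.obj m ⟶ n}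
    (h : ∀ i, f.toOrderHom (m.proj i) = g.toOrderHom (m.proj i)) : f = g := by
  ext c : 3
  obtain ⟨i, rfl⟩ := m.proj_surjective c
  exact h i

lemma contract_map_eq_iff {m n : FatDelta} (f g : m ⟶ n) :
    contract.map f = contract.map g ↔ ∀ i, n.cls (f.toFun i) = n.cls (g.toFun i) := by
  constructor
  · intro h i
    have h₁ := contract_map_proj f i
    rw [h, contract_map_proj g i] at h₁
    exact (congrArg Fin.val h₁).symm
  · intro h
    refine contract_hom_ext fun i => ?_
    rw [contract_map_proj, contract_map_proj]
    exact Fin.ext (h i)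

lemma isIso_contract_map_iff {m n : FatDelta} (f : m ⟶ n) :
    IsIso (contract.map f) ↔ vertical f := by
  rw [vertical_iff]
  constructor
  · intro _
    constructor
    · intro i j hij
      have h := congrArg (inv (contract.map f)).toOrderHom
        ((contract_map_proj f i).trans ((Fin.ext hij).trans (contract_map_proj f j).symm))
      have key : ∀ c, (inv (contract.map f)).toOrderHom ((contract.map f).toOrderHom c) = c := by
        intro c
        have := IsIso.hom_inv_id (contract.map f)
        exact congrArg (fun g => (SimplexCategory.Hom.toOrderHom g) c) this
      exact congrArg Fin.val ((key (m.proj i)).symm.trans (h.trans (key (m.proj j))))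
    · intro y
      have key : ∀ c, (contract.map f).toOrderHom ((inv (contract.map f)).toOrderHom c) = c := by
        intro c
        have := IsIso.inv_hom_id (contract.map f)
        exact congrArg (fun g => (SimplexCategory.Hom.toOrderHom g) c) this
      obtain ⟨x, hx⟩ := m.proj_surjective ((inv (contract.map f)).toOrderHom (n.proj y))
      refine ⟨x, congrArg Fin.val (?_ : n.proj _ = n.proj y)⟩
      exact (contract_map_proj f x).symm.trans
        ((congrArg (contract.map f).toOrderHom hx).trans (key (n.proj y)))
  · rintro ⟨hi, hs⟩
    have hb : Function.Bijective (contract.map f).toOrderHom := by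
      constructor
      · intro c c' h
        obtain ⟨i, rfl⟩ := m.proj_surjective c
        obtain ⟨j, rfl⟩ := m.proj_surjective c'
        rw [contract_map_proj, contract_map_proj] at h
        exact Fin.ext (hi i j (congrArg Fin.val h))
      · intro c
        obtain ⟨y, rfl⟩ := n.proj_surjective c
        obtain ⟨x, hx⟩ := hs y
        exact ⟨m.proj x, by rw [contract_map_proj]; exact Fin.ext hx⟩
    have : IsIso ((forget SimplexCategory).map (contract.map f)) := by
      rw [isIso_iff_bijective]
      exact hb
    exact isIso_of_reflects_iso _ (forget SimplexCategory)

lemma vertical_isInvertedBy_contract : vertical.IsInvertedBy contract :=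
  fun _ _ f hf => (isIso_contract_map_iff f).2 hf

lemma isClassMap_cls (m : FatDelta) : IsClassMap m m.cls m.rank :=
  ⟨m.cls_mono, fun _ _ h => h, m.cls_le_rank⟩

lemma vertical_toCograph_cls (m : FatDelta) : vertical (toCograph m.isClassMap_cls) :=
  vertical_toCograph _ (fun _ _ h => h) m.exists_cls_eq

section Localization

universe v' u'

variable {D : Type u'} [Category.{v'} D] (F : FatDelta ⥤ D) (hF : vertical.IsInvertedBy F)

include hF in
/-- The two morphisms `toCograph ≫ cographMap a` and `toCograph ≫ cographMap b` agree after
inverting the vertical morphisms, since `cographMap a` and `cographMap b` agree on the base. -/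
lemma map_eq_of_contract_map_eq {m n : FatDelta} (a b : m ⟶ n)
    (h : contract.map a = contract.map b) : F.map a = F.map b := by
  rw [contract_map_eq_iff] at h
  have hφ : IsClassMap m (fun i => n.cls (a.toFun i)) n.rank := n.isClassMap_cls.comp a
  let A : cograph m (fun i => n.cls (a.toFun i)) n.rank ⟶ cograph n n.cls n.rank :=
    cographMap a 0 le_rfl fun _ => rfl
  let B : cograph m (fun i => n.cls (a.toFun i)) n.rank ⟶ cograph n n.cls n.rank :=
    cographMap b 0 le_rfl fun i => (h i).symm
  have := hF _ (vertical_base hφ)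
  have := hF _ n.vertical_toCograph_cls
  have hAB : F.map A = F.map B := by
    rw [← cancel_epi (F.map (base m (fun i => n.cls (a.toFun i)) n.rank)), ← F.map_comp,
      ← F.map_comp]
    exact congrArg F.map ((base_cographMap _ _).trans (base_cographMap _ _).symm)
  rw [← cancel_mono (F.map (toCograph n.isClassMap_cls)), ← F.map_comp, ← F.map_comp,
    ← toCograph_cographMap a 0 le_rfl (fun _ => rfl) hφ n.isClassMap_cls,
    ← toCograph_cographMap b 0 le_rfl (fun i => (h i).symm) hφ n.isClassMap_cls,
    F.map_comp, F.map_comp]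
  exact congrArg _ hAB

/-- The morphism `F m ⟶ F [k]` induced by a monotone map of the classes of `m` to `{0, …, k}`, if
`F` inverts the vertical morphisms. -/
noncomputable def classHom {m : FatDelta} {φ : m.Dot → ℕ} {k : ℕ} (h : IsClassMap m φ k) :
    F.obj m ⟶ F.obj (ord k) :=
  haveI := hF _ (vertical_base h)
  F.map (toCograph h) ≫ inv (F.map (base m φ k))

lemma classHom_comp_base {m : FatDelta} {φ : m.Dot → ℕ} {k : ℕ} (h : IsClassMap m φ k) :
    classHom F hF h ≫ F.map (base m φ k) = F.map (toCograph h) := by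
  have := hF _ (vertical_base h)
  simp [classHom]

lemma classHom_congr {m : FatDelta} {φ ψ : m.Dot → ℕ} {k : ℕ} (h : IsClassMap m φ k)
    (h' : IsClassMap m ψ k) (e : ∀ i, φ i = ψ i) : classHom F hF h = classHom F hF h' := by
  obtain rfl := funext e
  rfl

/-- The zigzags of cographs are natural. -/
lemma map_comp_classHom {m n : FatDelta} {φ : n.Dot → ℕ} {k : ℕ} (h : IsClassMap n φ k)
    (f : m ⟶ n) : F.map f ≫ classHom F hF h = classHom F hF (h.comp f) := by
  have hb := hF _ (vertical_base h)
  rw [← cancel_mono (F.map (base n φ k)), Category.assoc, classHom_comp_base,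
    ← base_cographMap (φ := fun i => φ (f.toFun i)) f (fun _ => rfl), F.map_comp,
    ← Category.assoc, classHom_comp_base, ← F.map_comp, ← F.map_comp,
    toCograph_cographMap f 0 le_rfl (fun _ => rfl) (h.comp f) h]

lemma classHom_ord_id (k : ℕ) (h : IsClassMap (ord k) (fun i => i.1) k) :
    classHom F hF h = 𝟙 _ := by
  have hb := hF _ (vertical_base h)
  rw [← cancel_mono (F.map (base (ord k) (fun i => i.1) k)), classHom_comp_base, Category.id_comp]
  refine map_eq_of_contract_map_eq F hF _ _ ((contract_map_eq_iff _ _).2 fun i => ?_)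
  exact cls_toCograph h i

lemma classHom_comp_classHom {m : FatDelta} {φ : m.Dot → ℕ} {k l : ℕ} (h : IsClassMap m φ k)
    {ψ : (ord k).Dot → ℕ} (h' : IsClassMap (ord k) ψ l)
    (h'' : IsClassMap m (fun i => ψ ⟨φ i, Nat.lt_succ_of_le (h.le i)⟩) l) :
    classHom F hF h ≫ classHom F hF h' = classHom F hF h'' := by
  -- `ψ` is extended along the vertical inclusion of the base to the cograph of `φ`; the induced
  -- morphism is compared with those of its restrictions to the base and to `m`
  have hex : ∀ x : (cograph m φ k).Dot, ∃ y : (ord k).Dot,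
      (cograph m φ k).cls ((base m φ k).toFun y) = (cograph m φ k).cls x :=
    ((vertical_iff _).1 (vertical_base h)).2
  have hinj := ((vertical_iff _).1 (vertical_base h)).1
  choose r hr using hex
  have hr' : ∀ y, r ((base m φ k).toFun y) = y := fun y => by
    have := hinj _ _ (hr ((base m φ k).toFun y))
    rw [cls_ord, cls_ord] at this
    exact Fin.ext this
  have hχ : IsClassMap (cograph m φ k) (fun x => ψ (r x)) l := by
    refine ⟨fun x y hxy => h'.mono ?_, fun x y hxy => h'.cls _ _ (hinj _ _ ?_), fun x => h'.le _⟩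
    · by_contra hlt
      have h₁ := (cograph m φ k).cls_mono
        ((base m φ k).strictMono.monotone (le_of_not_ge hlt))
      have h₂ := (cograph m φ k).cls_mono hxy
      rw [hr, hr] at h₁
      have h₃ := hinj (r x) (r y) (by rw [hr, hr]; omega)
      rw [cls_ord, cls_ord] at h₃
      exact hlt (Fin.ext h₃).le
    · rw [hr, hr, hxy]
  have hb := hF _ (vertical_base h)
  have e₁ := map_comp_classHom F hF hχ (base m φ k)
  have e₂ := map_comp_classHom F hF hχ (toCograph h)
  rw [classHom_congr F hF (hχ.comp (base m φ k)) h' (fun y => congrArg ψ (hr' y))] at e₁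
  rw [classHom_congr F hF (hχ.comp (toCograph h)) h'' (fun i => ?_)] at e₂
  · rw [← e₁, ← Category.assoc, classHom_comp_base, e₂]
  · refine congrArg ψ ((?_ : r _ = r _).trans (hr' _))
    have := hinj _ _ ((hr _).trans ((cls_toCograph h i).trans (hr _).symm))
    rw [cls_ord, cls_ord] at this
    exact Fin.ext this

lemma isClassMap_toOrderHom {n k : SimplexCategory} (α : n ⟶ k) :
    IsClassMap (ord n.len) (fun i => (α.toOrderHom i).1) k.len :=
  .of_mono _ (fun _ _ h => α.toOrderHom.monotone h) fun i => Nat.lt_succ_iff.1 (α.toOrderHom i).2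

/-- The extension to `Δ` of a functor that inverts the vertical morphisms. -/
noncomputable def descend : SimplexCategory ⥤ D where
  obj n := F.obj (ord n.len)
  map α := classHom F hF (isClassMap_toOrderHom α)
  map_id n := classHom_ord_id F hF n.len _
  map_comp α β := (classHom_comp_classHom F hF (isClassMap_toOrderHom α) (isClassMap_toOrderHom β)
    (isClassMap_toOrderHom (α ≫ β))).symm

lemma isIso_classHom_cls (m : FatDelta) : IsIso (classHom F hF m.isClassMap_cls) := by
  have := hF _ (vertical_base m.isClassMap_cls)
  have := hF _ m.vertical_toCograph_cls
  unfold classHom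
  infer_instance

/-- A functor that inverts the vertical morphisms factors through `Δ`: every semi-ordinal `m` is
linked by vertical morphisms to its contraction, by way of the cograph of its class map. -/
noncomputable def contractCompDescendIso : contract ⋙ descend F hF ≅ F :=
  (NatIso.ofComponents (F := F) (G := contract ⋙ descend F hF) (fun m =>
    haveI := isIso_classHom_cls F hF m
    (asIso (classHom F hF m.isClassMap_cls) : F.obj m ≅ F.obj (ord m.rank))) (fun {m n} f => by
      simp only [Functor.comp_map]
      refine (map_comp_classHom F hF n.isClassMap_cls f).trans ?_
      refine Eq.trans ?_ (classHom_comp_classHom F hF m.isClassMap_cls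
        (isClassMap_toOrderHom (contract.map f)) ?_).symm
      · exact classHom_congr F hF _ _ fun i =>
          (congrArg Fin.val (contract_map_proj f i)).symm
      · refine ⟨fun i j h => ?_, fun i j h => ?_, fun i => Nat.lt_succ_iff.1 (Fin.is_lt _)⟩
        · exact (contract.map f).toOrderHom.monotone (m.cls_mono h)
        · simp only [h])).symm

end Localization

/-- Contraction of links does nothing to the semi-ordinals without links. -/
noncomputable def contractOrdIso (k : ℕ) : contract.obj (ord k) ≅ ⦋k⦌ :=
  eqToIso (show ⦋(ord k).rank⦌ = ⦋k⦌ from congrArg SimplexCategory.mk (rank_ord k))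

lemma eqToHom_toOrderHom {k l : ℕ} (h : SimplexCategory.mk k = SimplexCategory.mk l)
    (i : Fin (k + 1)) : ((eqToHom h).toOrderHom i).1 = i.1 := by
  obtain rfl : k = l := congrArg SimplexCategory.len h
  rfl

lemma contractOrdIso_hom_apply (k : ℕ) (i : Fin ((ord k).rank + 1)) :
    ((contractOrdIso k).hom.toOrderHom i).1 = i.1 :=
  eqToHom_toOrderHom (congrArg SimplexCategory.mk (rank_ord k)) i

/-- The contraction of links exhibits `Δ` as the localization of the fat delta at the vertical
morphisms. -/
instance contract_isLocalization : contract.IsLocalization vertical := by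
  have hQ := vertical.Q_inverts
  let L := Localization.lift contract vertical_isInvertedBy_contract vertical.Q
  let e : vertical.Q ⋙ L ≅ contract := Localization.fac _ _ _
  let G := descend vertical.Q hQ
  let unit : 𝟭 _ ≅ L ⋙ G := Localization.liftNatIso vertical.Q vertical vertical.Q
    (contract ⋙ G) _ _ (contractCompDescendIso vertical.Q hQ).symm
  let counit : G ⋙ L ≅ 𝟭 _ :=
    NatIso.ofComponents (fun n => e.app (ord n.len) ≪≫ contractOrdIso n.len) (by
      intro n k α
      let b := base (ord n.len) (fun i => (α.toOrderHom i).1) k.len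
      let a := toCograph (isClassMap_toOrderHom α)
      have h : L.map (classHom vertical.Q hQ (isClassMap_toOrderHom α)) ≫
          (vertical.Q ⋙ L).map b = (vertical.Q ⋙ L).map a :=
        (L.map_comp _ _).symm.trans
          (congrArg L.map (classHom_comp_base vertical.Q hQ (isClassMap_toOrderHom α)))
      have hb := (isIso_contract_map_iff b).2 (vertical_base (isClassMap_toOrderHom α))
      change L.map (classHom vertical.Q hQ (isClassMap_toOrderHom α)) ≫ e.hom.app (ord k.len) ≫
        (contractOrdIso k.len).hom = (e.hom.app (ord n.len) ≫ (contractOrdIso n.len).hom) ≫ α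
      have h₂ : contract.map a =
          ((contractOrdIso n.len).hom ≫ α ≫ (contractOrdIso k.len).inv) ≫ contract.map b := by
        refine contract_hom_ext fun i => ?_
        rw [contract_map_proj]
        change _ = (contract.map _).toOrderHom ((contractOrdIso k.len).inv.toOrderHom
          (α.toOrderHom ((contractOrdIso n.len).hom.toOrderHom ((ord n.len).proj i))))
        have h₃ : (contractOrdIso n.len).hom.toOrderHom ((ord n.len).proj i) = i :=
          Fin.ext ((contractOrdIso_hom_apply _ _).trans (cls_ord _ _))
        have h₄ : ∀ j : Fin (k.len + 1), (contractOrdIso k.len).inv.toOrderHom j =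
            (ord k.len).proj j := fun j =>
          Fin.ext ((eqToHom_toOrderHom (congrArg SimplexCategory.mk (rank_ord k.len)).symm _).trans
            (cls_ord _ _).symm)
        rw [h₃, h₄]
        refine Eq.trans ?_ (contract_map_proj b _).symm
        exact Fin.ext (cls_toCograph _ _)
      have h₃ := e.hom.naturality a
      have h₄ := e.hom.naturality b
      rw [← h, h₂, Category.assoc, h₄] at h₃
      rw [← Category.assoc, ← Category.assoc, cancel_mono] at h₃
      rw [← Category.assoc, h₃]
      simp)
  have : L.IsEquivalence := Functor.IsEquivalence.mk' G unit counit
  exact Functor.IsLocalization.of_equivalence_target vertical.Q vertical contract L.asEquivalence e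

end FatDelta

/-! ### Isomorphisms and pullbacks of categories -/

section CatLemmas

/-- A functor is an isomorphism of categories iff it is bijective on objects and on morphisms. -/
lemma Cat.isIso_iff {C D : Cat.{u, u}} (F : C ⟶ D) :
    IsIso F ↔ Function.Bijective F.toFunctor.obj ∧
      ∀ x y, Function.Bijective (F.toFunctor.map (X := x) (Y := y)) := by
  constructor
  · intro _
    have h₁ := congrArg Cat.Hom.toFunctor (IsIso.hom_inv_id F)
    have h₂ := congrArg Cat.Hom.toFunctor (IsIso.inv_hom_id F)
    rw [Cat.Hom.comp_toFunctor, Cat.Hom.id_toFunctor] at h₁ h₂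
    have e : F.toFunctor.IsEquivalence :=
      Functor.IsEquivalence.mk' (inv F).toFunctor (eqToIso h₁.symm) (eqToIso h₂)
    exact ⟨⟨fun x y h => (Functor.congr_obj h₁ x).symm.trans
      ((congrArg (inv F).toFunctor.obj h).trans (Functor.congr_obj h₁ y)),
      fun y => ⟨_, Functor.congr_obj h₂ y⟩⟩, fun x y => ⟨F.toFunctor.map_injective,
      F.toFunctor.map_surjective⟩⟩
  · rintro ⟨hobj, hmap⟩
    let g := Equiv.ofBijective _ hobj
    have hg : ∀ y, F.toFunctor.obj (g.symm y) = y := g.apply_symm_apply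
    have hg' : ∀ x, g.symm (F.toFunctor.obj x) = x := g.symm_apply_apply
    let pre {y y' : D} (f : y ⟶ y') :=
      (hmap (g.symm y) (g.symm y')).2 (eqToHom (hg y) ≫ f ≫ eqToHom (hg y').symm)
    let G : D ⥤ C :=
      { obj := fun y => g.symm y
        map := fun f => (pre f).choose
        map_id := fun y => (hmap _ _).1 (by rw [(pre (𝟙 y)).choose_spec]; simp)
        map_comp := fun f f' => (hmap _ _).1 (by
          rw [(pre (f ≫ f')).choose_spec, F.toFunctor.map_comp, (pre f).choose_spec,
            (pre f').choose_spec]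
          simp) }
    have hG : ∀ {y y' : D} (f : y ⟶ y'), F.toFunctor.map (G.map f) =
        eqToHom (hg y) ≫ f ≫ eqToHom (hg y').symm := fun f => (pre f).choose_spec
    refine ⟨⟨⟨G⟩, ?_, ?_⟩⟩
    · apply Cat.ext
      refine CategoryTheory.Functor.ext (fun x => hg' x) fun x x' f => (hmap _ _).1 ?_
      change F.toFunctor.map (G.map (F.toFunctor.map f)) = _
      rw [hG]
      simp [eqToHom_map]
    · apply Cat.ext
      refine CategoryTheory.Functor.ext (fun x => hg x) fun x x' f => ?_
      exact hG f

variable {A B C D : Type u} [Category.{u} A] [Category.{u} B] [Category.{u} C] [Category.{u} D]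

/-- A square of functors over a discrete category is a pullback iff it is so on objects and
morphisms; over a discrete base, there is no compatibility condition on the morphisms. -/
structure IsDiscretePullback (p : A ⥤ B) (q : A ⥤ C) (f : B ⥤ D) (g : C ⥤ D) : Prop where
  obj : ∀ b c, f.obj b = g.obj c → ∃! a, p.obj a = b ∧ q.obj a = c
  hom : ∀ {a a' : A} (h : p.obj a ⟶ p.obj a') (k : q.obj a ⟶ q.obj a'),
    ∃! m : a ⟶ a', p.map m = h ∧ q.map m = k

variable (f : B ⥤ D) (g : C ⥤ D)

/-- The pairs of objects with the same image. -/
def pullbackObjects : ObjectProperty (B × C) := fun x => f.obj x.1 = g.obj x.2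

/-- The pullback over a discrete category. -/
abbrev PullbackCat : Type u := (pullbackObjects f g).FullSubcategory

variable {f g}

/-- The comparison functor to the pullback over a discrete category. -/
def toPullbackCat (p : A ⥤ B) (q : A ⥤ C) (w : p ⋙ f = q ⋙ g) : A ⥤ PullbackCat f g :=
  ObjectProperty.lift _ (Functor.prod' p q) (fun a => Functor.congr_obj w a)

lemma PullbackCat.functor_ext {F G : A ⥤ PullbackCat f g}
    (h₁ : F ⋙ (pullbackObjects f g).ι ⋙ CategoryTheory.Prod.fst B C =
      G ⋙ (pullbackObjects f g).ι ⋙ CategoryTheory.Prod.fst B C)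
    (h₂ : F ⋙ (pullbackObjects f g).ι ⋙ CategoryTheory.Prod.snd B C =
      G ⋙ (pullbackObjects f g).ι ⋙ CategoryTheory.Prod.snd B C) :
    F = G := by
  refine CategoryTheory.Functor.hext (fun a => ?_) fun a a' m => ?_
  · exact ObjectProperty.FullSubcategory.ext (Prod.ext (Functor.congr_obj h₁ a)
      (Functor.congr_obj h₂ a))
  · have e : ∀ a, F.obj a = G.obj a := fun a =>
      ObjectProperty.FullSubcategory.ext (Prod.ext (Functor.congr_obj h₁ a)
        (Functor.congr_obj h₂ a))
    have k₁ : HEq (F.map m).hom.1 (G.map m).hom.1 := Functor.hcongr_hom h₁ m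
    have k₂ : HEq (F.map m).hom.2 (G.map m).hom.2 := Functor.hcongr_hom h₂ m
    have ea := e a
    have ea' := e a'
    generalize F.map m = s at k₁ k₂ ⊢
    generalize G.map m = t at k₁ k₂ ⊢
    revert s t
    generalize F.obj a = x at ea ⊢
    generalize F.obj a' = x' at ea' ⊢
    subst ea ea'
    intro s t k₁ k₂
    exact heq_of_eq (ObjectProperty.hom_ext _ (Prod.ext (eq_of_heq k₁) (eq_of_heq k₂)))

end CatLemmas

section

variable {A B C D : Cat.{u, u}} {p : A ⟶ B} {q : A ⟶ C} {f : B ⟶ D} {g : C ⟶ D}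

variable (f g) in
/-- The first projection of the pullback over a discrete category. -/
def pullbackFst : Cat.of (PullbackCat f.toFunctor g.toFunctor) ⟶ B :=
  ((pullbackObjects f.toFunctor g.toFunctor).ι ⋙ CategoryTheory.Prod.fst B C).toCatHom

variable (f g) in
/-- The second projection of the pullback over a discrete category. -/
def pullbackSnd : Cat.of (PullbackCat f.toFunctor g.toFunctor) ⟶ C :=
  ((pullbackObjects f.toFunctor g.toFunctor).ι ⋙ CategoryTheory.Prod.snd B C).toCatHom

lemma isPullback_pullbackCat (hD : IsDiscrete D) :
    IsPullback (pullbackFst f g) (pullbackSnd f g) f g := by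
  refine ⟨⟨?_⟩, ⟨Limits.PullbackCone.IsLimit.mk _
    (fun s => (toPullbackCat s.fst.toFunctor s.snd.toFunctor
      (congrArg Cat.Hom.toFunctor s.condition)).toCatHom) (fun _ => rfl) (fun _ => rfl) ?_⟩⟩
  · apply Cat.ext
    exact CategoryTheory.Functor.ext (fun x => x.property) fun _ _ _ => Subsingleton.elim _ _
  · intro s m h₁ h₂
    apply Cat.ext
    exact PullbackCat.functor_ext (congrArg Cat.Hom.toFunctor h₁) (congrArg Cat.Hom.toFunctor h₂)

lemma isPullback_iff_isDiscretePullback (hD : IsDiscrete D) (w : p ≫ f = q ≫ g) :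
    IsPullback p q f g ↔
      IsDiscretePullback p.toFunctor q.toFunctor f.toFunctor g.toFunctor := by
  let K : A ⟶ Cat.of (PullbackCat f.toFunctor g.toFunctor) :=
    (toPullbackCat p.toFunctor q.toFunctor (congrArg Cat.Hom.toFunctor w)).toCatHom
  have hP := isPullback_pullbackCat (f := f) (g := g) hD
  have h₁ : IsPullback p q f g ↔ IsIso K := by
    constructor
    · intro h
      have : K = (h.isoIsPullback _ _ hP).hom := by
        apply hP.hom_ext
        · exact (IsPullback.isoIsPullback_hom_fst _ _ h hP).symm
        · exact (IsPullback.isoIsPullback_hom_snd _ _ h hP).symm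
      rw [this]
      infer_instance
    · intro _
      exact IsPullback.of_iso hP (asIso K).symm (Iso.refl _) (Iso.refl _) (Iso.refl _)
        (by
          rw [Iso.symm_hom, asIso_inv, Iso.refl_hom, Category.comp_id, IsIso.eq_inv_comp]
          rfl)
        (by
          rw [Iso.symm_hom, asIso_inv, Iso.refl_hom, Category.comp_id, IsIso.eq_inv_comp]
          rfl)
        (by simp) (by simp)
  rw [h₁, Cat.isIso_iff]
  constructor
  · rintro ⟨ho, hm⟩
    constructor
    · intro b c hbc
      obtain ⟨a, ha⟩ := ho.2 ⟨(b, c), hbc⟩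
      refine ⟨a, ⟨congrArg (fun z => z.obj.1) ha, congrArg (fun z => z.obj.2) ha⟩, ?_⟩
      rintro a' ⟨h₁, h₂⟩
      exact ho.1 ((ObjectProperty.FullSubcategory.ext (Prod.ext h₁ h₂) :
        K.toFunctor.obj a' = ⟨(b, c), hbc⟩).trans ha.symm)
    · intro a a' h k
      obtain ⟨m, hm'⟩ := (hm a a').2 (ObjectProperty.homMk (h, k))
      refine ⟨m, ⟨congrArg (fun z => z.hom.1) hm', congrArg (fun z => z.hom.2) hm'⟩, ?_⟩
      rintro m' ⟨h₁, h₂⟩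
      exact (hm a a').1 ((ObjectProperty.hom_ext _ (Prod.ext h₁ h₂) :
        K.toFunctor.map m' = ObjectProperty.homMk (h, k)).trans hm'.symm)
  · intro h
    refine ⟨⟨fun a a' e => ?_, fun x => ?_⟩, fun a a' => ⟨fun m m' e => ?_, fun s => ?_⟩⟩
    · obtain ⟨_, _, hu⟩ := h.obj _ _ (Functor.congr_obj (congrArg Cat.Hom.toFunctor w) a')
      exact (hu a ⟨congrArg (fun z => z.obj.1) e, congrArg (fun z => z.obj.2) e⟩).trans
        (hu a' ⟨rfl, rfl⟩).symm
    · obtain ⟨a, ha, _⟩ := h.obj x.obj.1 x.obj.2 x.property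
      exact ⟨a, ObjectProperty.FullSubcategory.ext (Prod.ext ha.1 ha.2)⟩
    · exact (h.hom _ _).unique ⟨congrArg (fun z => z.hom.1) e, congrArg (fun z => z.hom.2) e⟩
        ⟨rfl, rfl⟩
    · obtain ⟨m, hm, _⟩ := h.hom s.hom.1 s.hom.2
      exact ⟨m, ObjectProperty.hom_ext _ (Prod.ext hm.1 hm.2)⟩

end

/-! ### Pseudo-natural families of objects -/

section Pseudo

universe v w

variable {J : Type w} [Category.{v} J]

/-- A family of objects of the categories `X j`, indexed by the elements of the sets `T j`, that is
natural up to coherent isomorphism: a pseudo-natural transformation from `T`, seen as a diagram of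
discrete categories, to `X`. The isomorphism `η` is indexed by a morphism, an element and its image,
which is provided separately so as to avoid transports. -/
structure PseudoFamily (X : J ⥤ Cat.{u, u}) (T : J ⥤ Type u) where
  e : ∀ j, T.obj j → X.obj j
  η : ∀ {i j : J} (θ : i ⟶ j) (τ : T.obj i) (σ : T.obj j), T.map θ τ = σ →
    ((X.map θ).toFunctor.obj (e i τ) ≅ e j σ)
  η_id : ∀ (j : J) (τ : T.obj j) (h : T.map (𝟙 j) τ = τ),
    (η (𝟙 j) τ τ h).hom = eqToHom (by simp)
  η_comp : ∀ {i j k : J} (θ : i ⟶ j) (θ' : j ⟶ k) (τ : T.obj i) (σ : T.obj j) (ρ : T.obj k)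
    (h : T.map θ τ = σ) (h' : T.map θ' σ = ρ) (h'' : T.map (θ ≫ θ') τ = ρ),
    (η (θ ≫ θ') τ ρ h'').hom = eqToHom (by simp) ≫ (X.map θ').toFunctor.map (η θ τ σ h).hom ≫
      (η θ' σ ρ h').hom

namespace PseudoFamily

variable {X : J ⥤ Cat.{u, u}} {T : J ⥤ Type u} (P : PseudoFamily X T)

lemma η_eqToHom_assoc {i j : J} (θ : i ⟶ j) (τ : T.obj i) (σ σ' : T.obj j) (h : T.map θ τ = σ)
    (h' : T.map θ τ = σ') {z : X.obj j} (k : P.e j σ' ⟶ z) :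
    (P.η θ τ σ h).hom ≫ eqToHom (congrArg (P.e j) (h.symm.trans h')) ≫ k =
      (P.η θ τ σ' h').hom ≫ k := by
  subst h h'
  simp

/-- The objects of the strictification: the elements of `T j`, with the morphisms between their
images in `X j`. -/
abbrev Strict (j : J) : Type u := InducedCategory (X.obj j) (P.e j)

lemma induced_eqToHom_hom {C : Type*} {D : Type*} [Category D] {F : C → D}
    {x y : InducedCategory D F} (h : x = y) :
    (eqToHom h).hom = eqToHom (congrArg F h) := by
  subst h; rfl

lemma induced_functor_ext {A B D : Type*} [Category A] [Category D] {φ : B → D}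
    {F G : A ⥤ InducedCategory D φ} (h : ∀ a, F.obj a = G.obj a)
    (h' : ∀ {a a' : A} (m : a ⟶ a'), (F.map m).hom =
      eqToHom (congrArg φ (h a)) ≫ (G.map m).hom ≫ eqToHom (congrArg φ (h a').symm)) : F = G :=
  CategoryTheory.Functor.ext h fun a a' m => InducedCategory.hom_ext (by
    rw [InducedCategory.comp_hom, InducedCategory.comp_hom, induced_eqToHom_hom,
      induced_eqToHom_hom]
    exact h' m)

/-- The transition functors of the strictification. -/
@[simps, reducible]
def strictMap {i j : J} (θ : i ⟶ j) : P.Strict i ⥤ P.Strict j where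
  obj τ := T.map θ τ
  map {τ σ} f := InducedCategory.homMk
    ((P.η θ τ _ rfl).inv ≫ (X.map θ).toFunctor.map f.hom ≫ (P.η θ σ _ rfl).hom)
  map_id τ := by ext; simp
  map_comp f g := by ext; simp

lemma map_id_map {X : J ⥤ Cat.{u, u}} {j : J} {x y : X.obj j} (f : x ⟶ y) :
    (X.map (𝟙 j)).toFunctor.map f =
      eqToHom (by simp) ≫ f ≫ eqToHom (by simp) := by
  have := Functor.congr_hom (congrArg Cat.Hom.toFunctor (X.map_id j)) f
  simpa using this

lemma map_comp_map {X : J ⥤ Cat.{u, u}} {i j k : J} (θ : i ⟶ j) (θ' : j ⟶ k) {x y : X.obj i}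
    (f : x ⟶ y) :
    (X.map (θ ≫ θ')).toFunctor.map f =
      eqToHom (by simp) ≫ (X.map θ').toFunctor.map ((X.map θ).toFunctor.map f) ≫
        eqToHom (by simp) := by
  have := Functor.congr_hom (congrArg Cat.Hom.toFunctor (X.map_comp θ θ')) f
  simpa using this

lemma strictMap_map_hom {i j : J} (θ : i ⟶ j) {τ σ : P.Strict i} (f : τ ⟶ σ) (τ' σ' : T.obj j)
    (h : T.map θ τ = τ') (h' : T.map θ σ = σ') :
    ((P.strictMap θ).map f).hom = eqToHom (by rw [strictMap_obj, h]) ≫ (P.η θ τ τ' h).inv ≫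
      (X.map θ).toFunctor.map f.hom ≫ (P.η θ σ σ' h').hom ≫
        eqToHom (by rw [strictMap_obj, h']) := by
  subst h h'
  simp

/-- The strictification of a pseudo-natural family: the diagram of categories whose sets of objects
are the sets `T j`. -/
def strict : J ⥤ Cat.{u, u} where
  obj j := Cat.of (P.Strict j)
  map θ := (P.strictMap θ).toCatHom
  map_id j := by
    apply Cat.ext
    refine induced_functor_ext (fun τ => T.map_id_apply _ τ) fun {τ σ} f => ?_
    have hτ : T.map (𝟙 j) τ = τ := T.map_id_apply _ τ
    have hσ : T.map (𝟙 j) σ = σ := T.map_id_apply _ σ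
    have h := P.strictMap_map_hom (𝟙 j) f τ σ hτ hσ
    refine h.trans ?_
    have e₁ := P.η_id j τ hτ
    have e₂ := P.η_id j σ hσ
    have e₃ : (P.η (𝟙 j) τ τ hτ).inv = eqToHom (by simp) := by
      rw [← cancel_epi (P.η (𝟙 j) τ τ hτ).hom, Iso.hom_inv_id, e₁]; simp
    rw [e₂, e₃, map_id_map]
    simp only [eqToHom_trans_assoc, Category.assoc, eqToHom_trans]
    rfl
  map_comp {i j k} θ θ' := by
    apply Cat.ext
    refine induced_functor_ext (fun τ => T.map_comp_apply θ θ' τ) fun {τ σ} f => ?_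
    have hτ : T.map (θ ≫ θ') τ = T.map θ' (T.map θ τ) :=
      T.map_comp_apply θ θ' τ
    have hσ : T.map (θ ≫ θ') σ = T.map θ' (T.map θ σ) :=
      T.map_comp_apply θ θ' σ
    have h := P.strictMap_map_hom (θ ≫ θ') f _ _ hτ hσ
    refine h.trans ?_
    have e₁ := P.η_comp θ θ' τ _ _ rfl rfl hτ
    have e₂ := P.η_comp θ θ' σ _ _ rfl rfl hσ
    have e₃ : (P.η (θ ≫ θ') τ _ hτ).inv = (P.η θ' (T.map θ τ) _ rfl).inv ≫
        (X.map θ').toFunctor.map (P.η θ τ _ rfl).inv ≫ eqToHom (by simp) := by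
      rw [← cancel_epi (P.η (θ ≫ θ') τ _ hτ).hom, Iso.hom_inv_id, e₁]
      simp [← Functor.map_comp_assoc]
    rw [e₂, e₃, map_comp_map]
    change _ = eqToHom _ ≫ ((P.η θ' _ _ rfl).inv ≫ (X.map θ').toFunctor.map
      ((P.η θ τ _ rfl).inv ≫ (X.map θ).toFunctor.map f.hom ≫ (P.η θ σ _ rfl).hom) ≫
        (P.η θ' _ _ rfl).hom) ≫ eqToHom _
    simp

/-- An object of `X j` with a presentation as an object of the given family, up to isomorphism. -/
structure Presented (j : J) : Type u where
  τ : T.obj j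
  x : X.obj j
  ι : P.e j τ ≅ x

lemma Presented.ext {j : J} {a b : P.Presented j} (h₁ : a.τ = b.τ) (h₂ : a.x = b.x)
    (h₃ : a.ι.hom ≫ eqToHom h₂ = eqToHom (by rw [h₁]) ≫ b.ι.hom) : a = b := by
  obtain ⟨τ, x, ι⟩ := a
  obtain ⟨τ', x', ι'⟩ := b
  dsimp at h₁ h₂
  subst h₁ h₂
  simp only [eqToHom_refl, Category.comp_id, Category.id_comp] at h₃
  rw [Iso.ext h₃]

/-- The category of presented objects, with the morphisms of `X j`. -/
abbrev PresentedCat (j : J) : Type u := InducedCategory (X.obj j) (Presented.x (P := P) (j := j))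

/-- The transition functors for presented objects. -/
@[reducible]
def presentedMap {i j : J} (θ : i ⟶ j) : P.PresentedCat i ⥤ P.PresentedCat j where
  obj a := ⟨T.map θ a.τ, (X.map θ).toFunctor.obj a.x,
    (P.η θ a.τ _ rfl).symm ≪≫ (X.map θ).toFunctor.mapIso a.ι⟩
  map f := InducedCategory.homMk ((X.map θ).toFunctor.map f.hom)

lemma presentedMap_ι_hom {i j : J} (θ : i ⟶ j) (a : P.PresentedCat i) :
    ((P.presentedMap θ).obj a).ι.hom =
      (P.η θ a.τ _ rfl).inv ≫ (X.map θ).toFunctor.map a.ι.hom := rfl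

/-- The diagram of categories of presented objects. -/
def presented : J ⥤ Cat.{u, u} where
  obj j := Cat.of (P.PresentedCat j)
  map θ := (P.presentedMap θ).toCatHom
  map_id j := by
    have hobj : ∀ a : P.PresentedCat j, (P.presentedMap (𝟙 j)).obj a = a := fun a => by
      have hτ : T.map (𝟙 j) a.τ = a.τ := T.map_id_apply _ a.τ
      refine Presented.ext P hτ
        (Functor.congr_obj (congrArg Cat.Hom.toFunctor (X.map_id j)) a.x) ?_
      rw [presentedMap_ι_hom, map_id_map, Category.assoc, Iso.inv_comp_eq,
        P.η_eqToHom_assoc (𝟙 j) a.τ _ a.τ rfl hτ,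
        P.η_id]
      simp
    apply Cat.ext
    exact induced_functor_ext hobj fun f => map_id_map f.hom
  map_comp {i j k} θ θ' := by
    have hobj : ∀ a : P.PresentedCat i, (P.presentedMap (θ ≫ θ')).obj a =
        (P.presentedMap θ').obj ((P.presentedMap θ).obj a) := fun a => by
      have hτ : T.map (θ ≫ θ') a.τ = T.map θ' (T.map θ a.τ) :=
        T.map_comp_apply θ θ' a.τ
      refine Presented.ext P hτ
        (Functor.congr_obj (congrArg Cat.Hom.toFunctor (X.map_comp θ θ')) a.x) ?_
      rw [presentedMap_ι_hom, map_comp_map, Category.assoc, Iso.inv_comp_eq, presentedMap_ι_hom,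
        presentedMap_ι_hom]
      refine Eq.trans ?_ (P.η_eqToHom_assoc (θ ≫ θ') a.τ _ _ rfl hτ _).symm
      rw [P.η_comp θ θ' a.τ _ _ rfl rfl hτ]
      change _ = (_ ≫ (X.map θ').toFunctor.map (P.η θ a.τ _ rfl).hom ≫ (P.η θ' _ _ rfl).hom) ≫
        (P.η θ' _ _ rfl).inv ≫ _
      simp [← Functor.map_comp_assoc]
    apply Cat.ext
    exact induced_functor_ext hobj fun f => map_comp_map θ θ' f.hom

/-- The underlying objects of presented objects. -/
def presentedToDiagram : P.presented ⟶ X where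
  app j := (inducedFunctor (Presented.x (P := P) (j := j))).toCatHom
  naturality _ _ _ := rfl

/-- The functor sending a presented object to its presentation. -/
@[reducible]
def presentedToStrictFunctor (j : J) : P.PresentedCat j ⥤ P.Strict j where
  obj a := a.τ
  map {a b} f := InducedCategory.homMk (a.ι.hom ≫ f.hom ≫ b.ι.inv)
  map_id a := by ext; simp
  map_comp f g := by ext; simp

/-- The presentations of presented objects. -/
def presentedToStrict : P.presented ⟶ P.strict where
  app j := (P.presentedToStrictFunctor j).toCatHom
  naturality i j θ := by
    apply Cat.ext
    refine induced_functor_ext (fun _ => rfl) fun {a b} f => ?_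
    change ((P.η θ a.τ _ rfl).inv ≫ (X.map θ).toFunctor.map a.ι.hom) ≫
        (X.map θ).toFunctor.map f.hom ≫
          ((X.map θ).toFunctor.map b.ι.inv ≫ (P.η θ b.τ _ rfl).hom) =
      eqToHom _ ≫ ((P.η θ a.τ _ rfl).inv ≫
        (X.map θ).toFunctor.map (a.ι.hom ≫ f.hom ≫ b.ι.inv) ≫ (P.η θ b.τ _ rfl).hom) ≫ eqToHom _
    simp only [Functor.map_comp, Category.assoc]
    exact ((Category.id_comp _).trans (by
      simp only [← Category.assoc]
      exact Category.comp_id _)).symm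

/-- The choice of a presentation does not matter as long as there is one. -/
lemma isEquivalence_presentedToDiagram (j : J) (h : ∀ x : X.obj j, ∃ τ, Nonempty (P.e j τ ≅ x)) :
    (P.presentedToDiagram.app j).toFunctor.IsEquivalence where
  full := inferInstanceAs (inducedFunctor _).Full
  faithful := inferInstanceAs (inducedFunctor _).Faithful
  essSurj := ⟨fun x => by
    obtain ⟨τ, ⟨ι⟩⟩ := h x
    exact ⟨⟨τ, x, ι⟩, ⟨Iso.refl _⟩⟩⟩

lemma isEquivalence_presentedToStrict (j : J) :
    (P.presentedToStrict.app j).toFunctor.IsEquivalence where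
  full := ⟨fun {a b} f => ⟨InducedCategory.homMk (a.ι.inv ≫ f.hom ≫ b.ι.hom), by
    apply InducedCategory.hom_ext
    have h : ∀ g : P.e j a.τ ⟶ P.e j b.τ, a.ι.hom ≫ (a.ι.inv ≫ g ≫ b.ι.hom) ≫ b.ι.inv = g := by
      simp
    exact h f.hom⟩⟩
  faithful := ⟨fun {a b} f g h => by
    have h' : a.ι.hom ≫ f.hom ≫ b.ι.inv = a.ι.hom ≫ g.hom ≫ b.ι.inv :=
      congrArg InducedCategory.Hom.hom h
    apply InducedCategory.hom_ext
    simpa using h'⟩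
  essSurj := ⟨fun τ => ⟨⟨τ, P.e j τ, Iso.refl _⟩, ⟨Iso.refl _⟩⟩⟩

end PseudoFamily

end Pseudo

/-! ### Spines -/

section Spine

lemma map_eq_of_functor_eq {A B : Type u} [Category.{u} A] [Category.{u} B] {F G : A ⥤ B}
    (h : F = G) {x y : A} (f : x ⟶ y) :
    F.map f = eqToHom (Functor.congr_obj h x) ≫ G.map f ≫
      eqToHom (Functor.congr_obj h y).symm :=
  Functor.congr_hom h f

lemma bijective_conj_map {A B : Type u} [Category.{u} A] [Category.{u} B] (F : A ⥤ B) [F.Full]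
    [F.Faithful] {x y : A} {x' y' : B} (hx : x' = F.obj x) (hy : F.obj y = y') :
    Function.Bijective fun f : x ⟶ y => eqToHom hx ≫ F.map f ≫ eqToHom hy := by
  subst hx hy
  simpa using ⟨F.map_injective, F.map_surjective⟩

/-- The Segal condition for the spine of the `k`-simplices: an object of `N` amounts, up to
isomorphism, to a chain of `k` objects of `Q`. Here `v` is the first vertex, the `e j` are the edges
of the spine, and `s`, `t` are the source and the target. For a chain of length zero, the vertex is
part of the data. -/
structure IsSpine {N Q P : Type u} [Category.{u} N] [Category.{u} Q] [Category.{u} P] {k : ℕ}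
    (v : N ⥤ P) (e : Fin k → N ⥤ Q) (s t : Q ⥤ P) : Prop where
  bijective : ∀ x y : N, v.obj x = v.obj y →
    Function.Bijective fun (f : x ⟶ y) (j : Fin k) => (e j).map f
  exists_filler : ∀ (a : P) (l : Fin k → Q), (∀ j, j.1 = 0 → s.obj (l j) = a) →
    (∀ i j, i.1 + 1 = j.1 → t.obj (l i) = s.obj (l j)) →
    ∃ x : N, v.obj x = a ∧ ∀ j, Nonempty ((e j).obj x ≅ l j)

variable {N Q P N' Q' P' : Type u} [Category.{u} N] [Category.{u} Q] [Category.{u} P]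
  [Category.{u} N'] [Category.{u} Q'] [Category.{u} P'] {k : ℕ}
  {v : N ⥤ P} {e : Fin k → N ⥤ Q} {s t : Q ⥤ P}
  {v' : N' ⥤ P'} {e' : Fin k → N' ⥤ Q'} {s' t' : Q' ⥤ P'}

/-- The Segal condition is invariant under equivalences. -/
lemma IsSpine.of_isEquivalence (h : IsSpine v' e' s' t') [IsDiscrete P]
    (F : N ⥤ N') (G : Q ⥤ Q') (H : P ⥤ P') [F.IsEquivalence] [G.IsEquivalence] [H.IsEquivalence]
    (hv : F ⋙ v' = v ⋙ H) (he : ∀ j, F ⋙ e' j = e j ⋙ G) (hs : G ⋙ s' = s ⋙ H)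
    (ht : G ⋙ t' = t ⋙ H) [IsDiscrete P'] : IsSpine v e s t where
  bijective x y hxy := by
    have h₁ : v'.obj (F.obj x) = v'.obj (F.obj y) :=
      (Functor.congr_obj hv x).trans ((congrArg H.obj hxy).trans (Functor.congr_obj hv y).symm)
    have h₂ := (h.bijective _ _ h₁).comp ⟨F.map_injective (X := x) (Y := y), F.map_surjective⟩
    have h₃ : Function.Bijective fun (g : ∀ j : Fin k, (e j).obj x ⟶ (e j).obj y) j =>
        eqToHom (Functor.congr_obj (he j) x) ≫ G.map (g j) ≫
          eqToHom (Functor.congr_obj (he j) y).symm :=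
      Function.Bijective.piMap fun j => bijective_conj_map G _ _
    refine (Function.Bijective.of_comp_iff' h₃ _).1 ?_
    refine (congrArg Function.Bijective (funext fun f => funext fun j => ?_)).mp h₂
    exact map_eq_of_functor_eq (he j) f
  exists_filler a l h₀ h₁ := by
    obtain ⟨x, hx, hx'⟩ := h.exists_filler (H.obj a) (fun j => G.obj (l j))
      (fun j hj => (Functor.congr_obj hs (l j)).trans (congrArg H.obj (h₀ j hj)))
      (fun i j hij => (Functor.congr_obj ht (l i)).trans
        ((congrArg H.obj (h₁ i j hij)).trans (Functor.congr_obj hs (l j)).symm))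
    let y := F.objPreimage x
    let ι : F.obj y ≅ x := F.objObjPreimageIso x
    refine ⟨y, IsDiscrete.eq_of_hom (H.preimage (eqToHom (Functor.congr_obj hv y).symm ≫
      v'.map ι.hom ≫ eqToHom hx)), fun j => ?_⟩
    obtain ⟨κ⟩ := hx' j
    exact ⟨G.preimageIso (eqToIso (Functor.congr_obj (he j) y).symm ≪≫ (e' j).mapIso ι ≪≫ κ)⟩

lemma IsSpine.hom_ext (h : IsSpine v e s t) {x y : N} (hxy : v.obj x = v.obj y) {f g : x ⟶ y}
    (hfg : ∀ j, (e j).map f = (e j).map g) : f = g :=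
  (h.bijective x y hxy).1 (funext hfg)

/-- A morphism whose edges are isomorphisms is an isomorphism. -/
lemma IsSpine.isIso (h : IsSpine v e s t) {x y : N} (hxy : v.obj x = v.obj y) (f : x ⟶ y)
    (hf : ∀ j, IsIso ((e j).map f)) : IsIso f := by
  obtain ⟨g, hg⟩ := (h.bijective y x hxy.symm).2 fun j => inv ((e j).map f)
  have hg : ∀ j, (e j).map g = inv ((e j).map f) := congrFun hg
  refine ⟨g, h.hom_ext rfl fun j => ?_, h.hom_ext rfl fun j => ?_⟩ <;> simp [hg]

lemma IsSpine.nonempty_iso (h : IsSpine v e s t) {x y : N} (hxy : v.obj x = v.obj y)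
    (κ : ∀ j, (e j).obj x ≅ (e j).obj y) : Nonempty (x ≅ y) := by
  obtain ⟨f, hf⟩ := (h.bijective x y hxy).2 fun j => (κ j).hom
  have := h.isIso hxy f fun j => by
    rw [show (e j).map f = (κ j).hom from congrFun hf j]
    infer_instance
  exact ⟨asIso f⟩

end Spine

/-! ### Weak 2-categories over the fat delta -/

namespace FatDelta

/-- The `j`-th edge of the semi-ordinal without links. -/
def edge (k : ℕ) (j : Fin k) : arrow ⟶ ord k where
  toFun i := ⟨j.1 + i.1, by have : i.1 < 2 := i.2; have := j.2; simp; omega⟩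
  strictMono a b h := by
    have : a.1 < b.1 := h
    rw [Fin.lt_def]
    simp only []
    omega
  coloured a b h hab := by
    have h : a.1 < b.1 := h
    have hb : b.1 < 2 := b.2
    exact absurd (hab ⟨0, Nat.one_pos⟩ (Fin.le_def.2 (by change a.1 ≤ 0; omega))
      (Fin.le_def.2 (by change 0 + 1 ≤ b.1; omega))) (Set.notMem_empty _)

/-- The functor `X_n ⥤ X_m` induced by a morphism `m ⟶ n`. -/
abbrev res (X : FatDeltaᵒᵖ ⥤ Cat.{u, u}) {m n : FatDelta} (f : m ⟶ n) :
    X.obj (op n) ⥤ X.obj (op m) :=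
  (X.map f.op).toFunctor

lemma res_comp (X : FatDeltaᵒᵖ ⥤ Cat.{u, u}) {m n p : FatDelta} (f : m ⟶ n) (g : n ⟶ p) :
    res X (f ≫ g) = res X g ⋙ res X f :=
  congrArg Cat.Hom.toFunctor (X.map_comp g.op f.op)

lemma res_id (X : FatDeltaᵒᵖ ⥤ Cat.{u, u}) (m : FatDelta) : res X (𝟙 m) = 𝟭 _ :=
  congrArg Cat.Hom.toFunctor (X.map_id (op m))

lemma res_comp_obj (X : FatDeltaᵒᵖ ⥤ Cat.{u, u}) {m n p : FatDelta} (f : m ⟶ n) (g : n ⟶ p)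
    (x : X.obj (op p)) : (res X (f ≫ g)).obj x = (res X f).obj ((res X g).obj x) :=
  Functor.congr_obj (res_comp X f g) x

lemma app_naturality {X Y : FatDeltaᵒᵖ ⥤ Cat.{u, u}} (α : X ⟶ Y) {m n : FatDelta} (f : m ⟶ n) :
    (α.app (op n)).toFunctor ⋙ res Y f = res X f ⋙ (α.app (op m)).toFunctor :=
  congrArg Cat.Hom.toFunctor (α.naturality f.op).symm

/-- A weak 2-category over the fat delta: the common generalization of fair 2-categories and of
Tamsamani 2-categories, in which both the vertical morphisms and the Segal maps are only sent to
equivalences. -/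
structure IsWeakTwoCategory (X : FatDeltaᵒᵖ ⥤ Cat.{u, u}) : Prop where
  colours : ∀ {m n : FatDelta} (f : m ⟶ n), vertical f → (res X f).IsEquivalence
  discrete : IsDiscrete (X.obj (op pt))
  spine : ∀ k, IsSpine (res X ((ord k).dot 0)) (fun j => res X (edge k j)) (res X (arrow.dot 0))
    (res X (arrow.dot 1))

/-- A vertical morphism from the ordinal `[k]` provides a spine. -/
lemma IsWeakTwoCategory.spine_of_vertical {X : FatDeltaᵒᵖ ⥤ Cat.{u, u}} (hX : IsWeakTwoCategory X)
    {k : ℕ} {n : FatDelta} (v : ord k ⟶ n) (hv : vertical v) :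
    IsSpine (res X (n.dot (v.toFun 0))) (fun j => res X (edge k j ≫ v)) (res X (arrow.dot 0))
      (res X (arrow.dot 1)) :=
  haveI := hX.colours v hv
  haveI := hX.discrete
  (hX.spine k).of_isEquivalence (res X v) (𝟭 _) (𝟭 _) (res_comp X _ v).symm
    (fun _ => (res_comp X _ v).symm) rfl rfl

/-- The weak 2-categories are closed under levelwise equivalences. -/
lemma IsWeakTwoCategory.of_levelwise {X Y : FatDeltaᵒᵖ ⥤ Cat.{u, u}} (hY : IsWeakTwoCategory Y)
    (α : X ⟶ Y) (hα : ∀ m, (α.app m).toFunctor.IsEquivalence)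
    (hX : IsDiscrete (X.obj (op pt))) : IsWeakTwoCategory X where
  discrete := hX
  colours {m n} f hf := by
    have := hY.colours f hf
    have h : (res X f ⋙ (α.app (op m)).toFunctor).IsEquivalence := by
      rw [← app_naturality]
      infer_instance
    exact Functor.isEquivalence_of_comp_right _ (α.app (op m)).toFunctor
  spine k :=
    haveI := hY.discrete
    (hY.spine k).of_isEquivalence (α.app _).toFunctor (α.app _).toFunctor (α.app _).toFunctor
      (app_naturality α _) (fun _ => app_naturality α _) (app_naturality α _) (app_naturality α _)

lemma isomorphismClasses_map_bijective {C D : Cat.{u, u}} (F : C ⟶ D) [F.toFunctor.IsEquivalence] :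
    Function.Bijective (isomorphismClasses.map F) := by
  constructor
  · rintro ⟨x⟩ ⟨y⟩ h
    obtain ⟨i⟩ := Quotient.exact h
    exact Quotient.sound ⟨F.toFunctor.preimageIso i⟩
  · rintro ⟨y⟩
    exact ⟨Quotient.mk _ (F.toFunctor.objPreimage y),
      Quotient.sound ⟨F.toFunctor.objObjPreimageIso y⟩⟩

/-- In a weak 2-category, two morphisms that agree after contraction of the links induce the same
map on isomorphism classes of objects. -/
lemma IsWeakTwoCategory.nonempty_iso {X : FatDeltaᵒᵖ ⥤ Cat.{u, u}} (hX : IsWeakTwoCategory X)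
    {m n : FatDelta} (f g : m ⟶ n) (h : contract.map f = contract.map g) (x : X.obj (op n)) :
    Nonempty ((res X f).obj x ≅ (res X g).obj x) := by
  have hF : vertical.IsInvertedBy (X ⋙ isomorphismClasses).rightOp := fun m n f hf => by
    have := hX.colours f hf
    have : IsIso ((X ⋙ isomorphismClasses).map f.op) := by
      rw [isIso_iff_bijective]
      exact isomorphismClasses_map_bijective _
    exact inferInstanceAs (IsIso ((X ⋙ isomorphismClasses).map f.op).op)
  have h₁ := congrArg (fun g => g.unop) (map_eq_of_contract_map_eq _ hF f g h)
  exact Quotient.exact (congrArg (fun g => g (Quotient.mk _ x)) h₁)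

/-- As the category of objects is discrete, the vertices of a cell depend only on the classes of
the dots. -/
lemma IsWeakTwoCategory.vertex_eq {X : FatDeltaᵒᵖ ⥤ Cat.{u, u}} (hX : IsWeakTwoCategory X)
    {m : FatDelta} {i j : m.Dot} (h : m.cls i = m.cls j) (x : X.obj (op m)) :
    (res X (m.dot i)).obj x = (res X (m.dot j)).obj x := by
  obtain ⟨κ⟩ := hX.nonempty_iso (m.dot i) (m.dot j) ((contract_map_eq_iff _ _).2 fun _ => h) x
  have := hX.discrete
  exact IsDiscrete.eq_of_hom κ.hom

end FatDelta

/-! ### The Grothendieck construction -/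

namespace Grothendieck

universe v w

variable {J : Type w} [Category.{v} J] {F : J ⥤ Cat.{u, u}}

lemma fiber_injective {P Q : Grothendieck F} {b : P.base ⟶ Q.base}
    {f g : (F.map b).toFunctor.obj P.fiber ⟶ Q.fiber}
    (h : (⟨b, f⟩ : Grothendieck.Hom P Q) = ⟨b, g⟩) : f = g :=
  eq_of_heq (Grothendieck.Hom.mk.inj h).2

/-- The morphisms `a` with invertible `a.fiber` are the cocartesian ones. Composing with them
detects the component in the fibre up to the transition functor. -/
lemma map_fiber_eq {P Q R : Grothendieck F} {b : P.base ⟶ Q.base}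
    {f g : (F.map b).toFunctor.obj P.fiber ⟶ Q.fiber} (a : Q ⟶ R) [IsIso a.fiber]
    (h : (⟨b, f⟩ : Grothendieck.Hom P Q) ≫ a = (⟨b, g⟩ : Grothendieck.Hom P Q) ≫ a) :
    (F.map a.base).toFunctor.map f = (F.map a.base).toFunctor.map g := by
  have h' := fiber_injective h
  exact (cancel_mono a.fiber).1 ((cancel_epi (eqToHom _)).1 h')

/-- Lifting a morphism `w` along a cocartesian morphism `a` is a problem in the fibre. -/
lemma comp_eq_of {P Q R : Grothendieck F} (a : Q ⟶ R) (w : P ⟶ R)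
    {b : P.base ⟶ Q.base} (hb : w.base = b ≫ a.base)
    (f : (F.map b).toFunctor.obj P.fiber ⟶ Q.fiber)
    (hf : (F.map a.base).toFunctor.map f ≫ a.fiber =
      eqToHom (by rw [hb, F.map_comp]; rfl) ≫ w.fiber) :
    (⟨b, f⟩ : Grothendieck.Hom P Q) ≫ a = w := by
  refine Grothendieck.ext _ _ hb.symm ?_
  rw [Grothendieck.comp_fiber, hf]
  simp only [eqToHom_trans_assoc]
  exact Category.id_comp _

lemma isIso_map_fiber {P Q R : Grothendieck F} (f : P ⟶ Q) (a : Q ⟶ R) [IsIso a.fiber]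
    (h : IsIso (f ≫ a).fiber) : IsIso ((F.map a.base).toFunctor.map f.fiber) := by
  rw [Grothendieck.comp_fiber] at h
  have := @IsIso.of_isIso_comp_left _ _ _ _ _ _ _ _ h
  exact IsIso.of_isIso_comp_right _ a.fiber

/-- Morphisms out of an object over a cocartesian morphism `a`. -/
lemma existsUnique_of_isIso_fiber {P Q R : Grothendieck F} (a : P ⟶ Q) [IsIso a.fiber]
    (w : P ⟶ R) (g : Q.base ⟶ R.base) (hg : w.base = a.base ≫ g) :
    ∃! η : Q ⟶ R, η.base = g ∧ a ≫ η = w := by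
  have h₁ : (F.map w.base).toFunctor.obj P.fiber =
      (F.map g).toFunctor.obj ((F.map a.base).toFunctor.obj P.fiber) := by
    rw [hg, F.map_comp]; rfl
  refine ⟨⟨g, inv ((F.map g).toFunctor.map a.fiber) ≫ eqToHom h₁.symm ≫ w.fiber⟩, ⟨rfl, ?_⟩, ?_⟩
  · refine Grothendieck.ext _ _ hg.symm ?_
    rw [Grothendieck.comp_fiber]
    simp only [IsIso.hom_inv_id_assoc, eqToHom_trans_assoc]
    exact Category.id_comp _
  · rintro ⟨g', η⟩ ⟨h₂, h₃⟩
    dsimp only at h₂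
    subst h₂
    have h₄ := Grothendieck.congr h₃
    rw [Grothendieck.comp_fiber] at h₄
    refine Grothendieck.ext _ _ rfl ?_
    dsimp only at h₄ ⊢
    rw [eqToHom_comp_iff] at h₄
    rw [eqToHom_refl, Category.id_comp, eq_comm, IsIso.inv_comp_eq, h₄]
    simp only [eqToHom_trans_assoc]

lemma isIso_fiber_of_comp {P Q R : Grothendieck F} (a : P ⟶ Q) [IsIso a.fiber] (η : Q ⟶ R)
    [h : IsIso (a ≫ η).fiber] : IsIso η.fiber := by
  rw [Grothendieck.comp_fiber] at h
  have := @IsIso.of_isIso_comp_left _ _ _ _ _ _ _ _ h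
  exact IsIso.of_isIso_comp_left (((F.map η.base).toFunctor).map a.fiber) η.fiber

lemma isIso_comp_fiber {P Q R : Grothendieck F} (a : P ⟶ Q) [IsIso a.fiber] (η : Q ⟶ R)
    [IsIso η.fiber] : IsIso (a ≫ η).fiber := by
  rw [Grothendieck.comp_fiber]
  infer_instance

/-- The component in the fibre of a morphism over a given morphism of the base. -/
def fiberOver {P Q : Grothendieck F} (f : P ⟶ Q) {b : P.base ⟶ Q.base} (h : f.base = b) :
    (F.map b).toFunctor.obj P.fiber ⟶ Q.fiber :=
  eqToHom (by rw [h]) ≫ f.fiber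

lemma isIso_fiberOver {P Q : Grothendieck F} (f : P ⟶ Q) [IsIso f.fiber] {b : P.base ⟶ Q.base}
    (h : f.base = b) : IsIso (fiberOver f h) := by
  unfold fiberOver
  infer_instance

lemma fiberOver_id {P : Grothendieck F} (f : P ⟶ P) (h : f.base = 𝟙 P.base) (hf : f = 𝟙 P) :
    fiberOver f h = eqToHom (by simp) := by
  subst hf
  exact Category.id_comp _

lemma fiberOver_comp {P Q R : Grothendieck F} (f : P ⟶ Q) (g : Q ⟶ R) (k : P ⟶ R)
    {b : P.base ⟶ Q.base} {b' : Q.base ⟶ R.base} (hf : f.base = b) (hg : g.base = b')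
    (hk : k.base = b ≫ b') (h : k = f ≫ g) :
    fiberOver k hk = eqToHom (by simp) ≫ (F.map b').toFunctor.map (fiberOver f hf) ≫
      fiberOver g hg := by
  subst hf hg h
  simp only [fiberOver, Grothendieck.comp_fiber, eqToHom_refl, Category.id_comp]
  exact Category.id_comp _

end Grothendieck

/-! ### Paths -/

section Paths

variable {V E V' E' V'' E'' : Type u}

/-- The list `l` of edges is a path from `a` to `b`. -/
def IsPath (s t : E → V) (a : V) (l : List E) (b : V) : Prop :=
  ∃ v : ℕ → V, v 0 = a ∧ v l.length = b ∧ ∀ i e, l[i]? = some e → s e = v i ∧ t e = v (i + 1)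

variable {s t : E → V} {s' t' : E' → V'}

lemma IsPath.nil (a : V) : IsPath s t a [] a := ⟨fun _ => a, rfl, rfl, by simp⟩

lemma IsPath.append {a b c : V} {l l' : List E} (h : IsPath s t a l b) (h' : IsPath s t b l' c) :
    IsPath s t a (l ++ l') c := by
  obtain ⟨v, h₀, h₁, hv⟩ := h
  obtain ⟨v', h₀', h₁', hv'⟩ := h'
  refine ⟨fun n => if n ≤ l.length then v n else v' (n - l.length), ?_, ?_, fun i e he => ?_⟩
  · simpa using h₀
  · rw [List.length_append]
    dsimp only
    by_cases h : l'.length = 0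
    · rw [if_pos (by omega), h, Nat.add_zero, h₁, ← h₀', ← h₁', h]
    · rw [if_neg (by omega), Nat.add_sub_cancel_left, h₁']
  · by_cases hi : i < l.length
    · rw [List.getElem?_append_left hi] at he
      dsimp only
      rw [if_pos (by omega), if_pos (by omega)]
      exact hv i e he
    · rw [List.getElem?_append_right (by omega)] at he
      obtain ⟨h₂, h₃⟩ := hv' _ _ he
      dsimp only
      rw [if_neg (show ¬ i + 1 ≤ l.length by omega), h₃, h₂,
        show i + 1 - l.length = i - l.length + 1 by omega]
      refine ⟨?_, rfl⟩
      split_ifs with h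
      · rw [show i = l.length by omega, h₁, Nat.sub_self, h₀']
      · rfl

lemma IsPath.map (fV : V → V') (fE : E → E') (hs : ∀ e, s' (fE e) = fV (s e))
    (ht : ∀ e, t' (fE e) = fV (t e)) {a b : V} {l : List E} (h : IsPath s t a l b) :
    IsPath s' t' (fV a) (l.map fE) (fV b) := by
  obtain ⟨v, h₀, h₁, hv⟩ := h
  refine ⟨fun i => fV (v i), congrArg fV h₀, by simp [h₁], fun i e he => ?_⟩
  rw [List.getElem?_map, Option.map_eq_some_iff] at he
  obtain ⟨e, he, rfl⟩ := he
  exact ⟨(hs e).trans (congrArg fV (hv i e he).1), (ht e).trans (congrArg fV (hv i e he).2)⟩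

/-- The free category on a graph. Its objects are the vertices. -/
structure PathCat (s t : E → V) : Type u where
  pt : V

instance : Category.{u} (PathCat s t) where
  Hom a b := {l : List E // IsPath s t a.pt l b.pt}
  id a := ⟨[], .nil a.pt⟩
  comp f g := ⟨f.1 ++ g.1, f.2.append g.2⟩
  comp_id f := Subtype.ext (List.append_nil f.1)
  assoc f g h := Subtype.ext (List.append_assoc f.1 g.1 h.1)

/-- The functoriality of free categories. -/
def PathCat.map (fV : V → V') (fE : E → E') (hs : ∀ e, s' (fE e) = fV (s e))
    (ht : ∀ e, t' (fE e) = fV (t e)) : PathCat s t ⥤ PathCat s' t' where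
  obj a := ⟨fV a.pt⟩
  map f := ⟨f.1.map fE, f.2.map fV fE hs ht⟩
  map_comp _ _ := Subtype.ext List.map_append

namespace PathCat

variable {r : ℕ} (τ : ComposableArrows (PathCat s t) r)

/-- The list of edges of a composable sequence of paths, between two vertices. -/
def seg (i j : Fin (r + 1)) (h : i ≤ j) : List E := (τ.map (homOfLE h)).1

lemma isPath_seg (i j : Fin (r + 1)) (h : i ≤ j) :
    IsPath s t (τ.obj i).pt (seg τ i j h) (τ.obj j).pt := (τ.map (homOfLE h)).2

lemma seg_self (i : Fin (r + 1)) : seg τ i i le_rfl = [] :=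
  congrArg Subtype.val (τ.map_id i)

lemma seg_append (i j k : Fin (r + 1)) (h : i ≤ j) (h' : j ≤ k) :
    seg τ i j h ++ seg τ j k h' = seg τ i k (h.trans h') :=
  (congrArg Subtype.val (τ.map_comp (homOfLE h) (homOfLE h'))).symm

/-- The list of all the edges of a composable sequence of paths. -/
def total : List E := seg τ 0 (Fin.last r) (Fin.zero_le _)

/-- The number of edges before a vertex. -/
def pos (i : Fin (r + 1)) : ℕ := (seg τ 0 i (Fin.zero_le _)).length

lemma pos_zero : pos τ 0 = 0 := congrArg List.length (seg_self τ 0)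

lemma length_seg (i j : Fin (r + 1)) (h : i ≤ j) : pos τ i + (seg τ i j h).length = pos τ j := by
  rw [pos, pos, ← seg_append τ 0 i j (Fin.zero_le _) h, List.length_append]

lemma pos_mono : Monotone (pos τ) := fun i j h => by
  have := length_seg τ i j h
  omega

lemma pos_le (i : Fin (r + 1)) : pos τ i ≤ (total τ).length := pos_mono τ (Fin.le_last i)

lemma getElem?_seg (i j : Fin (r + 1)) (h : i ≤ j) (q : ℕ) (hq : q < (seg τ i j h).length) :
    (seg τ i j h)[q]? = (total τ)[pos τ i + q]? := by
  rw [total, ← seg_append τ 0 j _ (Fin.zero_le _) (Fin.le_last j),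
    ← seg_append τ 0 i j (Fin.zero_le _) h, List.getElem?_append_left, List.getElem?_append_right,
    pos, Nat.add_sub_cancel_left]
  · exact Nat.le_add_right _ _
  · rw [List.length_append, pos]
    omega

end PathCat

end Paths

namespace FatDelta

/-- The category of weak 2-categories. -/
abbrev WeakTwoCat : Type (u + 1) :=
  ObjectProperty.FullSubcategory (IsWeakTwoCategory : ObjectProperty (FatDeltaᵒᵖ ⥤ Cat.{u, u}))

/-- The free category on the objects and 1-cells of a diagram. -/
abbrev OneCells (X : FatDeltaᵒᵖ ⥤ Cat.{u, u}) : Type u :=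
  PathCat (res X (arrow.dot 0)).obj (res X (arrow.dot 1)).obj

/-- The functoriality of the category of paths of 1-cells. -/
def oneCells : (FatDeltaᵒᵖ ⥤ Cat.{u, u}) ⥤ Cat.{u, u} where
  obj X := Cat.of (OneCells X)
  map f := (PathCat.map (f.app (op pt)).toFunctor.obj (f.app (op arrow)).toFunctor.obj
    (Functor.congr_obj (app_naturality f _)) (Functor.congr_obj (app_naturality f _))).toCatHom
  map_id X := by
    apply Cat.ext
    exact CategoryTheory.Functor.hext (fun _ => rfl) fun _ _ _ =>
      heq_of_eq (Subtype.ext (List.map_id _))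
  map_comp f g := by
    apply Cat.ext
    exact CategoryTheory.Functor.hext (fun _ => rfl) fun _ _ l =>
      heq_of_eq (Subtype.ext (List.map_map (g := (g.app (op arrow)).toFunctor.obj)
        (f := (f.app (op arrow)).toFunctor.obj) (l := l.1)).symm)

/-- The index category for the evaluation of weak 2-categories. Keeping the 2-category as one of the
two variables makes every construction natural in it. -/
abbrev Idx : Type (u + 1) := FatDeltaᵒᵖ × WeakTwoCat.{u}

/-- The evaluation of weak 2-categories, in both variables. -/
def ev : Idx.{u} ⥤ Cat.{u, u} :=
  (𝟭 FatDeltaᵒᵖ).prod (ObjectProperty.ι _) ⋙ evaluationUncurried FatDeltaᵒᵖ Cat.{u, u}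

/-- The pastings over a semi-ordinal: the composable sequences of paths of 1-cells, indexed by the
ordinal obtained by contracting the links. -/
noncomputable def pasting : Idx.{u} ⥤ Type u :=
  contract.op.prod (ObjectProperty.ι _ ⋙ oneCells ⋙ nerveFunctor) ⋙
    evaluationUncurried SimplexCategoryᵒᵖ (Type u)

end FatDelta

namespace FatDelta

/-! ### Fillers of pasting diagrams -/

section Fillers

variable {i j k : Idx.{u}}

lemma get_eq_of_eq_map {A B : Type*} (f : A → B) {L : List B} {S T : List A} (e : L = S.map f)
    (q : Fin L.length) (p : Fin T.length) (h : q.1 < S.length → S[q.1]? = T[p.1]?) :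
    f (T.get p) = L.get q := by
  subst e
  have hq : q.1 < S.length := by simpa using q.2
  have h' := h hq
  rw [List.getElem?_eq_getElem hq, List.getElem?_eq_getElem p.2] at h'
  simpa using congrArg f (Option.some.inj h').symm

/-- A pasting as a composable sequence in the category of paths. -/
def toPaths (τ : pasting.obj j) : ComposableArrows (OneCells j.2.obj) j.1.unop.rank := τ

open PathCat

lemma pasting_map_obj (θ : i ⟶ j) (τ : pasting.obj i) (c : Fin (j.1.unop.rank + 1)) :
    ((toPaths (pasting.map θ τ)).obj c).pt = (θ.2.hom.app (op pt)).toFunctor.obj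
      ((toPaths τ).obj ((contract.map θ.1.unop).toOrderHom c)).pt := rfl

lemma pasting_map_seg (θ : i ⟶ j) (τ : pasting.obj i) (c d : Fin (j.1.unop.rank + 1)) (h : c ≤ d) :
    seg (toPaths (pasting.map θ τ)) c d h = (seg (toPaths τ) _ _
      ((contract.map θ.1.unop).toOrderHom.monotone h)).map
        (θ.2.hom.app (op arrow)).toFunctor.obj := rfl

/-- The number of 1-cells before a dot. -/
noncomputable def height (τ : pasting.obj j) (x : j.1.unop.Dot) : ℕ :=
  pos (toPaths τ) (j.1.unop.proj x)

/-- The list of 1-cells of a pasting. -/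
noncomputable def cells (τ : pasting.obj j) : List (j.2.obj.obj (op arrow)) := total (toPaths τ)

lemma isClassMap_height (τ : pasting.obj j) :
    IsClassMap j.1.unop (height τ) (cells τ).length where
  mono _ _ h := pos_mono _ (j.1.unop.cls_mono h)
  cls x y h := congrArg (pos (toPaths τ)) (Fin.ext h : j.1.unop.proj x = j.1.unop.proj y)
  le _ := pos_le _ _

/-- The number of 1-cells that are dropped at the beginning under a transition map. -/
noncomputable def shift (θ : i ⟶ j) (τ : pasting.obj i) : ℕ :=
  pos (toPaths τ) ((contract.map θ.1.unop).toOrderHom 0)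

lemma height_map (θ : i ⟶ j) (τ : pasting.obj i) (σ : pasting.obj j) (h : pasting.map θ τ = σ)
    (x : j.1.unop.Dot) : height τ (θ.1.unop.toFun x) = height σ x + shift θ τ := by
  subst h
  have h₁ := length_seg (toPaths τ) _ _
    ((contract.map θ.1.unop).toOrderHom.monotone (Fin.zero_le (j.1.unop.proj x)))
  have h₂ := congrArg List.length (pasting_map_seg θ τ 0 (j.1.unop.proj x) (Fin.zero_le _))
  rw [List.length_map] at h₂
  have h₃ := congrArg (pos (toPaths τ)) (contract_map_proj θ.1.unop x)
  change pos _ _ = (seg _ _ _ _).length + pos _ _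
  rw [h₂, ← h₃, ← h₁, Nat.add_comm]
  rfl

lemma length_cells_map (θ : i ⟶ j) (τ : pasting.obj i) (σ : pasting.obj j)
    (h : pasting.map θ τ = σ) : (cells σ).length + shift θ τ ≤ (cells τ).length := by
  subst h
  have h₁ := length_seg (toPaths τ) _ _
    ((contract.map θ.1.unop).toOrderHom.monotone (Fin.zero_le (Fin.last j.1.unop.rank)))
  have h₂ := congrArg List.length
    (pasting_map_seg θ τ 0 (Fin.last j.1.unop.rank) (Fin.zero_le _))
  rw [List.length_map] at h₂
  have h₃ := pos_le (toPaths τ) ((contract.map θ.1.unop).toOrderHom (Fin.last j.1.unop.rank))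
  refine (congrArg (· + _) h₂).le.trans ?_
  rw [Nat.add_comm]
  exact h₁.le.trans h₃

lemma cells_map (θ : i ⟶ j) (τ : pasting.obj i) (σ : pasting.obj j) (h : pasting.map θ τ = σ)
    (q : Fin (cells σ).length) (p : Fin (cells τ).length) (hpq : p.1 = q.1 + shift θ τ) :
    (θ.2.hom.app (op arrow)).toFunctor.obj ((cells τ).get p) = (cells σ).get q := by
  subst h
  refine get_eq_of_eq_map _ (pasting_map_seg θ τ 0 (Fin.last j.1.unop.rank) (Fin.zero_le _)) q p
    fun hq => ?_
  exact (getElem?_seg (toPaths τ) _ _ _ q.1 hq).trans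
    (congrArg (fun n => (cells τ)[n]?) ((Nat.add_comm _ _).trans hpq.symm))

/-- The semi-ordinal over which a pasting is filled: the chain of all the 1-cells of the pasting,
together with the dots of the indexing semi-ordinal, each linked to its place on the chain. -/
noncomputable def shape (τ : pasting.obj j) : FatDelta :=
  cograph j.1.unop (height τ) (cells τ).length

/-- The inclusion of the spine in the shape of a pasting. -/
noncomputable def spineMap (τ : pasting.obj j) : ord (cells τ).length ⟶ shape τ := base _ _ _

/-- The inclusion of the indexing semi-ordinal in the shape of a pasting. -/
noncomputable def dotMap (τ : pasting.obj j) : j.1.unop ⟶ shape τ := toCograph (isClassMap_height τ)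

lemma spine_shape (τ : pasting.obj j) :
    IsSpine (res j.2.obj ((shape τ).dot ((spineMap τ).toFun 0)))
      (fun q => res j.2.obj (edge _ q ≫ spineMap τ)) (res j.2.obj (arrow.dot 0))
      (res j.2.obj (arrow.dot 1)) :=
  j.2.property.spine_of_vertical _ (vertical_base (isClassMap_height τ))

/-- A filler of a pasting: a higher cell whose spine consists of the 1-cells of the pasting, up to
isomorphism. -/
structure Filler (τ : pasting.obj j) where
  x : j.2.obj.obj (op (shape τ))
  vertex : (res j.2.obj ((shape τ).dot ((spineMap τ).toFun 0))).obj x = ((toPaths τ).obj 0).pt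
  cell : ∀ q, (res j.2.obj (edge _ q ≫ spineMap τ)).obj x ≅ (cells τ).get q

lemma nonempty_filler (τ : pasting.obj j) : Nonempty (Filler τ) := by
  obtain ⟨v, h₀, -, hv⟩ := isPath_seg (toPaths τ) 0 (Fin.last _) (Fin.zero_le _)
  have hv : ∀ q : Fin (cells τ).length,
      (res j.2.obj (arrow.dot 0)).obj ((cells τ).get q) = v q.1 ∧
        (res j.2.obj (arrow.dot 1)).obj ((cells τ).get q) = v (q.1 + 1) := fun q =>
    hv _ _ (List.getElem?_eq_getElem q.2)
  obtain ⟨x, hx, hx'⟩ := (spine_shape τ).exists_filler ((toPaths τ).obj 0).pt (cells τ).get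
    (fun q hq => by rw [(hv q).1, hq, h₀])
    (fun q q' hq => by rw [(hv q).2, (hv q').1, hq])
  exact ⟨⟨x, hx, fun q => (hx' q).some⟩⟩

/-- A chosen filler of a pasting. -/
noncomputable def filler (τ : pasting.obj j) : Filler τ := (nonempty_filler τ).some

/-- The filler of a pasting, in the total category. -/
noncomputable def fillerPt (τ : pasting.obj j) : Grothendieck ev.{u} :=
  ⟨(op (shape τ), j.2), (filler τ).x⟩

/-- A 1-cell of a weak 2-category, in the total category. -/
def cellPt (X : WeakTwoCat.{u}) (y : X.obj.obj (op arrow)) : Grothendieck ev.{u} :=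
  ⟨(op arrow, X), y⟩

/-- The edges of the filler. These morphisms of the total category are cocartesian, and morphisms to
the filler are determined by their composites with them. -/
noncomputable def probe (τ : pasting.obj j) (q : Fin (cells τ).length) :
    fillerPt τ ⟶ cellPt j.2 ((cells τ).get q) where
  base := ((edge _ q ≫ spineMap τ).op, 𝟙 _)
  fiber := ((filler τ).cell q).hom

instance (τ : pasting.obj j) (q : Fin (cells τ).length) : IsIso (probe τ q).fiber :=
  inferInstanceAs (IsIso ((filler τ).cell q).hom)

/-- The strict image of a 1-cell under a morphism of weak 2-categories. -/
def cellMap {X Y : WeakTwoCat.{u}} (f : X ⟶ Y) {y : X.obj.obj (op arrow)}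
    {y' : Y.obj.obj (op arrow)} (h : (f.hom.app (op arrow)).toFunctor.obj y = y') :
    cellPt X y ⟶ cellPt Y y' where
  base := (𝟙 _, f)
  fiber := eqToHom (by rw [← h]; exact congrArg _ (Functor.congr_obj (res_id _ _) y))

instance {X Y : WeakTwoCat.{u}} (f : X ⟶ Y) {y : X.obj.obj (op arrow)}
    {y' : Y.obj.obj (op arrow)} (h : (f.hom.app (op arrow)).toFunctor.obj y = y') :
    IsIso (cellMap f h).fiber := by
  unfold cellMap
  infer_instance

lemma cellMap_comp {X Y Z : WeakTwoCat.{u}} (f : X ⟶ Y) (g : Y ⟶ Z) {x : X.obj.obj (op arrow)}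
    {y : Y.obj.obj (op arrow)} {z : Z.obj.obj (op arrow)}
    (h : (f.hom.app (op arrow)).toFunctor.obj x = y)
    (h' : (g.hom.app (op arrow)).toFunctor.obj y = z)
    (h'' : ((f ≫ g).hom.app (op arrow)).toFunctor.obj x = z) :
    cellMap f h ≫ cellMap g h' = cellMap (f ≫ g) h'' := by
  subst h h'
  refine Grothendieck.ext _ _ (Prod.ext (Category.comp_id _) rfl) ?_
  rw [Grothendieck.comp_fiber]
  simp only [cellMap, eqToHom_map]
  exact (congrArg (_ ≫ ·) ((congrArg (_ ≫ ·) (eqToHom_trans _ _)).trans (eqToHom_trans _ _))).trans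
    (eqToHom_trans _ _)

lemma cellMap_id {X : WeakTwoCat.{u}} {x : X.obj.obj (op arrow)}
    (h : ((𝟙 X : X ⟶ X).hom.app (op arrow)).toFunctor.obj x = x) :
    cellMap (𝟙 X) h = 𝟙 (cellPt X x) :=
  Grothendieck.ext _ _ rfl (Category.id_comp _)

lemma height_zero (τ : pasting.obj j) : height τ 0 = 0 := by
  have h₀ : (0 : Fin (j.1.unop.rank + 1)) = j.1.unop.proj 0 := Fin.ext (cls_zero _).symm
  exact (congrArg (pos (toPaths τ)) h₀.symm).trans (pos_zero _)

lemma shift_eq (θ : i ⟶ j) (τ : pasting.obj i) : shift θ τ = height τ (θ.1.unop.toFun 0) := by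
  rw [height_map θ τ _ rfl, height_zero, Nat.zero_add]

lemma shift_comp (θ : i ⟶ j) (θ' : j ⟶ k) (τ : pasting.obj i) (σ : pasting.obj j)
    (h : pasting.map θ τ = σ) : shift (θ ≫ θ') τ = shift θ' σ + shift θ τ := by
  rw [shift_eq, shift_eq θ', ← height_map θ τ σ h]
  rfl

lemma shift_id (τ : pasting.obj j) : shift (𝟙 j) τ = 0 := by
  rw [shift_eq]
  exact height_zero τ

/-- The transition map between the shapes of pastings. -/
noncomputable def shapeMap (θ : i ⟶ j) (τ : pasting.obj i) (σ : pasting.obj j)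
    (h : pasting.map θ τ = σ) : shape σ ⟶ shape τ :=
  cographMap θ.1.unop (shift θ τ) (length_cells_map θ τ σ h) (height_map θ τ σ h)

lemma dotMap_shapeMap (θ : i ⟶ j) (τ : pasting.obj i) (σ : pasting.obj j)
    (h : pasting.map θ τ = σ) : dotMap σ ≫ shapeMap θ τ σ h = θ.1.unop ≫ dotMap τ :=
  toCograph_cographMap _ _ _ _ _ _

lemma shapeMap_toFun (θ : i ⟶ j) (τ : pasting.obj i) (σ : pasting.obj j)
    (h : pasting.map θ τ = σ) (x : CographDot j.1.unop (height σ) (cells σ).length) :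
    (shapeMap θ τ σ h).toFun (ofOrderDot _ x) =
      ofOrderDot _ (CographDot.map θ.1.unop _ (length_cells_map θ τ σ h) x) :=
  cographMap_toFun _ _ _ _ _

lemma shapeMap_comp (θ : i ⟶ j) (θ' : j ⟶ k) (τ : pasting.obj i) (σ : pasting.obj j)
    (ρ : pasting.obj k) (h : pasting.map θ τ = σ) (h' : pasting.map θ' σ = ρ)
    (h'' : pasting.map (θ ≫ θ') τ = ρ) :
    shapeMap θ' σ ρ h' ≫ shapeMap θ τ σ h = shapeMap (θ ≫ θ') τ ρ h'' := by
  refine hom_ext fun x => ?_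
  obtain ⟨x, rfl⟩ := (ofOrderDot _).surjective x
  refine (congrArg (shapeMap θ τ σ h).toFun (shapeMap_toFun θ' σ ρ h' x)).trans ?_
  refine (shapeMap_toFun θ τ σ h _).trans (Eq.trans ?_ (shapeMap_toFun (θ ≫ θ') τ ρ h'' x).symm)
  congr 1
  rcases x with x | q
  · rfl
  · refine congrArg CographDot.base (Fin.ext ?_)
    change q.1 + _ + _ = q.1 + _
    rw [shift_comp θ θ' τ σ h, Nat.add_assoc]

lemma shapeMap_id (τ : pasting.obj j) (h : pasting.map (𝟙 j) τ = τ) :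
    shapeMap (𝟙 j) τ τ h = 𝟙 _ := by
  refine hom_ext fun x => ?_
  obtain ⟨x, rfl⟩ := (ofOrderDot _).surjective x
  refine (shapeMap_toFun (𝟙 j) τ τ h x).trans ?_
  change _ = ofOrderDot _ x
  congr 1
  rcases x with x | q
  · rfl
  · refine congrArg CographDot.base (Fin.ext ?_)
    change q.1 + _ = q.1
    rw [shift_id, Nat.add_zero]

lemma edge_shapeMap (θ : i ⟶ j) (τ : pasting.obj i) (σ : pasting.obj j)
    (h : pasting.map θ τ = σ) (q : Fin (cells σ).length) (p : Fin (cells τ).length)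
    (hpq : p.1 = q.1 + shift θ τ) :
    (edge _ q ≫ spineMap σ) ≫ shapeMap θ τ σ h = edge _ p ≫ spineMap τ := by
  refine hom_ext fun x => ?_
  refine (shapeMap_toFun θ τ σ h _).trans ?_
  change _ = ofOrderDot _ _
  congr 1
  refine congrArg CographDot.base (Fin.ext ?_)
  change q.1 + x.1 + _ = p.1 + x.1
  rw [hpq, Nat.add_right_comm]

/-- The vertices of the chain are the targets of its edges, except for the first one, which is part
of the data of a filler. -/
lemma filler_vertex_base (τ : pasting.obj j) (c : Fin (j.1.unop.rank + 1)) :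
    (res j.2.obj ((shape τ).dot ((spineMap τ).toFun ⟨pos (toPaths τ) c,
      Nat.lt_succ_of_le (pos_le _ _)⟩))).obj (filler τ).x = ((toPaths τ).obj c).pt := by
  obtain ⟨v, h₀, h₁, hv⟩ := isPath_seg (toPaths τ) 0 c (Fin.zero_le _)
  have hd := j.2.property.discrete
  rcases Nat.eq_zero_or_pos (pos (toPaths τ) c) with hc | hc
  · have h₂ : ((toPaths τ).obj 0).pt = ((toPaths τ).obj c).pt :=
      h₀.symm.trans ((congrArg v hc.symm).trans h₁)
    rw [← h₂, ← (filler τ).vertex]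
    exact congrArg (fun z => (res j.2.obj ((shape τ).dot ((spineMap τ).toFun z))).obj
      (filler τ).x) (Fin.ext hc)
  · have hq : pos (toPaths τ) c - 1 < (cells τ).length := by
      have := pos_le (toPaths τ) c
      change _ < (total _).length
      omega
    have hq' : pos (toPaths τ) c - 1 < (seg (toPaths τ) 0 c (Fin.zero_le _)).length := by
      change _ < pos _ _
      omega
    have e := getElem?_seg (toPaths τ) 0 c (Fin.zero_le _) _ hq'
    rw [pos_zero, Nat.zero_add] at e
    have h₂ := (hv _ _ (e.trans (List.getElem?_eq_getElem hq))).2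
    have h₃ : v (pos (toPaths τ) c - 1 + 1) = v (pos (toPaths τ) c) :=
      congrArg v (Nat.sub_add_cancel hc)
    refine Eq.trans ?_ (h₂.trans (h₃.trans h₁))
    have κ := (res j.2.obj (arrow.dot 1)).map ((filler τ).cell ⟨_, hq⟩).hom
    refine Eq.trans ?_ ((res_comp_obj j.2.obj (arrow.dot 1) (edge _ ⟨_, hq⟩ ≫ spineMap τ)
      (filler τ).x).trans (IsDiscrete.eq_of_hom κ))
    have h₄ : (shape τ).dot ((spineMap τ).toFun ⟨pos (toPaths τ) c,
        Nat.lt_succ_of_le (pos_le _ _)⟩) = arrow.dot 1 ≫ edge _ ⟨_, hq⟩ ≫ spineMap τ :=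
      hom_ext fun _ => congrArg (spineMap τ).toFun (Fin.ext (Nat.sub_add_cancel hc).symm)
    rw [h₄]

/-- The vertices of a filler. -/
lemma filler_vertex (τ : pasting.obj j) (x : (shape τ).Dot) (y : j.1.unop.Dot)
    (h : (shape τ).cls x = (shape τ).cls ((dotMap τ).toFun y)) :
    (res j.2.obj ((shape τ).dot x)).obj (filler τ).x =
      ((toPaths τ).obj (j.1.unop.proj y)).pt :=
  (j.2.property.vertex_eq (h.trans (cls_toCograph (isClassMap_height τ) y)) _).trans
    (filler_vertex_base τ (j.1.unop.proj y))

/-! ### The coherent family of cells -/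

/-- The transition map between the shapes of pastings, in the index category. -/
noncomputable def shapeHom (θ : i ⟶ j) (τ : pasting.obj i) (σ : pasting.obj j)
    (h : pasting.map θ τ = σ) : (fillerPt τ).base ⟶ (fillerPt σ).base :=
  ((shapeMap θ τ σ h).op, θ.2)

lemma fillerHom_ext {P : Grothendieck ev.{u}} {σ : pasting.obj j} {f g : P ⟶ fillerPt σ}
    (hb : f.base = g.base) (h : ∀ q, f ≫ probe σ q = g ≫ probe σ q) : f = g := by
  obtain ⟨b, f⟩ := f
  obtain ⟨b', g⟩ := g
  dsimp only at hb
  subst hb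
  refine Grothendieck.ext _ _ rfl ?_
  rw [eqToHom_refl, Category.id_comp]
  have hd := j.2.property.discrete
  refine (spine_shape σ).hom_ext (IsDiscrete.eq_of_hom
    ((res j.2.obj ((shape σ).dot ((spineMap σ).toFun 0))).map f)) fun q => ?_
  exact Grothendieck.map_fiber_eq (probe σ q) (h q)

lemma comp_comp_inv_comp_hom {C : Type*} [Category C] {a b c d : C} (f : a ⟶ b) (g : b ⟶ c)
    (e : d ≅ c) : (f ≫ g ≫ e.inv) ≫ e.hom = f ≫ g := by
  simp

/-- Morphisms to a filler are constructed on the spine. -/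
lemma exists_fillerMap {P : Grothendieck ev.{u}} {σ : pasting.obj j}
    (b : P.base ⟶ (fillerPt σ).base) (w : ∀ q, P ⟶ cellPt j.2 ((cells σ).get q))
    (hb : ∀ q, (w q).base = b ≫ (probe σ q).base)
    (hv : (res j.2.obj ((shape σ).dot ((spineMap σ).toFun 0))).obj
      ((ev.map b).toFunctor.obj P.fiber) = ((toPaths σ).obj 0).pt) :
    ∃ ζ : P ⟶ fillerPt σ, ζ.base = b ∧ ∀ q, ζ ≫ probe σ q = w q := by
  have hw : ∀ q, (ev.map (probe σ q).base).toFunctor.obj ((ev.map b).toFunctor.obj P.fiber) =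
      (ev.map (w q).base).toFunctor.obj P.fiber := fun q => by
    rw [hb, Functor.map_comp]
    rfl
  obtain ⟨f, hf⟩ := ((spine_shape σ).bijective _ _ (hv.trans (filler σ).vertex.symm)).2 fun q =>
    eqToHom (hw q) ≫ (w q).fiber ≫ ((filler σ).cell q).inv
  refine ⟨⟨b, f⟩, rfl, fun q => Grothendieck.comp_eq_of (probe σ q) (w q) (hb q) f ?_⟩
  refine (congrArg (· ≫ ((filler σ).cell q).hom) (congrFun hf q)).trans ?_
  exact comp_comp_inv_comp_hom _ _ _

lemma shapeHom_probe (θ : i ⟶ j) (τ : pasting.obj i) (σ : pasting.obj j)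
    (h : pasting.map θ τ = σ) (q : Fin (cells σ).length) (p : Fin (cells τ).length)
    (hpq : p.1 = q.1 + shift θ τ) :
    (probe τ p ≫ cellMap θ.2 (cells_map θ τ σ h q p hpq)).base =
      shapeHom θ τ σ h ≫ (probe σ q).base :=
  Prod.ext ((Category.comp_id _).trans
    (congrArg Quiver.Hom.op (edge_shapeMap θ τ σ h q p hpq).symm))
    ((Category.id_comp _).trans (Category.comp_id _).symm)

lemma vertex_shapeHom (θ : i ⟶ j) (τ : pasting.obj i) (σ : pasting.obj j)
    (h : pasting.map θ τ = σ) :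
    (res j.2.obj ((shape σ).dot ((spineMap σ).toFun 0))).obj
      ((ev.map (shapeHom θ τ σ h)).toFunctor.obj (filler τ).x) = ((toPaths σ).obj 0).pt := by
  have h₁ : (shape τ).cls ((shapeMap θ τ σ h).toFun ((spineMap σ).toFun 0)) =
      (shape τ).cls ((dotMap τ).toFun (θ.1.unop.toFun 0)) := by
    have h₂ := hom_cls (shapeMap θ τ σ h) (cls_toCograph (isClassMap_height σ) 0)
    have h₃ := congrArg (fun g => (shape τ).cls (Hom.toFun g 0)) (dotMap_shapeMap θ τ σ h)
    refine Eq.trans ?_ (h₂.symm.trans h₃)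
    refine congrArg (fun z => (shape τ).cls ((shapeMap θ τ σ h).toFun ((spineMap σ).toFun z)))
      (Fin.ext ?_)
    exact (height_zero σ).symm
  have h₂ := filler_vertex τ _ _ h₁
  have h₃ := Functor.congr_obj (app_naturality θ.2.hom
    ((shape τ).dot ((shapeMap θ τ σ h).toFun ((spineMap σ).toFun 0)))) (filler τ).x
  have h₄ := res_comp_obj j.2.obj ((shape σ).dot ((spineMap σ).toFun 0)) (shapeMap θ τ σ h)
    ((θ.2.hom.app _).toFunctor.obj (filler τ).x)
  have h₅ := Functor.congr_obj (app_naturality θ.2.hom (shapeMap θ τ σ h)) (filler τ).x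
  have h₆ : (contract.map θ.1.unop).toOrderHom 0 = i.1.unop.proj (θ.1.unop.toFun 0) :=
    (congrArg (contract.map θ.1.unop).toOrderHom (Fin.ext (cls_zero j.1.unop).symm :
      (0 : Fin (j.1.unop.rank + 1)) = j.1.unop.proj 0)).trans (contract_map_proj _ 0)
  refine (congrArg (res j.2.obj ((shape σ).dot ((spineMap σ).toFun 0))).obj h₅.symm).trans
    (h₄.symm.trans (h₃.trans ?_))
  refine (congrArg (θ.2.hom.app (op pt)).toFunctor.obj h₂).trans ?_
  subst h
  rw [pasting_map_obj]
  exact congrArg (fun z => (θ.2.hom.app (op pt)).toFunctor.obj ((toPaths τ).obj z).pt) h₆.symm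

/-- The comparison between fillers. On the spine, it is prescribed by the strict equality between
the 1-cells of the two pastings; the Segal condition extends it uniquely to the fillers. -/
lemma existsUnique_fillerMap (θ : i ⟶ j) (τ : pasting.obj i) (σ : pasting.obj j)
    (h : pasting.map θ τ = σ) :
    ∃! ζ : fillerPt τ ⟶ fillerPt σ, ζ.base = shapeHom θ τ σ h ∧
      ∀ (q : Fin (cells σ).length) (p : Fin (cells τ).length) (hpq : p.1 = q.1 + shift θ τ),
        ζ ≫ probe σ q = probe τ p ≫ cellMap θ.2 (cells_map θ τ σ h q p hpq) := by
  have hp : ∀ q : Fin (cells σ).length, ∃ p : Fin (cells τ).length, p.1 = q.1 + shift θ τ :=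
    fun q => ⟨⟨_, by have := length_cells_map θ τ σ h; have := q.2; omega⟩, rfl⟩
  choose p hp using hp
  obtain ⟨ζ, hζ, hζ'⟩ := exists_fillerMap (shapeHom θ τ σ h)
    (fun q => probe τ (p q) ≫ cellMap θ.2 (cells_map θ τ σ h q (p q) (hp q)))
    (fun q => shapeHom_probe θ τ σ h q (p q) (hp q)) (vertex_shapeHom θ τ σ h)
  refine ⟨ζ, ⟨hζ, fun q p' hpq => ?_⟩, fun ζ' hζ'' => ?_⟩
  · obtain rfl : p' = p q := Fin.ext (hpq.trans (hp q).symm)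
    exact hζ' q
  · exact fillerHom_ext (hζ''.1.trans hζ.symm) fun q =>
      (hζ''.2 q (p q) (hp q)).trans (hζ' q).symm

/-- The comparison between fillers. -/
noncomputable def fillerMap (θ : i ⟶ j) (τ : pasting.obj i) (σ : pasting.obj j)
    (h : pasting.map θ τ = σ) : fillerPt τ ⟶ fillerPt σ :=
  (existsUnique_fillerMap θ τ σ h).choose

lemma fillerMap_base (θ : i ⟶ j) (τ : pasting.obj i) (σ : pasting.obj j)
    (h : pasting.map θ τ = σ) : (fillerMap θ τ σ h).base = shapeHom θ τ σ h :=
  (existsUnique_fillerMap θ τ σ h).choose_spec.1.1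

lemma fillerMap_probe (θ : i ⟶ j) (τ : pasting.obj i) (σ : pasting.obj j)
    (h : pasting.map θ τ = σ) (q : Fin (cells σ).length) (p : Fin (cells τ).length)
    (hpq : p.1 = q.1 + shift θ τ) :
    fillerMap θ τ σ h ≫ probe σ q = probe τ p ≫ cellMap θ.2 (cells_map θ τ σ h q p hpq) :=
  (existsUnique_fillerMap θ τ σ h).choose_spec.1.2 q p hpq

lemma fillerMap_id (τ : pasting.obj j) (h : pasting.map (𝟙 j) τ = τ) :
    fillerMap (𝟙 j) τ τ h = 𝟙 _ := by
  refine fillerHom_ext ((fillerMap_base _ _ _ _).trans ?_) fun q => ?_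
  · exact Prod.ext (congrArg Quiver.Hom.op (shapeMap_id τ h)) rfl
  · refine (fillerMap_probe (𝟙 j) τ τ h q q (by rw [shift_id, Nat.add_zero])).trans ?_
    refine Eq.trans ?_ (Category.id_comp _).symm
    exact (congrArg (probe τ q ≫ ·) (cellMap_id _)).trans (Category.comp_id _)

lemma fillerMap_comp (θ : i ⟶ j) (θ' : j ⟶ k) (τ : pasting.obj i) (σ : pasting.obj j)
    (ρ : pasting.obj k) (h : pasting.map θ τ = σ) (h' : pasting.map θ' σ = ρ)
    (h'' : pasting.map (θ ≫ θ') τ = ρ) :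
    fillerMap (θ ≫ θ') τ ρ h'' = fillerMap θ τ σ h ≫ fillerMap θ' σ ρ h' := by
  refine fillerHom_ext ?_ fun q => ?_
  · rw [Grothendieck.comp_base, fillerMap_base, fillerMap_base, fillerMap_base]
    exact Prod.ext (congrArg Quiver.Hom.op (shapeMap_comp θ θ' τ σ ρ h h' h'').symm) rfl
  · have l₁ := length_cells_map θ τ σ h
    have l₂ := length_cells_map θ' σ ρ h'
    have hq := q.2
    let p' : Fin (cells σ).length := ⟨q.1 + shift θ' σ, by omega⟩
    let p : Fin (cells τ).length := ⟨q.1 + shift θ' σ + shift θ τ, by omega⟩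
    rw [Category.assoc, fillerMap_probe θ' σ ρ h' q p' rfl, ← Category.assoc,
      fillerMap_probe θ τ σ h p' p rfl, Category.assoc,
      fillerMap_probe (θ ≫ θ') τ ρ h'' q p (by rw [shift_comp θ θ' τ σ h, ← Nat.add_assoc])]
    exact congrArg (probe τ p ≫ ·) (cellMap_comp θ.2 θ'.2 _ _ _).symm

instance (θ : i ⟶ j) (τ : pasting.obj i) (σ : pasting.obj j) (h : pasting.map θ τ = σ) :
    IsIso (fillerMap θ τ σ h).fiber := by
  have hd := j.2.property.discrete
  refine (spine_shape σ).isIso (IsDiscrete.eq_of_hom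
    ((res j.2.obj ((shape σ).dot ((spineMap σ).toFun 0))).map (fillerMap θ τ σ h).fiber)) _
    fun q => ?_
  have l₁ := length_cells_map θ τ σ h
  have hq := q.2
  have h₁ := fillerMap_probe θ τ σ h q ⟨q.1 + shift θ τ, by omega⟩ rfl
  refine Grothendieck.isIso_map_fiber (fillerMap θ τ σ h) (probe σ q) ?_
  rw [h₁]
  exact Grothendieck.isIso_comp_fiber _ _

/-- The cell presented by a pasting, in the total category: the restriction of the filler to the
indexing semi-ordinal. -/
noncomputable def pastedPt (τ : pasting.obj j) : Grothendieck ev.{u} :=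
  ⟨j, (res j.2.obj (dotMap τ)).obj (filler τ).x⟩

/-- The cocartesian morphism from a filler to the cell presented by a pasting. -/
noncomputable def fillerToPasted (τ : pasting.obj j) : fillerPt τ ⟶ pastedPt τ where
  base := ((dotMap τ).op, 𝟙 _)
  fiber := 𝟙 _

instance (τ : pasting.obj j) : IsIso (fillerToPasted τ).fiber :=
  inferInstanceAs (IsIso (𝟙 _))

lemma existsUnique_pastedMap (θ : i ⟶ j) (τ : pasting.obj i) (σ : pasting.obj j)
    (h : pasting.map θ τ = σ) :
    ∃! η : pastedPt τ ⟶ pastedPt σ, η.base = θ ∧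
      fillerToPasted τ ≫ η = fillerMap θ τ σ h ≫ fillerToPasted σ := by
  refine Grothendieck.existsUnique_of_isIso_fiber (fillerToPasted τ)
    (fillerMap θ τ σ h ≫ fillerToPasted σ) θ ?_
  rw [Grothendieck.comp_base, fillerMap_base]
  exact Prod.ext (congrArg Quiver.Hom.op (dotMap_shapeMap θ τ σ h))
    ((Category.comp_id _).trans (Category.id_comp _).symm)

/-- The comparison between the cells presented by pastings. -/
noncomputable def pastedMap (θ : i ⟶ j) (τ : pasting.obj i) (σ : pasting.obj j)
    (h : pasting.map θ τ = σ) : pastedPt τ ⟶ pastedPt σ :=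
  (existsUnique_pastedMap θ τ σ h).choose

lemma pastedMap_base (θ : i ⟶ j) (τ : pasting.obj i) (σ : pasting.obj j)
    (h : pasting.map θ τ = σ) : (pastedMap θ τ σ h).base = θ :=
  (existsUnique_pastedMap θ τ σ h).choose_spec.1.1

lemma fillerToPasted_pastedMap (θ : i ⟶ j) (τ : pasting.obj i) (σ : pasting.obj j)
    (h : pasting.map θ τ = σ) :
    fillerToPasted τ ≫ pastedMap θ τ σ h = fillerMap θ τ σ h ≫ fillerToPasted σ :=
  (existsUnique_pastedMap θ τ σ h).choose_spec.1.2

lemma pastedMap_id (τ : pasting.obj j) (h : pasting.map (𝟙 j) τ = τ) :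
    pastedMap (𝟙 j) τ τ h = 𝟙 _ := by
  refine ((existsUnique_pastedMap (𝟙 j) τ τ h).choose_spec.2 _ ⟨rfl, ?_⟩).symm
  rw [fillerMap_id, Category.id_comp]
  exact Category.comp_id _

lemma pastedMap_comp (θ : i ⟶ j) (θ' : j ⟶ k) (τ : pasting.obj i) (σ : pasting.obj j)
    (ρ : pasting.obj k) (h : pasting.map θ τ = σ) (h' : pasting.map θ' σ = ρ)
    (h'' : pasting.map (θ ≫ θ') τ = ρ) :
    pastedMap (θ ≫ θ') τ ρ h'' = pastedMap θ τ σ h ≫ pastedMap θ' σ ρ h' := by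
  refine ((existsUnique_pastedMap (θ ≫ θ') τ ρ h'').choose_spec.2 _ ⟨?_, ?_⟩).symm
  · rw [Grothendieck.comp_base, pastedMap_base, pastedMap_base]
    rfl
  · rw [fillerMap_comp θ θ' τ σ ρ h h' h'', ← Category.assoc, fillerToPasted_pastedMap,
      Category.assoc, fillerToPasted_pastedMap, Category.assoc]

instance (θ : i ⟶ j) (τ : pasting.obj i) (σ : pasting.obj j) (h : pasting.map θ τ = σ) :
    IsIso (pastedMap θ τ σ h).fiber := by
  have : IsIso (fillerToPasted τ ≫ pastedMap θ τ σ h).fiber := by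
    rw [fillerToPasted_pastedMap]
    exact Grothendieck.isIso_comp_fiber _ _
  exact Grothendieck.isIso_fiber_of_comp (fillerToPasted τ) _

end Fillers

/-- The cells presented by pastings form a pseudo-natural family: a morphism between fillers is
determined by its edges, which are the identities of the 1-cells of the pasting. -/
noncomputable def pastedFamily : PseudoFamily ev.{u} pasting.{u} where
  e _ τ := (pastedPt τ).fiber
  η θ τ σ h := @asIso _ _ _ _ (Grothendieck.fiberOver (pastedMap θ τ σ h) (pastedMap_base θ τ σ h))
    (Grothendieck.isIso_fiberOver _ _)
  η_id _ _ h := Grothendieck.fiberOver_id (pastedMap (𝟙 _) _ _ h)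
    (pastedMap_base _ _ _ _) (pastedMap_id _ h)
  η_comp θ θ' τ σ ρ h h' h'' := Grothendieck.fiberOver_comp (pastedMap θ τ σ h)
    (pastedMap θ' σ ρ h') (pastedMap (θ ≫ θ') τ ρ h'') (pastedMap_base _ _ _ _)
    (pastedMap_base _ _ _ _) (pastedMap_base _ _ _ _) (pastedMap_comp θ θ' τ σ ρ h h' h'')

end FatDelta

/-! ### Every cell is presented by a pasting -/

section Slices

variable {V E : Type u} {s t : E → V} {r : ℕ}

lemma isPath_slice (v : Fin (r + 1) → V) (L : Fin r → List E)
    (hL : ∀ q, IsPath s t (v q.castSucc) (L q) (v q.succ)) (i : Fin (r + 1)) (d : ℕ)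
    (h : i.1 + d < r + 1) :
    IsPath s t (v i) (((List.ofFn L).drop i.1).take d).flatten (v ⟨i.1 + d, h⟩) := by
  induction d with
  | zero => simpa using IsPath.nil (v i)
  | succ d ih =>
    have e : ((List.ofFn L).drop i.1)[d]? = some (L ⟨i.1 + d, by omega⟩) := by
      rw [List.getElem?_drop, List.getElem?_eq_getElem (by rw [List.length_ofFn]; omega),
        List.getElem_ofFn]
    rw [List.take_add_one, e, List.flatten_append]
    refine (ih (by omega)).append ?_
    have e' : (some (L ⟨i.1 + d, by omega⟩)).toList.flatten = L ⟨i.1 + d, by omega⟩ := by simp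
    rw [e']
    exact hL ⟨i.1 + d, by omega⟩

lemma eq_get_of_eq_ofFn {A : Type*} {L : List A} {n : ℕ} {l : Fin n → A} (e : L = List.ofFn l)
    (q : Fin L.length) (hq : q.1 < n) : l ⟨q.1, hq⟩ = L.get q := by
  subst e
  simp

/-- The composable sequence given by a chain of paths. -/
def PathCat.ofPaths (v : Fin (r + 1) → V) (L : Fin r → List E)
    (hL : ∀ q, IsPath s t (v q.castSucc) (L q) (v q.succ)) : ComposableArrows (PathCat s t) r where
  obj i := ⟨v i⟩
  map {i j} h := ⟨(((List.ofFn L).drop i.1).take (j.1 - i.1)).flatten, by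
    have h' : i.1 ≤ j.1 := h.le
    have := isPath_slice v L hL i (j.1 - i.1) (by have := j.2; omega)
    rwa [show (⟨i.1 + (j.1 - i.1), _⟩ : Fin (r + 1)) = j from Fin.ext (by simp only []; omega)]
      at this⟩
  map_id i := Subtype.ext (by
    change (List.take (i.1 - i.1) _).flatten = []
    rw [Nat.sub_self, List.take_zero, List.flatten_nil])
  map_comp {i j k} f g := Subtype.ext (by
    change (List.take (k.1 - i.1) _).flatten =
      (List.take (j.1 - i.1) _).flatten ++ (List.take (k.1 - j.1) _).flatten
    have h₁ : i.1 ≤ j.1 := f.le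
    have h₂ : j.1 ≤ k.1 := g.le
    rw [show k.1 - i.1 = (j.1 - i.1) + (k.1 - j.1) by omega, List.take_add, List.drop_drop,
      show i.1 + (j.1 - i.1) = j.1 by omega, List.flatten_append])

lemma PathCat.seg_ofPaths (v : Fin (r + 1) → V) (L : Fin r → List E)
    (hL : ∀ q, IsPath s t (v q.castSucc) (L q) (v q.succ)) (q : Fin r) :
    seg (ofPaths v L hL) q.castSucc q.succ (Fin.castSucc_lt_succ (i := q)).le = L q := by
  change (List.take (q.1 + 1 - q.1) (List.drop q.1 (List.ofFn L))).flatten = _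
  have e : ((List.ofFn L).drop q.1)[0]? = some (L q) := by
    rw [List.getElem?_drop, List.getElem?_eq_getElem (by rw [List.length_ofFn]; omega),
      List.getElem_ofFn]
    rfl
  rw [Nat.add_sub_cancel_left]
  generalize (List.ofFn L).drop q.1 = l at e
  cases l <;> simp_all

/-- A composable sequence of paths is determined by its vertices and by its consecutive paths. -/
lemma PathCat.composable_ext {τ σ : ComposableArrows (PathCat s t) r}
    (h₀ : ∀ c, (τ.obj c).pt = (σ.obj c).pt)
    (h : ∀ q : Fin r, seg τ q.castSucc q.succ (Fin.castSucc_lt_succ (i := q)).le =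
      seg σ q.castSucc q.succ (Fin.castSucc_lt_succ (i := q)).le) : τ = σ := by
  have hobj : ∀ c, τ.obj c = σ.obj c := fun c => congrArg PathCat.mk (h₀ c)
  have hseg : ∀ (d : ℕ) (i : Fin (r + 1)) (hd : i.1 + d < r + 1),
      seg τ i ⟨i.1 + d, hd⟩ (Fin.le_def.2 (Nat.le_add_right _ _)) =
        seg σ i ⟨i.1 + d, hd⟩ (Fin.le_def.2 (Nat.le_add_right _ _)) := by
    intro d
    induction d with
    | zero => exact fun i _ => (seg_self τ i).trans (seg_self σ i).symm
    | succ d ih =>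
      intro i hd
      have hle : (⟨i.1 + d, by omega⟩ : Fin (r + 1)) ≤ ⟨i.1 + (d + 1), hd⟩ :=
        Fin.le_def.2 (by simp only []; omega)
      rw [← seg_append τ i ⟨i.1 + d, by omega⟩ _ (Fin.le_def.2 (Nat.le_add_right _ _)) hle,
        ← seg_append σ i ⟨i.1 + d, by omega⟩ _ (Fin.le_def.2 (Nat.le_add_right _ _)) hle,
        ih i (by omega)]
      exact congrArg _ (h ⟨i.1 + d, by omega⟩)
  have key : ∀ {a b a' b' : PathCat s t} (f : a ⟶ b) (g : a' ⟶ b'), a = a' → b = b' →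
      f.1 = g.1 → f ≍ g := by
    rintro a b _ _ f g rfl rfl hfg
    exact heq_of_eq (Subtype.ext hfg)
  refine CategoryTheory.Functor.hext hobj fun i j f => key _ _ (hobj i) (hobj j) ?_
  have h₁ : ∀ (d : ℕ) (hd : i.1 + d < r + 1) (j : Fin (r + 1)) (f : i ⟶ j), j = ⟨i.1 + d, hd⟩ →
      (τ.map f).1 = (σ.map f).1 := by
    rintro d hd _ f rfl
    exact hseg d i hd
  have hij : i.1 ≤ j.1 := f.le
  have := j.2
  exact h₁ (j.1 - i.1) (by omega) j f (Fin.ext (by simp only []; omega))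

/-- The composable sequence of paths given by a chain of edges. -/
def PathCat.ofChain (v : Fin (r + 1) → V) (l : Fin r → E) (hs : ∀ q, s (l q) = v q.castSucc)
    (ht : ∀ q, t (l q) = v q.succ) : ComposableArrows (PathCat s t) r :=
  ofPaths v (fun q => [l q]) fun q => ⟨fun n => if n = 0 then v q.castSucc else v q.succ, rfl, rfl,
    fun i e he => by
      obtain ⟨hi, rfl⟩ := List.getElem?_eq_some_iff.1 he
      obtain rfl : i = 0 := by simpa using hi
      exact ⟨hs q, ht q⟩⟩

variable (v : Fin (r + 1) → V) (l : Fin r → E) (hs : ∀ q, s (l q) = v q.castSucc)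
    (ht : ∀ q, t (l q) = v q.succ)

lemma PathCat.seg_zero_ofChain (c : Fin (r + 1)) :
    seg (ofChain v l hs ht) 0 c (Fin.zero_le c) = (List.ofFn l).take c.1 := by
  change (List.take (c.1 - 0) (List.drop 0 (List.ofFn fun q => [l q]))).flatten = _
  rw [Nat.sub_zero, List.drop_zero, show (List.ofFn fun q => [l q]) =
    (List.ofFn l).map fun x => [x] from (by rw [List.map_ofFn]; rfl), ← List.map_take]
  induction (List.ofFn l).take c.1 <;> simp_all

lemma PathCat.total_ofChain : total (ofChain v l hs ht) = List.ofFn l :=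
  (seg_zero_ofChain v l hs ht (Fin.last r)).trans (List.take_of_length_le (by simp))

lemma PathCat.pos_ofChain (c : Fin (r + 1)) : pos (ofChain v l hs ht) c = c.1 := by
  have := c.2
  rw [pos, seg_zero_ofChain, List.length_take, List.length_ofFn]
  omega

end Slices

namespace FatDelta

/-- Every cell is isomorphic to the one presented by the pasting of its own spine, which is
obtained from the cograph of the class map. -/
lemma exists_pasting (j : Idx.{u}) (x : j.2.obj.obj j.1) :
    ∃ τ, Nonempty (pastedFamily.e j τ ≅ x) := by
  let m := j.1.unop
  let X := j.2.obj
  have := j.2.property.colours _ m.vertical_toCograph_cls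
  let y := (res X (toCograph m.isClassMap_cls)).objPreimage x
  let κ : (res X (toCograph m.isClassMap_cls)).obj y ≅ x :=
    (res X (toCograph m.isClassMap_cls)).objObjPreimageIso x
  let b := base m m.cls m.rank
  let v : (ord m.rank).Dot → X.obj (op pt) := fun c =>
    (res X ((cograph m m.cls m.rank).dot (b.toFun c))).obj y
  let l : Fin m.rank → X.obj (op arrow) := fun q => (res X (edge _ q ≫ b)).obj y
  have hs : ∀ q, (res X (arrow.dot 0)).obj (l q) = v q.castSucc := fun q =>
    (res_comp_obj _ _ _ _).symm
  have ht : ∀ q, (res X (arrow.dot 1)).obj (l q) = v q.succ := fun q =>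
    (res_comp_obj _ _ _ _).symm
  let τ : pasting.obj j := PathCat.ofChain v l hs ht
  have h₁ : cells τ = List.ofFn l := PathCat.total_ofChain v l hs ht
  have h₂ : (cells τ).length = m.rank := by rw [h₁, List.length_ofFn]
  have h₃ : ∀ i, height τ i = m.cls i := fun i => PathCat.pos_ofChain v l hs ht (m.proj i)
  -- every path of `τ` has length one, so that its shape is the cograph of the class map
  let f : shape τ ⟶ cograph m m.cls m.rank :=
    cographMap (𝟙 m) 0 h₂.le fun i => (h₃ i).symm
  have h₄ : dotMap τ ≫ f = toCograph m.isClassMap_cls :=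
    toCograph_cographMap _ _ _ _ (isClassMap_height τ) m.isClassMap_cls
  have h₅ : ∀ (c : (ord (cells τ).length).Dot) (c' : (ord m.rank).Dot), c.1 = c'.1 →
      f.toFun ((spineMap τ).toFun c) = b.toFun c' := fun c c' hc => by
    refine (cographMap_toFun (𝟙 m) 0 h₂.le _ _).trans ?_
    exact congrArg (fun z => ofOrderDot _ (CographDot.base z)) (Fin.ext hc)
  have h₆ : ∀ q, (res X (edge _ q ≫ spineMap τ)).obj ((res X f).obj y) = (cells τ).get q :=
    fun q => by
      have hq : q.1 < m.rank := h₂ ▸ q.2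
      have h₇ : (edge _ q ≫ spineMap τ) ≫ f = edge _ ⟨q.1, hq⟩ ≫ b :=
        hom_ext fun i => h₅ _ _ rfl
      rw [← res_comp_obj, h₇]
      exact eq_get_of_eq_ofFn h₁ q hq
  have h₈ : (res X ((shape τ).dot ((spineMap τ).toFun 0))).obj (filler τ).x =
      (res X ((shape τ).dot ((spineMap τ).toFun 0))).obj ((res X f).obj y) := by
    refine (filler τ).vertex.trans (Eq.trans ?_ (res_comp_obj X _ f y))
    exact congrArg (fun z => (res X (dot _ z)).obj y) (h₅ 0 0 rfl).symm
  obtain ⟨ι⟩ := (spine_shape τ).nonempty_iso h₈ fun q =>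
    (filler τ).cell q ≪≫ eqToIso (h₆ q).symm
  refine ⟨τ, ⟨(res X (dotMap τ)).mapIso ι ≪≫ eqToIso ?_ ≪≫ κ⟩⟩
  rw [← res_comp_obj, h₄]

/-! ### The strictification -/

/-- The replacement of a weak 2-category by its cells with a presentation as a pasting. -/
noncomputable def presentedCells : WeakTwoCat.{u} ⥤ (FatDeltaᵒᵖ ⥤ Cat.{u, u}) :=
  (Functor.curry.obj pastedFamily.presented).flip

/-- The strictification of a weak 2-category: the cells are the pastings of 1-cells. -/
noncomputable def strictify : WeakTwoCat.{u} ⥤ (FatDeltaᵒᵖ ⥤ Cat.{u, u}) :=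
  (Functor.curry.obj pastedFamily.strict).flip

lemma ev_map_left {X : WeakTwoCat.{u}} {m n : FatDeltaᵒᵖ} (θ : m ⟶ n) :
    ev.map ((θ, 𝟙 X) : ((m, X) : Idx.{u}) ⟶ (n, X)) = X.obj.map θ :=
  Category.comp_id _

lemma ev_map_right {X Y : WeakTwoCat.{u}} (f : X ⟶ Y) (m : FatDeltaᵒᵖ) :
    ev.map ((𝟙 m, f) : ((m, X) : Idx.{u}) ⟶ (m, Y)) = f.hom.app m :=
  (congrArg (· ≫ _) (X.obj.map_id m)).trans (Category.id_comp _)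

/-- A presented cell is a cell. -/
noncomputable def presentedToSelf :
    presentedCells.{u} ⟶ ObjectProperty.ι (IsWeakTwoCategory.{u}) where
  app X :=
    { app := fun m => pastedFamily.presentedToDiagram.app (m, X)
      naturality := fun m n θ =>
        (pastedFamily.presentedToDiagram.naturality
          ((θ, 𝟙 X) : ((m, X) : Idx) ⟶ (n, X))).trans (congrArg (_ ≫ ·) (ev_map_left θ)) }
  naturality X Y f := NatTrans.ext (funext fun m =>
    (pastedFamily.presentedToDiagram.naturality
      ((𝟙 m, f) : ((m, X) : Idx) ⟶ (m, Y))).trans (congrArg (_ ≫ ·) (ev_map_right f m)))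

/-- A presented cell is presented by a pasting. -/
noncomputable def presentedToStrictify : presentedCells.{u} ⟶ strictify.{u} :=
  (flipFunctor _ _ _).map (Functor.curry.map pastedFamily.presentedToStrict)

lemma isEquivalence_presentedToSelf (X : WeakTwoCat.{u}) (m : FatDeltaᵒᵖ) :
    ((presentedToSelf.app X).app m).toFunctor.IsEquivalence :=
  pastedFamily.isEquivalence_presentedToDiagram (m, X) (exists_pasting (m, X))

lemma isEquivalence_presentedToStrictify (X : WeakTwoCat.{u}) (m : FatDeltaᵒᵖ) :
    ((presentedToStrictify.app X).app m).toFunctor.IsEquivalence :=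
  pastedFamily.isEquivalence_presentedToStrict (m, X)

end FatDelta

namespace FatDelta

/-! ### Concatenations -/

section Concat

variable (m n : FatDelta)

lemma castAdd_mem_links (e : Fin m.len) :
    (Fin.castAdd n.len e : Fin (concat m n).len) ∈ (concat m n).links ↔ e ∈ m.links := by
  constructor
  · rintro (⟨e', h, he⟩ | ⟨e', h, he⟩)
    · rwa [← Fin.castAdd_injective _ _ he]
    · have h₁ := congrArg Fin.val he
      have h₂ := e.2
      simp only [Fin.val_natAdd, Fin.val_castAdd] at h₁
      omega
  · exact fun h => Or.inl ⟨e, h, rfl⟩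

lemma natAdd_mem_links (e : Fin n.len) :
    (Fin.natAdd m.len e : Fin (concat m n).len) ∈ (concat m n).links ↔ e ∈ n.links := by
  constructor
  · rintro (⟨e', h, he⟩ | ⟨e', h, he⟩)
    · have h₁ := congrArg Fin.val he
      have h₂ := e'.2
      simp only [Fin.val_natAdd, Fin.val_castAdd] at h₁
      omega
    · rwa [← Fin.natAdd_injective _ _ he]
  · exact fun h => Or.inr ⟨e, h, rfl⟩

lemma cls_inl (i : m.Dot) : (concat m n).cls ((inl m n).toFun i) = m.cls i := by
  classical
  refine Eq.trans (congrArg Finset.card (Finset.ext fun (e : Fin (m.len + n.len)) => ?_))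
    (Finset.card_map (Fin.castAddEmb n.len))
  refine Iff.trans Finset.mem_filter (Iff.trans ?_ Finset.mem_map.symm)
  simp only [Finset.mem_filter, Finset.mem_univ, true_and]
  constructor
  · rintro ⟨_, h₁, h₂⟩
    have h₃ : e.1 < i.1 := h₂
    have h₄ := i.2
    exact ⟨⟨e.1, by omega⟩, ⟨fun h => h₁ ((castAdd_mem_links m n _).2 h), h₃⟩, rfl⟩
  · rintro ⟨e, ⟨h₁, h₂⟩, rfl⟩
    exact ⟨Finset.mem_univ _, fun h => h₁ ((castAdd_mem_links m n _).1 h), h₂⟩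

lemma cls_inr (j : n.Dot) : (concat m n).cls ((inr m n).toFun j) = m.rank + n.cls j := by
  classical
  let S : Finset (Fin (m.len + n.len)) :=
    (Finset.univ.filter fun e : Fin m.len => e ∉ m.links).map (Fin.castAddEmb n.len)
  let T : Finset (Fin (m.len + n.len)) :=
    (Finset.univ.filter fun e : Fin n.len => e ∉ n.links ∧ e.castSucc < j).map
      (Fin.natAddEmb m.len)
  have hd : Disjoint S T := Finset.disjoint_left.2 fun e h₁ h₂ => by
    obtain ⟨a, _, rfl⟩ := Finset.mem_map.1 h₁
    obtain ⟨b, _, h⟩ := Finset.mem_map.1 h₂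
    have h₃ : m.len + b.1 = a.1 := congrArg Fin.val h
    omega
  refine Eq.trans (congrArg Finset.card (Finset.ext fun (e : Fin (m.len + n.len)) =>
    (?_ : _ ↔ e ∈ S ∪ T)))
    ((Finset.card_union_of_disjoint hd).trans
      (congrArg₂ (· + ·) (Finset.card_map _) (Finset.card_map _)))
  refine Iff.trans Finset.mem_filter ?_
  simp only [S, T, Finset.mem_union, Finset.mem_map, Finset.mem_filter, Finset.mem_univ, true_and]
  constructor
  · rintro ⟨_, h₁, h₂⟩
    have h₃ : e.1 < m.len + j.1 := h₂
    have h₄ := j.2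
    by_cases h₅ : e.1 < m.len
    · exact Or.inl ⟨⟨e.1, h₅⟩, fun h => h₁ ((castAdd_mem_links m n _).2 h), rfl⟩
    · have h₆ : (Fin.natAdd m.len (⟨e.1 - m.len, by omega⟩ : Fin n.len)) = e :=
        Fin.ext (by simp only [Fin.val_natAdd]; omega)
      refine Or.inr ⟨⟨e.1 - m.len, by omega⟩, ⟨fun h => h₁ ?_, ?_⟩, h₆⟩
      · rw [← h₆]
        exact (natAdd_mem_links m n _).2 h
      · exact Fin.lt_def.2 (by change e.1 - m.len < j.1; omega)
  · rintro (⟨e, h₁, rfl⟩ | ⟨e, ⟨h₁, h₂⟩, rfl⟩)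
    · refine ⟨Finset.mem_univ _, fun h => h₁ ((castAdd_mem_links m n _).1 h), ?_⟩
      have := e.2
      exact Fin.lt_def.2 (by change e.1 < m.len + j.1; omega)
    · refine ⟨Finset.mem_univ _, fun h => h₁ ((natAdd_mem_links m n _).1 h), ?_⟩
      exact Fin.lt_def.2 (by change m.len + e.1 < m.len + j.1; have : e.1 < j.1 := h₂; omega)

lemma rank_concat : (concat m n).rank = m.rank + n.rank := by
  rw [← cls_last, ← cls_last n, ← cls_inr]
  rfl

variable {m n}

lemma inl_last : (inl m n).toFun (Fin.last m.len) = (inr m n).toFun 0 := rfl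

/-- The morphism from an ordinal that picks out a dot in each class. -/
def secHom {k : ℕ} (s : (ord k).Dot → m.Dot) (hs : ∀ c, m.cls (s c) = c.1) : ord k ⟶ m :=
  homMk s (fun c d h => by
    by_contra h'
    have h₁ := m.cls_mono (not_lt.1 h')
    have h₂ : c.1 < d.1 := h
    rw [hs, hs] at h₁
    omega) (fun c d h h' => by
    rw [cls_ord, cls_ord] at h'
    rw [hs, hs, h'])

lemma vertical_secHom {k : ℕ} (s : (ord k).Dot → m.Dot) (hs : ∀ c, m.cls (s c) = c.1)
    (hk : m.rank ≤ k) : vertical (secHom s hs) := by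
  rw [vertical_iff]
  refine ⟨fun i j h => ?_, fun y => ⟨⟨m.cls y, ?_⟩, hs _⟩⟩
  · rw [cls_ord, cls_ord, ← hs i, ← hs j]
    exact h
  · have := m.cls_le_rank y
    change _ < k + 1
    omega

lemma exists_sec_last (m : FatDelta) :
    ∃ s : (ord m.rank).Dot → m.Dot, (∀ c, m.cls (s c) = c.1) ∧ s (Fin.last _) = Fin.last _ := by
  classical
  refine ⟨Function.update m.sec (Fin.last _) (Fin.last _), fun c => ?_, by simp⟩
  rcases eq_or_ne c (Fin.last _) with rfl | h
  · rw [Function.update_self, cls_last]; rfl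
  · rw [Function.update_of_ne h, cls_sec]

lemma exists_sec_zero (m : FatDelta) :
    ∃ s : (ord m.rank).Dot → m.Dot, (∀ c, m.cls (s c) = c.1) ∧ s 0 = 0 := by
  classical
  refine ⟨Function.update m.sec 0 0, fun c => ?_, by simp⟩
  rcases eq_or_ne c 0 with rfl | h
  · rw [Function.update_self, cls_zero]; rfl
  · rw [Function.update_of_ne h, cls_sec]

end Concat

/-- In a weak 2-category, the morphisms over a concatenation are the pairs of morphisms over its
two parts. -/
lemma IsWeakTwoCategory.existsUnique_hom {X : FatDeltaᵒᵖ ⥤ Cat.{u, u}} (hX : IsWeakTwoCategory X)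
    {m n : FatDelta} {x y : X.obj (op (concat m n))}
    (h : (res X (inl m n)).obj x ⟶ (res X (inl m n)).obj y)
    (k : (res X (inr m n)).obj x ⟶ (res X (inr m n)).obj y) :
    ∃! f : x ⟶ y, (res X (inl m n)).map f = h ∧ (res X (inr m n)).map f = k := by
  have hd := hX.discrete
  obtain ⟨s, hs, hs'⟩ := m.exists_sec_last
  obtain ⟨s', hs₀, hs₀'⟩ := n.exists_sec_zero
  -- the two sections are glued at the common dot
  let z : (ord (m.rank + n.rank)).Dot → (concat m n).Dot := fun c =>
    if hc : c.1 ≤ m.rank then (inl m n).toFun (s ⟨c.1, Nat.lt_succ_of_le hc⟩)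
    else (inr m n).toFun (s' ⟨c.1 - m.rank, by
      have : c.1 < m.rank + n.rank + 1 := c.2
      change _ < n.rank + 1
      omega⟩)
  have hz₁ : ∀ (c : (ord m.rank).Dot) (d : (ord (m.rank + n.rank)).Dot), d.1 = c.1 →
      z d = (inl m n).toFun (s c) := fun c d hcd => by
    have : c.1 < m.rank + 1 := c.2
    refine (dif_pos (show d.1 ≤ m.rank by omega)).trans ?_
    exact congrArg (fun c => (inl m n).toFun (s c)) (Fin.ext hcd)
  have hz₂ : ∀ (c : (ord n.rank).Dot) (d : (ord (m.rank + n.rank)).Dot), d.1 = m.rank + c.1 →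
      z d = (inr m n).toFun (s' c) := fun c d hcd => by
    by_cases hc : c.1 = 0
    · obtain rfl : c = 0 := Fin.ext hc
      rw [hz₁ (Fin.last _) d hcd, hs', hs₀', inl_last]
    · refine (dif_neg (show ¬ d.1 ≤ m.rank by omega)).trans ?_
      exact congrArg (fun c => (inr m n).toFun (s' c)) (Fin.ext (by simp only []; omega))
  have hz : ∀ c, (concat m n).cls (z c) = c.1 := fun c => by
    have h₀ : c.1 < m.rank + n.rank + 1 := c.2
    by_cases hc : c.1 ≤ m.rank
    · rw [hz₁ ⟨c.1, Nat.lt_succ_of_le hc⟩ c rfl, cls_inl, hs]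
    · have h₁ : c.1 - m.rank < n.rank + 1 := by omega
      rw [hz₂ ⟨c.1 - m.rank, h₁⟩ c (by simp only []; omega), cls_inr, hs₀]
      simp only []
      omega
  have e₁ : ∀ (q : Fin m.rank) (p : Fin (m.rank + n.rank)), p.1 = q.1 →
      edge _ p ≫ secHom z hz = (edge _ q ≫ secHom s hs) ≫ inl m n := fun q p hpq =>
    hom_ext fun i => hz₁ _ _ (congrArg (· + i.1) hpq)
  have e₂ : ∀ (q : Fin n.rank) (p : Fin (m.rank + n.rank)), p.1 = m.rank + q.1 →
      edge _ p ≫ secHom z hz = (edge _ q ≫ secHom s' hs₀) ≫ inr m n := fun q p hpq =>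
    hom_ext fun i => hz₂ _ _ ((congrArg (· + i.1) hpq).trans (Nat.add_assoc _ _ _))
  have sp := hX.spine_of_vertical _ (vertical_secHom z hz (rank_concat m n).le)
  have sp₁ := hX.spine_of_vertical _ (vertical_secHom s hs le_rfl)
  have sp₂ := hX.spine_of_vertical _ (vertical_secHom s' hs₀ le_rfl)
  have hv : (res X ((concat m n).dot (z 0))).obj x = (res X ((concat m n).dot (z 0))).obj y := by
    have e : (concat m n).dot (z 0) = m.dot (s 0) ≫ inl m n := hom_ext fun _ => hz₁ 0 0 rfl
    rw [e, res_comp_obj, res_comp_obj]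
    exact IsDiscrete.eq_of_hom ((res X _).map h)
  have key₁ : ∀ (q : Fin m.rank) (p : Fin (m.rank + n.rank)), p.1 = q.1 →
      res X (edge _ p ≫ secHom z hz) = res X (inl m n) ⋙ res X (edge _ q ≫ secHom s hs) :=
    fun q p hq => (congrArg (res X) (e₁ q p hq)).trans (res_comp X _ _)
  have key₂ : ∀ (q : Fin n.rank) (p : Fin (m.rank + n.rank)), p.1 = m.rank + q.1 →
      res X (edge _ p ≫ secHom z hz) = res X (inr m n) ⋙ res X (edge _ q ≫ secHom s' hs₀) :=
    fun q p hq => (congrArg (res X) (e₂ q p hq)).trans (res_comp X _ _)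
  have hsplit : ∀ p : Fin (m.rank + n.rank), (∃ q : Fin m.rank, p.1 = q.1) ∨
      ∃ q : Fin n.rank, p.1 = m.rank + q.1 := fun p => by
    by_cases hp : p.1 < m.rank
    · exact Or.inl ⟨⟨p.1, hp⟩, rfl⟩
    · exact Or.inr ⟨⟨p.1 - m.rank, by omega⟩, by simp only []; omega⟩
  have inj : ∀ f g : x ⟶ y, (res X (inl m n)).map f = (res X (inl m n)).map g →
      (res X (inr m n)).map f = (res X (inr m n)).map g → f = g := fun f g h₁ h₂ =>
    sp.hom_ext hv fun p => by
      rcases hsplit p with ⟨q, hq⟩ | ⟨q, hq⟩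
      · rw [map_eq_of_functor_eq (key₁ q p hq), map_eq_of_functor_eq (key₁ q p hq) g,
          Functor.comp_map, Functor.comp_map, h₁]
      · rw [map_eq_of_functor_eq (key₂ q p hq), map_eq_of_functor_eq (key₂ q p hq) g,
          Functor.comp_map, Functor.comp_map, h₂]
  -- on the spine, the morphism is prescribed by `h` on the left and by `k` on the right
  have hw : ∀ p : Fin (m.rank + n.rank), ∃ w : (res X (edge _ p ≫ secHom z hz)).obj x ⟶
      (res X (edge _ p ≫ secHom z hz)).obj y,
      (∀ (q : Fin m.rank) (hq : p.1 = q.1), w = eqToHom (Functor.congr_obj (key₁ q p hq) x) ≫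
        (res X (edge _ q ≫ secHom s hs)).map h ≫
          eqToHom (Functor.congr_obj (key₁ q p hq) y).symm) ∧
      ∀ (q : Fin n.rank) (hq : p.1 = m.rank + q.1), w =
        eqToHom (Functor.congr_obj (key₂ q p hq) x) ≫
          (res X (edge _ q ≫ secHom s' hs₀)).map k ≫
            eqToHom (Functor.congr_obj (key₂ q p hq) y).symm := fun p => by
    rcases hsplit p with ⟨q, hq⟩ | ⟨q, hq⟩
    · refine ⟨eqToHom (Functor.congr_obj (key₁ q p hq) x) ≫
        (res X (edge _ q ≫ secHom s hs)).map h ≫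
          eqToHom (Functor.congr_obj (key₁ q p hq) y).symm, fun q' hq' => ?_,
        fun q' hq' => absurd (hq.symm.trans hq') (by omega)⟩
      obtain rfl : q = q' := Fin.ext (hq.symm.trans hq')
      rfl
    · refine ⟨eqToHom (Functor.congr_obj (key₂ q p hq) x) ≫
        (res X (edge _ q ≫ secHom s' hs₀)).map k ≫
          eqToHom (Functor.congr_obj (key₂ q p hq) y).symm,
        fun q' hq' => absurd (hq.symm.trans hq') (by omega), fun q' hq' => ?_⟩
      obtain rfl : q = q' := Fin.ext (by omega)
      rfl
  choose w hw₁ hw₂ using hw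
  obtain ⟨f, hf⟩ := (sp.bijective x y hv).2 w
  have conj : ∀ {A : Type u} [Category.{u} A] {a a' b b' : A} (e : a = a') (e' : b' = b)
      {f g : a' ⟶ b'}, eqToHom e ≫ f ≫ eqToHom e' = eqToHom e ≫ g ≫ eqToHom e' → f = g := by
    rintro A _ a _ b _ rfl rfl f g h
    simpa using h
  have h₁ : (res X (inl m n)).map f = h :=
    sp₁.hom_ext (IsDiscrete.eq_of_hom ((res X _).map h)) fun q => by
      have e := key₁ q ⟨q.1, by omega⟩ rfl
      exact conj (Functor.congr_obj e x) (Functor.congr_obj e y).symm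
        ((map_eq_of_functor_eq e f).symm.trans ((congrFun hf _).trans (hw₁ _ q rfl)))
  have h₂ : (res X (inr m n)).map f = k :=
    sp₂.hom_ext (IsDiscrete.eq_of_hom ((res X _).map k)) fun q => by
      have e := key₂ q ⟨m.rank + q.1, by omega⟩ rfl
      exact conj (Functor.congr_obj e x) (Functor.congr_obj e y).symm
        ((map_eq_of_functor_eq e f).symm.trans ((congrFun hf _).trans (hw₂ _ q rfl)))
  exact ⟨f, ⟨h₁, h₂⟩, fun g hg => inj _ _ (hg.1.trans h₁.symm) (hg.2.trans h₂.symm)⟩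

end FatDelta

/-! ### Gluing composable sequences -/

section Glue

variable {V E : Type u} {s t : E → V}

namespace PathCat

lemma seg_congr {r : ℕ} (τ : ComposableArrows (PathCat s t) r) {i j i' j' : Fin (r + 1)}
    (hi : i = i') (hj : j = j') (h : i ≤ j) (h' : i' ≤ j') : seg τ i j h = seg τ i' j' h' := by
  subst hi hj
  rfl

/-- Two composable sequences with a common vertex are glued to a longer one. -/
lemma existsUnique_glue {a b r : ℕ} (hr : r = a + b) (p : Fin (a + 1) →o Fin (r + 1))
    (hp : ∀ c, (p c).1 = c.1) (q : Fin (b + 1) →o Fin (r + 1)) (hq : ∀ c, (q c).1 = a + c.1)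
    (τ : ComposableArrows (PathCat s t) a) (σ : ComposableArrows (PathCat s t) b)
    (h : (τ.obj (Fin.last a)).pt = (σ.obj 0).pt) :
    ∃! ρ : ComposableArrows (PathCat s t) r,
      ((∀ c, (ρ.obj (p c)).pt = (τ.obj c).pt) ∧
        ∀ c d h, seg ρ (p c) (p d) (p.monotone h) = seg τ c d h) ∧
      (∀ c, (ρ.obj (q c)).pt = (σ.obj c).pt) ∧
        ∀ c d h, seg ρ (q c) (q d) (q.monotone h) = seg σ c d h := by
  subst hr
  -- the vertices and the consecutive paths of the glued sequence, with their compatibilities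
  have hv : ∀ c : Fin (a + b + 1), ∃ v : V, (∀ c' : Fin (a + 1), c.1 = c'.1 → v = (τ.obj c').pt) ∧
      ∀ c' : Fin (b + 1), c.1 = a + c'.1 → v = (σ.obj c').pt := fun c => by
    by_cases hc : c.1 ≤ a
    · refine ⟨(τ.obj ⟨c.1, by omega⟩).pt, fun c' h' => ?_, fun c' h' => ?_⟩
      · exact congrArg (fun c => (τ.obj c).pt) (Fin.ext h')
      · obtain rfl : c' = 0 := Fin.ext (by change c'.1 = 0; omega)
        exact Eq.trans (congrArg (fun c => (τ.obj c).pt) (Fin.ext (by simpa using h'))) h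
    · refine ⟨(σ.obj ⟨c.1 - a, by omega⟩).pt, fun c' h' => absurd h' (by omega), fun c' h' => ?_⟩
      exact congrArg (fun c => (σ.obj c).pt) (Fin.ext (by simp only []; omega))
  have hL : ∀ c : Fin (a + b), ∃ l : List E,
      (∀ c' : Fin a, c.1 = c'.1 → l = seg τ c'.castSucc c'.succ Fin.castSucc_lt_succ.le) ∧
        ∀ c' : Fin b, c.1 = a + c'.1 → l = seg σ c'.castSucc c'.succ Fin.castSucc_lt_succ.le :=
    fun c => by
      by_cases hc : c.1 < a
      · refine ⟨seg τ (Fin.castSucc ⟨c.1, hc⟩) (Fin.succ ⟨c.1, hc⟩) Fin.castSucc_lt_succ.le,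
          fun c' h' => ?_, fun c' h' => absurd h' (by omega)⟩
        obtain rfl : c' = ⟨c.1, hc⟩ := Fin.ext h'.symm
        rfl
      · have hc' : c.1 - a < b := by omega
        refine ⟨seg σ (Fin.castSucc ⟨c.1 - a, hc'⟩) (Fin.succ ⟨c.1 - a, hc'⟩)
          Fin.castSucc_lt_succ.le, fun c' h' => absurd h' (by omega), fun c' h' => ?_⟩
        obtain rfl : c' = ⟨c.1 - a, hc'⟩ := Fin.ext (by simp only []; omega)
        rfl
  choose v hv₁ hv₂ using hv
  choose L hL₁ hL₂ using hL
  have hP : ∀ c : Fin (a + b), IsPath s t (v c.castSucc) (L c) (v c.succ) := fun c => by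
    by_cases hc : c.1 < a
    · rw [hL₁ c ⟨c.1, hc⟩ rfl, hv₁ c.castSucc (Fin.castSucc ⟨c.1, hc⟩) rfl,
        hv₁ c.succ (Fin.succ ⟨c.1, hc⟩) rfl]
      exact isPath_seg _ _ _ _
    · have hc' : c.1 - a < b := by omega
      have e : c.1 = a + (c.1 - a) := by omega
      rw [hL₂ c ⟨c.1 - a, hc'⟩ e, hv₂ c.castSucc (Fin.castSucc ⟨c.1 - a, hc'⟩) e,
        hv₂ c.succ (Fin.succ ⟨c.1 - a, hc'⟩) (by simp only [Fin.val_succ]; omega)]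
      exact isPath_seg _ _ _ _
  -- long segments decompose into consecutive ones
  have ext₁ : ∀ (r : ℕ) (ρ : ComposableArrows (PathCat s t) (a + b))
      (f : Fin (r + 1) →o Fin (a + b + 1))
      (τ : ComposableArrows (PathCat s t) r), (∀ c, (ρ.obj (f c)).pt = (τ.obj c).pt) →
      (∀ c : Fin r, seg ρ (f c.castSucc) (f c.succ) (f.monotone Fin.castSucc_lt_succ.le) =
        seg τ c.castSucc c.succ Fin.castSucc_lt_succ.le) →
      ∀ c d h, seg ρ (f c) (f d) (f.monotone h) = seg τ c d h := by
    intro r ρ f τ h₁ h₂ c d h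
    have e := composable_ext (τ := f.monotone.functor ⋙ ρ) (σ := τ) h₁ h₂
    subst e
    rfl
  refine ⟨ofPaths v L hP, ⟨⟨fun c => hv₁ _ _ (hp c), ext₁ a _ p τ
    (fun c => hv₁ _ _ (hp c)) fun c => ?_⟩, fun c => hv₂ _ _ (hq c),
    ext₁ b _ q σ (fun c => hv₂ _ _ (hq c)) fun c => ?_⟩, ?_⟩
  · have hc : c.1 < a + b := by omega
    refine Eq.trans ?_ ((seg_ofPaths v L hP ⟨c.1, hc⟩).trans (hL₁ ⟨c.1, hc⟩ c rfl))
    exact seg_congr _ (Fin.ext (hp _)) (Fin.ext (hp _)) _ _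
  · have hc : a + c.1 < a + b := by omega
    refine Eq.trans ?_ ((seg_ofPaths v L hP ⟨a + c.1, hc⟩).trans (hL₂ ⟨a + c.1, hc⟩ c rfl))
    exact seg_congr _ (Fin.ext (hq _)) (Fin.ext (hq _)) _ _
  · rintro ρ ⟨⟨h₁, h₂⟩, h₃, h₄⟩
    refine composable_ext (fun c => ?_) fun c => ?_
    · by_cases hc : c.1 ≤ a
      · have e : p ⟨c.1, by omega⟩ = c := Fin.ext (hp _)
        rw [← e]
        exact (h₁ _).trans (hv₁ _ _ (hp _)).symm
      · have e : q ⟨c.1 - a, by omega⟩ = c := Fin.ext (by rw [hq]; simp only []; omega)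
        rw [← e]
        exact (h₃ _).trans (hv₂ _ _ (hq _)).symm
    · refine Eq.trans ?_ (seg_ofPaths v L hP c).symm
      by_cases hc : c.1 < a
      · have e₁ : c.castSucc = p (Fin.castSucc ⟨c.1, hc⟩) :=
          Fin.ext (hp (Fin.castSucc ⟨c.1, hc⟩)).symm
        have e₂ : c.succ = p (Fin.succ ⟨c.1, hc⟩) :=
          Fin.ext (hp (Fin.succ ⟨c.1, hc⟩)).symm
        rw [hL₁ c ⟨c.1, hc⟩ rfl, ← h₂]
        exact seg_congr _ e₁ e₂ _ _
      · have hc' : c.1 - a < b := by omega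
        have e : c.1 = a + (c.1 - a) := by omega
        have e₁ : c.castSucc = q (Fin.castSucc ⟨c.1 - a, hc'⟩) :=
          Fin.ext (e.trans (hq (Fin.castSucc ⟨c.1 - a, hc'⟩)).symm)
        have e₂ : c.succ = q (Fin.succ ⟨c.1 - a, hc'⟩) :=
          Fin.ext ((congrArg (· + 1) e).trans (hq (Fin.succ ⟨c.1 - a, hc'⟩)).symm)
        rw [hL₂ c ⟨c.1 - a, hc'⟩ e, ← h₄]
        exact seg_congr _ e₁ e₂ _ _

end PathCat

end Glue

namespace PseudoFamily

universe v w

variable {J : Type w} [Category.{v} J] {X : J ⥤ Cat.{u, u}} {T : J ⥤ Type u}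
  (P : PseudoFamily X T)

lemma strictMap_bijective {i j : J} (θ : i ⟶ j)
    (h : ∀ x y, Function.Bijective ((X.map θ).toFunctor.map (X := x) (Y := y)))
    (τ σ : P.Strict i) : Function.Bijective ((P.strictMap θ).map (X := τ) (Y := σ)) := by
  refine ⟨fun f g hfg => ?_, fun f => ?_⟩
  · have e : (P.η θ τ _ rfl).inv ≫ (X.map θ).toFunctor.map f.hom ≫ (P.η θ σ _ rfl).hom =
        (P.η θ τ _ rfl).inv ≫ (X.map θ).toFunctor.map g.hom ≫ (P.η θ σ _ rfl).hom :=
      congrArg InducedCategory.Hom.hom hfg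
    refine InducedCategory.hom_ext ((h _ _).1 ?_)
    exact (cancel_mono _).1 ((cancel_epi _).1 e)
  · obtain ⟨g, hg⟩ := (h _ _).2 ((P.η θ τ _ rfl).hom ≫ f.hom ≫ (P.η θ σ _ rfl).inv)
    refine ⟨InducedCategory.homMk g, InducedCategory.hom_ext ?_⟩
    change (P.η θ τ _ rfl).inv ≫ (X.map θ).toFunctor.map g ≫ (P.η θ σ _ rfl).hom = f.hom
    rw [hg]
    simp

lemma isIso_strict_map {i j : J} (θ : i ⟶ j) (hT : Function.Bijective (T.map θ))
    (h : ∀ x y, Function.Bijective ((X.map θ).toFunctor.map (X := x) (Y := y))) :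
    IsIso (P.strict.map θ) :=
  (Cat.isIso_iff _).2 ⟨hT, P.strictMap_bijective θ h⟩

lemma presentedMap_obj_eq {i j : J} (θ : i ⟶ j) (c : P.PresentedCat i) (a : P.PresentedCat j)
    (h₁ : T.map θ c.τ = a.τ) (h₂ : (X.map θ).toFunctor.obj c.x = a.x)
    (h₃ : (X.map θ).toFunctor.map c.ι.hom = (P.η θ c.τ a.τ h₁).hom ≫ a.ι.hom ≫ eqToHom h₂.symm) :
    (P.presentedMap θ).obj c = a := by
  obtain ⟨τ, x, ι⟩ := a
  dsimp only at h₁ h₂ h₃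
  subst h₁ h₂
  refine Presented.ext P rfl rfl ?_
  rw [presentedMap_ι_hom, h₃]
  simp

lemma map_ι_of_presentedMap_obj_eq {i j : J} {θ : i ⟶ j} {c : P.PresentedCat i}
    {a : P.PresentedCat j} (h : (P.presentedMap θ).obj c = a) :
    (X.map θ).toFunctor.map c.ι.hom =
      (P.η θ c.τ a.τ (congrArg Presented.τ h)).hom ≫ a.ι.hom ≫
        eqToHom (congrArg Presented.x h).symm := by
  subst h
  change _ = (P.η θ c.τ _ _).hom ≫ ((P.η θ c.τ _ rfl).inv ≫ (X.map θ).toFunctor.map c.ι.hom) ≫ _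
  rw [Category.assoc]
  exact ((Iso.hom_inv_id_assoc _ _).trans (Category.comp_id _)).symm

/-- If the elements and the objects are transported bijectively, then so are the presented
objects. -/
lemma isIso_presented_map {i j : J} (θ : i ⟶ j) (hT : Function.Bijective (T.map θ))
    (h : IsIso (X.map θ)) : IsIso (P.presented.map θ) := by
  obtain ⟨ho, hm⟩ := (Cat.isIso_iff _).1 h
  refine (Cat.isIso_iff _).2 ⟨⟨fun c c' hcc => ?_, fun a => ?_⟩, fun c c' => ?_⟩
  · have h₁ := P.map_ι_of_presentedMap_obj_eq (θ := θ) (c := c) rfl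
    have h₂ := P.map_ι_of_presentedMap_obj_eq (θ := θ) (c := c') hcc.symm
    have hτ : c.τ = c'.τ := hT.1 (congrArg Presented.τ hcc)
    have hx : c.x = c'.x := ho.1 (congrArg Presented.x hcc)
    obtain ⟨τ, x, ι⟩ := c
    obtain ⟨τ', x', ι'⟩ := c'
    dsimp only at hτ hx
    subst hτ hx
    have e : ι = ι' := Iso.ext ((hm _ _).1 (h₁.trans h₂.symm))
    rw [e]
  · obtain ⟨τ, hτ⟩ := hT.2 a.τ
    obtain ⟨x, hx⟩ := ho.2 a.x
    have : (X.map θ).toFunctor.FullyFaithful :=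
      { preimage := fun f => ((hm _ _).2 f).choose
        map_preimage := fun f => ((hm _ _).2 f).choose_spec
        preimage_map := fun f => (hm _ _).1 ((hm _ _).2 _).choose_spec }
    refine ⟨⟨τ, x, this.preimageIso (P.η θ τ a.τ hτ ≪≫ a.ι ≪≫ eqToIso hx.symm)⟩,
      P.presentedMap_obj_eq θ _ _ hτ hx ?_⟩
    exact this.map_preimage _
  · refine ⟨fun f g hfg => InducedCategory.hom_ext ((hm _ _).1 ?_), fun f => ?_⟩
    · exact congrArg (fun f : (P.presentedMap θ).obj c ⟶ (P.presentedMap θ).obj c' => f.hom) hfg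
    · obtain ⟨g, hg⟩ := (hm _ _).2 f.hom
      exact ⟨InducedCategory.homMk g, InducedCategory.hom_ext hg⟩

end PseudoFamily

namespace FatDelta

/-! ### The strictification is a fair 2-category -/

lemma pasted_vertex {j : Idx.{u}} (τ : pasting.obj j) (i : j.1.unop.Dot) :
    (res j.2.obj (j.1.unop.dot i)).obj (pastedFamily.e j τ) =
      ((toPaths τ).obj (j.1.unop.proj i)).pt :=
  (res_comp_obj _ _ _ _).symm.trans (filler_vertex τ _ i rfl)

lemma pasting_ext {j : Idx.{u}} {τ σ : pasting.obj j}
    (h₀ : ∀ c, ((toPaths τ).obj c).pt = ((toPaths σ).obj c).pt)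
    (h : ∀ q : Fin j.1.unop.rank,
      PathCat.seg (toPaths τ) q.castSucc q.succ (Fin.castSucc_lt_succ (i := q)).le =
        PathCat.seg (toPaths σ) q.castSucc q.succ (Fin.castSucc_lt_succ (i := q)).le) : τ = σ :=
  PathCat.composable_ext h₀ h

lemma rank_pt : pt.rank = 0 := rank_ord 0

/-- A pasting over the one-dot semi-ordinal is an object. -/
lemma pasted_pt_injective (X : WeakTwoCat.{u}) :
    Function.Injective (pastedFamily.e (op pt, X)) := fun τ σ h => by
  refine pasting_ext (fun c => ?_) fun q => absurd q.2 (by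
    have := rank_pt
    change ¬ q.1 < pt.rank
    omega)
  obtain ⟨i, rfl⟩ := pt.proj_surjective c
  exact (pasted_vertex τ i).symm.trans
    ((congrArg (res X.obj (pt.dot i)).obj h).trans (pasted_vertex σ i))

variable (X : WeakTwoCat.{u})

lemma isDiscrete_strictify : IsDiscrete ((strictify.obj X).obj (op pt)) where
  subsingleton _ _ := ⟨fun _ _ => InducedCategory.hom_ext
    ((X.property.discrete.subsingleton _ _).elim _ _)⟩
  eq_of_hom f := pasted_pt_injective X (X.property.discrete.eq_of_hom f.hom)

lemma isDiscrete_presentedCells : IsDiscrete ((presentedCells.obj X).obj (op pt)) where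
  subsingleton _ _ := ⟨fun _ _ => InducedCategory.hom_ext
    ((X.property.discrete.subsingleton _ _).elim _ _)⟩
  eq_of_hom {a b} f := by
    have hd := X.property.discrete
    have hx : a.x = b.x := hd.eq_of_hom f.hom
    have hτ : a.τ = b.τ := pasted_pt_injective X
      ((hd.eq_of_hom a.ι.hom).trans (hx.trans (hd.eq_of_hom b.ι.hom).symm))
    exact PseudoFamily.Presented.ext _ hτ hx ((hd.subsingleton _ _).elim _ _)

/-- A pasting over a semi-ordinal depends only on its contraction. -/
lemma pasting_map_bijective {m n : FatDelta} (f : m ⟶ n) (hf : vertical f) :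
    Function.Bijective (pasting.map ((f.op, 𝟙 X) : ((op n, X) : Idx.{u}) ⟶ (op m, X))) := by
  have := (isIso_contract_map_iff f).2 hf
  rw [← isIso_iff_bijective]
  have h : IsIso ((contract.op.prod (ObjectProperty.ι (IsWeakTwoCategory.{u}) ⋙ oneCells ⋙
      nerveFunctor)).map ((f.op, 𝟙 X) : ((op n, X) : Idx.{u}) ⟶ (op m, X))) :=
    (isIso_prod_iff _ _).2 ⟨inferInstanceAs (IsIso (contract.map f).op),
      inferInstanceAs (IsIso (((ObjectProperty.ι (IsWeakTwoCategory.{u})) ⋙ oneCells ⋙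
        nerveFunctor).map (𝟙 X)))⟩
  exact inferInstanceAs (IsIso ((evaluationUncurried SimplexCategoryᵒᵖ (Type u)).map _))

lemma bijective_map_of_isEquivalence {A B : Type u} [Category.{u} A] [Category.{u} B] (F : A ⥤ B)
    (_ : F.IsEquivalence) (x y : A) : Function.Bijective (F.map (X := x) (Y := y)) :=
  ⟨F.map_injective, F.map_surjective⟩

/-- The strictification sends vertical morphisms to isomorphisms. -/
lemma isIso_strictify_map {m n : FatDelta} (f : m ⟶ n) (hf : vertical f) :
    IsIso ((strictify.obj X).map f.op) :=
  pastedFamily.isIso_strict_map _ (pasting_map_bijective X f hf) 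
    (bijective_map_of_isEquivalence _ (X.property.colours f hf))

lemma isIso_presentedCells_map {m n : FatDelta} (f : m ⟶ n) (hf : vertical f)
    (h : IsIso (X.obj.map f.op)) : IsIso ((presentedCells.obj X).map f.op) :=
  pastedFamily.isIso_presented_map
    ((f.op, 𝟙 X) : ((op n, X) : Idx.{u}) ⟶ (op m, X)) (pasting_map_bijective X f hf) (by
      rw [ev_map_left]
      exact h)

lemma pasting_map_eq_iff {m n : FatDelta} (f : m ⟶ n) (ρ : pasting.obj ((op n, X) : Idx.{u}))
    (τ : pasting.obj ((op m, X) : Idx.{u})) :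
    pasting.map ((f.op, 𝟙 X) : ((op n, X) : Idx.{u}) ⟶ (op m, X)) ρ = τ ↔
      (∀ c, ((toPaths ρ).obj ((contract.map f).toOrderHom c)).pt = ((toPaths τ).obj c).pt) ∧
        ∀ c d h, PathCat.seg (toPaths ρ) _ _ ((contract.map f).toOrderHom.monotone h) =
          PathCat.seg (toPaths τ) c d h := by
  have key : ∀ c d h, PathCat.seg (toPaths (pasting.map
      ((f.op, 𝟙 X) : ((op n, X) : Idx.{u}) ⟶ (op m, X)) ρ)) c d h =
        PathCat.seg (toPaths ρ) _ _ ((contract.map f).toOrderHom.monotone h) := fun c d h =>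
    (pasting_map_seg ((f.op, 𝟙 X) : ((op n, X) : Idx.{u}) ⟶ (op m, X)) ρ c d h).trans
      (List.map_id _)
  constructor
  · rintro rfl
    exact ⟨fun c => rfl, fun c d h => (key c d h).symm⟩
  · rintro ⟨h₀, h⟩
    exact pasting_ext h₀ fun q => (key _ _ _).trans (h _ _ _)

lemma contract_inl_apply (m n : FatDelta) (c : Fin (m.rank + 1)) :
    ((contract.map (inl m n)).toOrderHom c).1 = c.1 := by
  obtain ⟨i, rfl⟩ := m.proj_surjective c
  exact (congrArg Fin.val (contract_map_proj (inl m n) i)).trans (cls_inl m n i)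

lemma contract_inr_apply (m n : FatDelta) (c : Fin (n.rank + 1)) :
    ((contract.map (inr m n)).toOrderHom c).1 = m.rank + c.1 := by
  obtain ⟨i, rfl⟩ := n.proj_surjective c
  exact (congrArg Fin.val (contract_map_proj (inr m n) i)).trans (cls_inr m n i)

/-- Pastings satisfy the strict Segal condition. -/
lemma existsUnique_pasting {m n : FatDelta} (τ : pasting.obj ((op m, X) : Idx.{u}))
    (σ : pasting.obj ((op n, X) : Idx.{u}))
    (h : pasting.map (((m.dot (Fin.last m.len)).op, 𝟙 X) : ((op m, X) : Idx.{u}) ⟶ (op pt, X)) τ =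
      pasting.map (((n.dot 0).op, 𝟙 X) : ((op n, X) : Idx.{u}) ⟶ (op pt, X)) σ) :
    ∃! ρ : pasting.obj ((op (concat m n), X) : Idx.{u}),
      pasting.map (((inl m n).op, 𝟙 X) : ((op (concat m n), X) : Idx.{u}) ⟶ (op m, X)) ρ = τ ∧
        pasting.map (((inr m n).op, 𝟙 X) : ((op (concat m n), X) : Idx.{u}) ⟶ (op n, X)) ρ = σ := by
  have hv : ((toPaths τ).obj (Fin.last m.rank)).pt = ((toPaths σ).obj 0).pt := by
    have h₁ := congrArg (fun ρ => ((toPaths ρ).obj (pt.proj 0)).pt) h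
    have h₂ := contract_map_proj (m.dot (Fin.last m.len)) 0
    have h₃ := contract_map_proj (n.dot 0) 0
    have e₂ : m.proj (Fin.last m.len) = Fin.last m.rank := Fin.ext m.cls_last
    have e₃ : n.proj 0 = 0 := Fin.ext n.cls_zero
    exact (congrArg (fun c => ((toPaths τ).obj c).pt) (h₂.trans e₂).symm).trans
      (h₁.trans (congrArg (fun c => ((toPaths σ).obj c).pt) (h₃.trans e₃)))
  refine (existsUnique_congr fun ρ => ?_).1 (PathCat.existsUnique_glue (rank_concat m n)
    (contract.map (inl m n)).toOrderHom (contract_inl_apply m n)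
    (contract.map (inr m n)).toOrderHom (contract_inr_apply m n) (toPaths τ) (toPaths σ) hv)
  exact and_congr (pasting_map_eq_iff X (inl m n) ρ τ).symm
    (pasting_map_eq_iff X (inr m n) ρ σ).symm

lemma concat_condition (Y : FatDeltaᵒᵖ ⥤ Cat.{u, u}) (m n : FatDelta) :
    Y.map (inl m n).op ≫ Y.map (m.dot (Fin.last m.len)).op =
      Y.map (inr m n).op ≫ Y.map (n.dot 0).op := by
  rw [← Y.map_comp, ← Y.map_comp, ← op_comp, ← op_comp]
  rfl

/-- The strictification of a weak 2-category is fair: on objects, the Segal condition is the one for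
pastings; on morphisms, it is the one of the weak 2-category, conjugated by the isomorphisms that
compare the restriction of a pasted cell with the cell of the restricted pasting. -/
lemma isFairTwoCategory_strictify : IsFairTwoCategory (strictify.obj X) where
  discrete := isDiscrete_strictify X
  colours f hf := by
    have := isIso_strictify_map X f hf
    exact (Cat.equivOfIso (asIso ((strictify.obj X).map f.op))).isEquivalence_functor
  segal m n := by
    refine (isPullback_iff_isDiscretePullback (isDiscrete_strictify X)
      (concat_condition _ m n)).2 ⟨existsUnique_pasting X, fun {a a'} h k => ?_⟩
    let θ : ((op (concat m n), X) : Idx.{u}) ⟶ (op m, X) := ((inl m n).op, 𝟙 X)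
    let θ' : ((op (concat m n), X) : Idx.{u}) ⟶ (op n, X) := ((inr m n).op, 𝟙 X)
    have key : ∀ {A : Type u} [Category.{u} A] {x x' y y' : A} (p : x ≅ y) (q : x' ≅ y')
        (f : x ⟶ x') (g : y ⟶ y'), p.inv ≫ f ≫ q.hom = g ↔ f = p.hom ≫ g ≫ q.inv := by
      intro A _ x x' y y' p q f g
      rw [Iso.inv_comp_eq, ← Iso.eq_comp_inv, Category.assoc]
    let h' := (pastedFamily.η θ a _ rfl).hom ≫ h.hom ≫ (pastedFamily.η θ a' _ rfl).inv
    let k' := (pastedFamily.η θ' a _ rfl).hom ≫ k.hom ≫ (pastedFamily.η θ' a' _ rfl).inv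
    obtain ⟨f, ⟨hf₁, hf₂⟩, hf⟩ := X.property.existsUnique_hom (x := pastedFamily.e _ a)
      (y := pastedFamily.e _ a') h' k'
    refine ⟨InducedCategory.homMk f, ⟨InducedCategory.hom_ext ((key _ _ _ _).2 hf₁),
      InducedCategory.hom_ext ((key _ _ _ _).2 hf₂)⟩, fun g hg => InducedCategory.hom_ext
        (hf _ ⟨(key _ _ _ _).1 (congrArg InducedCategory.Hom.hom hg.1),
          (key _ _ _ _).1 (congrArg InducedCategory.Hom.hom hg.2)⟩)⟩

end FatDelta

section

variable {A B : Type u} [Category.{u} A] [Category.{u} B] {F G : A ⥤ B}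

lemma map_eq_map_iff_of_functor_eq (h : F = G) {x y : A} (f g : x ⟶ y) :
    F.map f = F.map g ↔ G.map f = G.map g := by
  subst h
  rfl

lemma exists_map_eq_iff_of_functor_eq (h : F = G) {x y : A} (w : F.obj x ⟶ F.obj y) :
    ∃ w' : G.obj x ⟶ G.obj y, ∀ f : x ⟶ y, F.map f = w ↔ G.map f = w' := by
  subst h
  exact ⟨w, fun _ => Iff.rfl⟩

end

lemma IsDiscretePullback.existsUnique_iso {A B C D : Type u} [Category.{u} A] [Category.{u} B]
    [Category.{u} C] [Category.{u} D] {p : A ⥤ B} {q : A ⥤ C} {f : B ⥤ D} {g : C ⥤ D}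
    (hP : IsDiscretePullback p q f g) {a a' : A} (h : p.obj a ≅ p.obj a')
    (k : q.obj a ≅ q.obj a') : ∃! m : a ≅ a', p.map m.hom = h.hom ∧ q.map m.hom = k.hom := by
  obtain ⟨f, ⟨hf, hf'⟩, hfu⟩ := hP.hom h.hom k.hom
  obtain ⟨g, ⟨hg, hg'⟩, -⟩ := hP.hom h.inv k.inv
  refine ⟨⟨f, g, (hP.hom (𝟙 _) (𝟙 _)).unique ⟨?_, ?_⟩ ⟨p.map_id _, q.map_id _⟩,
    (hP.hom (𝟙 _) (𝟙 _)).unique ⟨?_, ?_⟩ ⟨p.map_id _, q.map_id _⟩⟩, ⟨hf, hf'⟩,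
    fun m hm => Iso.ext (hfu _ hm)⟩
  · rw [p.map_comp, hf, hg, h.hom_inv_id]
  · rw [q.map_comp, hf', hg', k.hom_inv_id]
  · rw [p.map_comp, hf, hg, h.inv_hom_id]
  · rw [q.map_comp, hf', hg', k.inv_hom_id]

namespace FatDelta

/-! ### Fair 2-categories are weak 2-categories -/

section FairWeak

variable {X : FatDeltaᵒᵖ ⥤ Cat.{u, u}}

lemma isDiscretePullback_of_isFairTwoCategory (hX : IsFairTwoCategory X) (m n : FatDelta) :
    IsDiscretePullback (res X (inl m n)) (res X (inr m n)) (res X (m.dot (Fin.last m.len)))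
      (res X (n.dot 0)) :=
  (isPullback_iff_isDiscretePullback hX.discrete (concat_condition X m n)).1 (hX.segal m n)

/-- Appending an edge to a semi-ordinal without links. -/
def ordSucc (k : ℕ) : ord (k + 1) ⟶ concat (ord k) arrow :=
  homMk id strictMono_id fun i j h h' => by
    rw [cls_ord, cls_ord] at h'
    exact absurd h' (Fin.lt_def.1 h).ne

lemma concat_ord_links (k : ℕ) : (concat (ord k) arrow).links = ∅ := by
  simp only [concat, ord, arrow, Set.image_empty, Set.union_empty]
  rfl

/-- The inverse of `ordSucc`. -/
def ordSuccInv (k : ℕ) : concat (ord k) arrow ⟶ ord (k + 1) :=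
  homMk id strictMono_id fun i j h h' => by
    rw [cls_of_links_eq_empty _ (concat_ord_links k),
      cls_of_links_eq_empty _ (concat_ord_links k)] at h'
    exact absurd h' (Fin.lt_def.1 h).ne

lemma ordSucc_comp_inv (k : ℕ) : ordSucc k ≫ ordSuccInv k = 𝟙 _ := rfl

lemma inv_comp_ordSucc (k : ℕ) : ordSuccInv k ≫ ordSucc k = 𝟙 _ := rfl

lemma vertical_of_iso {m n : FatDelta} (f : m ⟶ n) (g : n ⟶ m) (h : f ≫ g = 𝟙 _)
    (h' : g ≫ f = 𝟙 _) : vertical f :=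
  (isIso_contract_map_iff f).1 (haveI : IsIso f := ⟨g, h, h'⟩; inferInstance)

lemma edge_castSucc_ordSucc (k : ℕ) (j : Fin k) :
    edge (k + 1) j.castSucc ≫ ordSucc k = edge k j ≫ inl (ord k) arrow := rfl

/-- Concatenation with an edge extends the spine by one step. -/
lemma spine_concat_of_isFairTwoCategory (hX : IsFairTwoCategory X) (k : ℕ)
    (h : IsSpine (res X ((ord k).dot 0)) (fun j => res X (edge k j)) (res X (arrow.dot 0))
      (res X (arrow.dot 1))) :
    IsSpine (res X ((concat (ord k) arrow).dot 0))
      (fun j => res X (edge (k + 1) j ≫ ordSucc k)) (res X (arrow.dot 0))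
      (res X (arrow.dot 1)) := by
  have hd := hX.discrete
  have hP := isDiscretePullback_of_isFairTwoCategory hX (ord k) arrow
  have e₁ : ∀ j, res X (edge (k + 1) j.castSucc ≫ ordSucc k) =
      res X (inl (ord k) arrow) ⋙ res X (edge k j) := fun j =>
    (congrArg (res X) (edge_castSucc_ordSucc k j)).trans (res_comp X _ _)
  have e₀ : res X ((concat (ord k) arrow).dot 0) =
      res X (inl (ord k) arrow) ⋙ res X ((ord k).dot 0) :=
    res_comp X ((ord k).dot 0) (inl (ord k) arrow)
  constructor
  · intro x y hxy
    have hxy' : (res X ((ord k).dot 0)).obj ((res X (inl (ord k) arrow)).obj x) =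
        (res X ((ord k).dot 0)).obj ((res X (inl (ord k) arrow)).obj y) :=
      (Functor.congr_obj e₀ x).symm.trans (hxy.trans (Functor.congr_obj e₀ y))
    constructor
    · intro f g hfg
      have hfg' := congrFun hfg
      refine (hP.hom _ _).unique ⟨rfl, rfl⟩ ⟨h.hom_ext hxy' fun j => ?_, (hfg' (Fin.last k)).symm⟩
      exact ((map_eq_map_iff_of_functor_eq (e₁ j) f g).1 (hfg' j.castSucc)).symm
    · intro w
      choose w' hw' using fun j => exists_map_eq_iff_of_functor_eq (e₁ j) (w j.castSucc)
      obtain ⟨f₁, hf₁⟩ := (h.bijective _ _ hxy').2 w'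
      obtain ⟨f, ⟨hf, hf'⟩, -⟩ := hP.hom f₁ (w (Fin.last k))
      refine ⟨f, funext fun j => ?_⟩
      induction j using Fin.lastCases with
      | last => exact hf'
      | cast j =>
        exact (hw' j f).2 ((congrArg (res X (edge k j)).map hf).trans (congrFun hf₁ j))
  · intro a l h₀ h₁
    obtain ⟨x₁, hx₁, κ⟩ := h.exists_filler a (fun j => l j.castSucc)
      (fun j hj => h₀ _ hj) (fun i j hij => h₁ _ _ hij)
    have hl : (res X ((ord k).dot (Fin.last k))).obj x₁ =
        (res X (arrow.dot 0)).obj (l (Fin.last k)) := by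
      cases k with
      | zero => exact hx₁.trans (h₀ _ rfl).symm
      | succ k =>
        obtain ⟨κ⟩ := κ (Fin.last k)
        exact (res_comp_obj X (arrow.dot 1) (edge (k + 1) (Fin.last k)) x₁).trans
          ((hd.eq_of_hom ((res X (arrow.dot 1)).map κ.hom)).trans (h₁ _ _ rfl))
    obtain ⟨x, ⟨hx, hx'⟩, -⟩ := hP.obj x₁ (l (Fin.last k)) hl
    refine ⟨x, (Functor.congr_obj e₀ x).trans
      ((congrArg (res X ((ord k).dot 0)).obj hx).trans hx₁), fun j => ?_⟩
    induction j using Fin.lastCases with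
    | last => exact ⟨eqToIso hx'⟩
    | cast j =>
      exact (κ j).map fun κ => eqToIso ((Functor.congr_obj (e₁ j) x).trans
        (congrArg (res X (edge k j)).obj hx)) ≪≫ κ

/-- Fair 2-categories are weak 2-categories. -/
lemma isWeakTwoCategory_of_isFairTwoCategory (hX : IsFairTwoCategory X) : IsWeakTwoCategory X where
  colours := hX.colours
  discrete := hX.discrete
  spine k := by
    have hd := hX.discrete
    induction k with
    | zero =>
      have e : res X ((ord 0).dot 0) = 𝟭 (X.obj (op pt)) :=
        (congrArg (res X) (hom_ext fun i => (Subsingleton.elim (α := Fin 1) _ _) :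
          pt.dot 0 = 𝟙 pt)).trans (res_id X pt)
      refine ⟨fun x y hxy => ⟨fun f g _ => (hd.subsingleton x y).elim f g, fun w => ?_⟩,
        fun a l _ _ => ⟨a, Functor.congr_obj e a, fun j => j.elim0⟩⟩
      have hxy' : x = y :=
        (Functor.congr_obj e x).symm.trans (hxy.trans (Functor.congr_obj e y))
      exact ⟨eqToHom hxy', funext fun j => j.elim0⟩
    | succ k ih =>
      have := hX.colours _ (vertical_of_iso _ _ (inv_comp_ordSucc k) (ordSucc_comp_inv k))
      exact (spine_concat_of_isFairTwoCategory hX k ih).of_isEquivalence (res X (ordSuccInv k))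
        (𝟭 _) (𝟭 _) (res_comp X _ _).symm (fun j => (res_comp X _ _).symm) rfl rfl

lemma isWeakTwoCategory_presentedCells (X : WeakTwoCat.{u}) :
    IsWeakTwoCategory (presentedCells.obj X) :=
  X.property.of_levelwise (presentedToSelf.app X) (fun m => isEquivalence_presentedToSelf X m)
    (isDiscrete_presentedCells X)

/-- The presented cells of a fair 2-category form a fair 2-category. Two presented cells with a
common vertex are glued by gluing the pastings, the cells and the isomorphisms between them
separately. -/
lemma isFairTwoCategory_presentedCells (X : WeakTwoCat.{u}) (hX : IsFairTwoCategory X.obj) :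
    IsFairTwoCategory (presentedCells.obj X) where
  colours f hf := (isWeakTwoCategory_presentedCells X).colours f hf
  discrete := isDiscrete_presentedCells X
  segal m n := by
    have hP := isDiscretePullback_of_isFairTwoCategory hX m n
    refine (isPullback_iff_isDiscretePullback (isDiscrete_presentedCells X)
      (concat_condition _ m n)).2 ⟨fun a b hab => ?_, fun {a a'} h k => ?_⟩
    · let θ : ((op (concat m n), X) : Idx.{u}) ⟶ (op m, X) := ((inl m n).op, 𝟙 X)
      let θ' : ((op (concat m n), X) : Idx.{u}) ⟶ (op n, X) := ((inr m n).op, 𝟙 X)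
      obtain ⟨ρ, ⟨hρ, hρ'⟩, hρu⟩ := existsUnique_pasting X a.τ b.τ
        (congrArg PseudoFamily.Presented.τ hab)
      obtain ⟨z, ⟨hz, hz'⟩, hzu⟩ := hP.obj a.x b.x (congrArg PseudoFamily.Presented.x hab)
      let h₁ := (pastedFamily.η θ ρ a.τ hρ) ≪≫ a.ι ≪≫ eqToIso hz.symm
      let h₂ := (pastedFamily.η θ' ρ b.τ hρ') ≪≫ b.ι ≪≫ eqToIso hz'.symm
      obtain ⟨κ, ⟨hκ, hκ'⟩, hu⟩ := hP.existsUnique_iso (a := pastedFamily.e _ ρ) (a' := z) h₁ h₂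
      refine ⟨⟨ρ, z, κ⟩, ⟨pastedFamily.presentedMap_obj_eq θ _ _ hρ hz hκ,
        pastedFamily.presentedMap_obj_eq θ' _ _ hρ' hz' hκ'⟩, ?_⟩
      rintro ⟨ρ', z₂, ι⟩ ⟨hc, hc'⟩
      have e₁ : ρ' = ρ := hρu _ ⟨congrArg PseudoFamily.Presented.τ hc,
        congrArg PseudoFamily.Presented.τ hc'⟩
      have e₂ : z₂ = z := hzu _ ⟨congrArg PseudoFamily.Presented.x hc,
        congrArg PseudoFamily.Presented.x hc'⟩
      subst e₁ e₂
      have e₃ : ι = κ := hu _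
        ⟨pastedFamily.map_ι_of_presentedMap_obj_eq (θ := θ) hc,
          pastedFamily.map_ι_of_presentedMap_obj_eq (θ := θ') hc'⟩
      rw [e₃]
    · obtain ⟨f, ⟨hf, hf'⟩, hfu⟩ := hP.hom (a := a.x) (a' := a'.x) h.hom k.hom
      exact ⟨InducedCategory.homMk f, ⟨InducedCategory.hom_ext hf, InducedCategory.hom_ext hf'⟩,
        fun g hg => InducedCategory.hom_ext (hfu _ ⟨congrArg InducedCategory.Hom.hom hg.1,
          congrArg InducedCategory.Hom.hom hg.2⟩)⟩

end FairWeak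

end FatDelta

/-! ### Tamsamani 2-categories as weak 2-categories -/

section Tamsamani

variable (Z : SimplexCategoryᵒᵖ ⥤ Cat.{u, u})

/-- The Segal condition for `Z_k`, in terms of the spine of the `k`-simplex. -/
def HasSpine (k : ℕ) : Prop :=
  IsSpine (Z.map (SimplexCategory.const ⦋0⦌ ⦋k⦌ 0).op).toFunctor
    (fun j => (Z.map (SimplexCategory.mkOfSucc j).op).toFunctor)
    (Z.map (SimplexCategory.δ (n := 0) 1).op).toFunctor
    (Z.map (SimplexCategory.δ (n := 0) 0).op).toFunctor

variable {Z}

lemma source_mkOfSucc {k : ℕ} (x : Z.obj (op ⦋k + 1⦌)) :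
    (Z.map (SimplexCategory.δ (n := 0) 1).op).toFunctor.obj
        ((Z.map (SimplexCategory.mkOfSucc (0 : Fin (k + 1))).op).toFunctor.obj x) =
      (Z.map (SimplexCategory.const ⦋0⦌ ⦋k + 1⦌ 0).op).toFunctor.obj x := by
  have h := congrArg (fun f => (Z.map f.op).toFunctor.obj x)
    (SimplexCategory.δ_one_mkOfSucc (0 : Fin (k + 1)))
  refine Eq.trans ?_ h
  rw [op_comp, Z.map_comp]
  rfl

lemma hasSpine_of_segalMap (hd : IsDiscrete (Z.obj (op ⦋0⦌))) (k : ℕ)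
    (h : (segalMap Z (k + 1)).IsEquivalence) : HasSpine Z (k + 1) where
  bijective x y _ := by
    refine ⟨fun f g hfg => (segalMap Z (k + 1)).map_injective (ObjectProperty.hom_ext _ hfg),
      fun w => ?_⟩
    obtain ⟨f, hf⟩ := (segalMap Z (k + 1)).map_surjective (X := x) (Y := y)
      (ObjectProperty.homMk w)
    exact ⟨f, congrArg (fun z => z.hom) hf⟩
  exists_filler a l h₀ h₁ := by
    let c : ChainCat Z (k + 1) := ⟨l, h₁⟩
    let x := (segalMap Z (k + 1)).objPreimage c
    let ι : (segalMap Z (k + 1)).obj x ≅ c := (segalMap Z (k + 1)).objObjPreimageIso c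
    let κ : ∀ j, (Z.map (SimplexCategory.mkOfSucc j).op).toFunctor.obj x ≅ l j := fun j =>
      ((chainObjects Z (k + 1)).ι ⋙ Pi.eval _ j).mapIso ι
    exact ⟨x, (source_mkOfSucc x).symm.trans ((IsDiscrete.eq_of_hom
      ((Z.map (SimplexCategory.δ (n := 0) 1).op).toFunctor.map (κ 0).hom)).trans (h₀ 0 rfl)),
      fun j => ⟨κ j⟩⟩

lemma segalMap_of_hasSpine (hd : IsDiscrete (Z.obj (op ⦋0⦌))) (k : ℕ)
    (h : HasSpine Z (k + 1)) : (segalMap Z (k + 1)).IsEquivalence := by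
  have hv : ∀ {x y : Z.obj (op ⦋k + 1⦌)} (w : (segalMap Z (k + 1)).obj x ⟶
      (segalMap Z (k + 1)).obj y),
      (Z.map (SimplexCategory.const ⦋0⦌ ⦋k + 1⦌ 0).op).toFunctor.obj x =
        (Z.map (SimplexCategory.const ⦋0⦌ ⦋k + 1⦌ 0).op).toFunctor.obj y := fun {x y} w =>
    (source_mkOfSucc x).symm.trans ((IsDiscrete.eq_of_hom
      ((Z.map (SimplexCategory.δ (n := 0) 1).op).toFunctor.map (w.hom 0))).trans
        (source_mkOfSucc y))
  refine { faithful := ⟨fun {x y} f g hfg => ?_⟩, full := ⟨fun {x y} w => ?_⟩,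
           essSurj := ⟨fun c => ?_⟩ }
  · exact h.hom_ext (hv ((segalMap Z (k + 1)).map f)) fun j => congrArg (fun z => z.hom j) hfg
  · obtain ⟨f, hf⟩ := (h.bijective x y (hv w)).2 w.hom
    exact ⟨f, ObjectProperty.hom_ext _ hf⟩
  · obtain ⟨x, -, hx⟩ := h.exists_filler _ c.obj
      (fun j hj => congrArg (fun j => (Z.map (SimplexCategory.δ (n := 0) 1).op).toFunctor.obj
        (c.obj j)) (Fin.ext hj : j = 0)) c.property
    exact ⟨x, ⟨ObjectProperty.isoMk _ (Pi.isoMk fun j => (hx j).some)⟩⟩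

lemma hasSpine_zero (hd : IsDiscrete (Z.obj (op ⦋0⦌))) : HasSpine Z 0 := by
  have e : (Z.map (SimplexCategory.const ⦋0⦌ ⦋0⦌ 0).op).toFunctor = 𝟭 _ := by
    rw [show SimplexCategory.const ⦋0⦌ ⦋0⦌ 0 = 𝟙 _ from Subsingleton.elim _ _, op_id, Z.map_id]
    rfl
  refine ⟨fun x y hxy => ⟨fun f g _ => Subsingleton.elim f g, fun w => ?_⟩,
    fun a l _ _ => ⟨a, Functor.congr_obj e a, fun j => j.elim0⟩⟩
  exact ⟨eqToHom ((Functor.congr_obj e x).symm.trans (hxy.trans (Functor.congr_obj e y))),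
    funext fun j => j.elim0⟩

lemma hasSpine_one : HasSpine Z 1 := by
  have e : ∀ j : Fin 1, (Z.map (SimplexCategory.mkOfSucc j).op).toFunctor = 𝟭 _ := fun j => by
    rw [show SimplexCategory.mkOfSucc j = 𝟙 _ from ?_, op_id, Z.map_id]
    · rfl
    · ext i
      fin_cases j
      fin_cases i <;> rfl
  refine ⟨fun x y _ => ⟨fun f g hfg => (map_eq_map_iff_of_functor_eq (e 0) f g).1 (congrFun hfg 0),
    fun w => ?_⟩, fun a l h₀ _ => ?_⟩
  · obtain ⟨w', hw'⟩ := exists_map_eq_iff_of_functor_eq (e 0) (w 0)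
    refine ⟨w', funext fun j => ?_⟩
    obtain rfl : j = 0 := Subsingleton.elim _ _
    exact (hw' w').2 rfl
  · refine ⟨l 0, ?_, fun j => ?_⟩
    · refine Eq.trans ?_ (h₀ 0 rfl)
      exact (source_mkOfSucc (k := 0) (l 0)).symm.trans (congrArg _ (Functor.congr_obj (e 0) _))
    · obtain rfl : j = 0 := Subsingleton.elim _ _
      exact ⟨eqToIso (Functor.congr_obj (e 0) _)⟩

/-- The conditions for `k = 0` and `k = 1`, which are not part of the definition of a Tamsamani
2-category, hold automatically. -/
lemma isTamsamaniTwoCategory_iff :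
    IsTamsamaniTwoCategory Z ↔ IsDiscrete (Z.obj (op ⦋0⦌)) ∧ ∀ k, HasSpine Z k := by
  constructor
  · rintro ⟨hd, h⟩
    refine ⟨hd, fun k => ?_⟩
    match k with
    | 0 => exact hasSpine_zero hd
    | 1 => exact hasSpine_one
    | k + 2 => exact hasSpine_of_segalMap hd _ (h _ (by omega))
  · rintro ⟨hd, h⟩
    refine ⟨hd, fun k hk => ?_⟩
    obtain ⟨k, rfl⟩ : ∃ l, k = l + 1 := ⟨k - 1, by omega⟩
    exact segalMap_of_hasSpine hd _ (h _)

end Tamsamani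

namespace FatDelta

lemma contract_map_comp_contractOrdIso {k l : ℕ} (f : ord k ⟶ ord l) (α : ⦋k⦌ ⟶ ⦋l⦌)
    (h : ∀ i : Fin (k + 1), (α.toOrderHom i).1 = (f.toFun i).1) :
    contract.map f ≫ (contractOrdIso l).hom = (contractOrdIso k).hom ≫ α := by
  refine contract_hom_ext fun i => Fin.ext ?_
  have h₁ : (contractOrdIso k).hom.toOrderHom ((ord k).proj i) = i :=
    Fin.ext ((contractOrdIso_hom_apply k _).trans (cls_ord k i))
  refine (contractOrdIso_hom_apply l _).trans ?_
  refine (congrArg Fin.val (contract_map_proj f i)).trans ((cls_ord l _).trans ?_)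
  refine (h i).symm.trans ?_
  exact congrArg (fun i => (α.toOrderHom i).1) h₁.symm

lemma contractOrdIso_inv_comp {k l : ℕ} (f : ord k ⟶ ord l) (α : ⦋k⦌ ⟶ ⦋l⦌)
    (h : ∀ i : Fin (k + 1), (α.toOrderHom i).1 = (f.toFun i).1) :
    α ≫ (contractOrdIso l).inv = (contractOrdIso k).inv ≫ contract.map f := by
  rw [Iso.eq_inv_comp, ← Category.assoc, ← contract_map_comp_contractOrdIso f α h, Category.assoc,
    Iso.hom_inv_id, Category.comp_id]

variable (Z : SimplexCategoryᵒᵖ ⥤ Cat.{u, u})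

/-- The restriction of `Z` to the fat delta, over an ordinal without links. -/
noncomputable def contractOrdObjIso (k : ℕ) : Z.obj (op ⦋k⦌) ≅ (contract.op ⋙ Z).obj (op (ord k)) :=
  Z.mapIso (contractOrdIso k).op

instance (k : ℕ) : (contractOrdObjIso Z k).hom.toFunctor.IsEquivalence :=
  (Cat.equivOfIso (contractOrdObjIso Z k)).isEquivalence_functor

instance (k : ℕ) : (contractOrdObjIso Z k).inv.toFunctor.IsEquivalence :=
  (Cat.equivOfIso (contractOrdObjIso Z k)).isEquivalence_inverse

lemma contractOrdObjIso_hom_comp {k l : ℕ} (f : ord k ⟶ ord l) (α : ⦋k⦌ ⟶ ⦋l⦌)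
    (h : ∀ i : Fin (k + 1), (α.toOrderHom i).1 = (f.toFun i).1) :
    (contractOrdObjIso Z l).hom.toFunctor ⋙ res (contract.op ⋙ Z) f =
      (Z.map α.op).toFunctor ⋙ (contractOrdObjIso Z k).hom.toFunctor := by
  have := congrArg (fun g => (Z.map g.op).toFunctor) (contract_map_comp_contractOrdIso f α h)
  simp only [op_comp, Z.map_comp] at this
  exact this

lemma contractOrdObjIso_inv_comp {k l : ℕ} (f : ord k ⟶ ord l) (α : ⦋k⦌ ⟶ ⦋l⦌)
    (h : ∀ i : Fin (k + 1), (α.toOrderHom i).1 = (f.toFun i).1) :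
    (contractOrdObjIso Z l).inv.toFunctor ⋙ (Z.map α.op).toFunctor =
      res (contract.op ⋙ Z) f ⋙ (contractOrdObjIso Z k).inv.toFunctor := by
  have := congrArg (fun g => (Z.map g.op).toFunctor) (contractOrdIso_inv_comp f α h)
  simp only [op_comp, Z.map_comp] at this
  exact this

lemma isDiscrete_of_iso {C D : Cat.{u, u}} (e : C ≅ D) (hD : IsDiscrete D) : IsDiscrete C where
  subsingleton _ _ := ⟨fun _ _ => (Cat.equivOfIso e).functor.map_injective
    ((hD.subsingleton _ _).elim _ _)⟩
  eq_of_hom f := ((Cat.isIso_iff e.hom).1 inferInstance).1.1 (hD.eq_of_hom (e.hom.toFunctor.map f))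

lemma isWeakTwoCategory_contract_iff :
    IsWeakTwoCategory (contract.op ⋙ Z) ↔ IsTamsamaniTwoCategory Z := by
  rw [isTamsamaniTwoCategory_iff]
  have h₀ : ∀ k (i : Fin 1), ((SimplexCategory.const ⦋0⦌ ⦋k⦌ 0).toOrderHom i).1 =
      (((ord k).dot 0).toFun i).1 := fun _ _ => rfl
  have h₁ : ∀ k (j : Fin k) (i : Fin 2), ((SimplexCategory.mkOfSucc j).toOrderHom i).1 =
      ((edge k j).toFun i).1 := fun k j i => by
    fin_cases i <;> rfl
  have h₂ : ∀ i : Fin 1, ((SimplexCategory.δ (n := 0) 1).toOrderHom i).1 =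
      ((arrow.dot 0).toFun i).1 := fun i => by
    fin_cases i; rfl
  have h₃ : ∀ i : Fin 1, ((SimplexCategory.δ (n := 0) 0).toOrderHom i).1 =
      ((arrow.dot 1).toFun i).1 := fun i => by
    fin_cases i; rfl
  let F₁ : Z.obj (op ⦋1⦌) ⥤ (contract.op ⋙ Z).obj (op arrow) :=
    (contractOrdObjIso Z 1).hom.toFunctor
  let F₀ : Z.obj (op ⦋0⦌) ⥤ (contract.op ⋙ Z).obj (op pt) := (contractOrdObjIso Z 0).hom.toFunctor
  let G₁ : (contract.op ⋙ Z).obj (op arrow) ⥤ Z.obj (op ⦋1⦌) :=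
    (contractOrdObjIso Z 1).inv.toFunctor
  let G₀ : (contract.op ⋙ Z).obj (op pt) ⥤ Z.obj (op ⦋0⦌) := (contractOrdObjIso Z 0).inv.toFunctor
  have i₁ : F₁.IsEquivalence := inferInstanceAs (contractOrdObjIso Z 1).hom.toFunctor.IsEquivalence
  have i₀ : F₀.IsEquivalence := inferInstanceAs (contractOrdObjIso Z 0).hom.toFunctor.IsEquivalence
  have j₁ : G₁.IsEquivalence := inferInstanceAs (contractOrdObjIso Z 1).inv.toFunctor.IsEquivalence
  have j₀ : G₀.IsEquivalence := inferInstanceAs (contractOrdObjIso Z 0).inv.toFunctor.IsEquivalence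
  constructor
  · intro h
    have hd := h.discrete
    have hd' : IsDiscrete (Z.obj (op ⦋0⦌)) := isDiscrete_of_iso (contractOrdObjIso Z 0) hd
    exact ⟨hd', fun k => (h.spine k).of_isEquivalence (contractOrdObjIso Z k).hom.toFunctor
      F₁ F₀
      (contractOrdObjIso_hom_comp Z _ _ (h₀ k)) (fun j => contractOrdObjIso_hom_comp Z _ _ (h₁ k j))
      (contractOrdObjIso_hom_comp Z _ _ h₂) (contractOrdObjIso_hom_comp Z _ _ h₃)⟩
  · rintro ⟨hd, h⟩
    have hd' : IsDiscrete ((contract.op ⋙ Z).obj (op pt)) :=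
      isDiscrete_of_iso (contractOrdObjIso Z 0).symm hd
    refine ⟨fun f hf => ?_, hd', fun k => (h k).of_isEquivalence
      (contractOrdObjIso Z k).inv.toFunctor G₁ G₀
      (contractOrdObjIso_inv_comp Z _ _ (h₀ k)) (fun j => contractOrdObjIso_inv_comp Z _ _ (h₁ k j))
      (contractOrdObjIso_inv_comp Z _ _ h₂) (contractOrdObjIso_inv_comp Z _ _ h₃)⟩
    have := (isIso_contract_map_iff f).2 hf
    exact (Cat.equivOfIso (asIso (Z.map (contract.map f).op))).isEquivalence_functor

end FatDelta

/-! ### Local equivalences -/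

section LocalEquivalence

variable {Q P Q' P' Q'' P'' : Type u} [Category.{u} Q] [Category.{u} P] [Category.{u} Q']
  [Category.{u} P'] [Category.{u} Q''] [Category.{u} P'']

/-- A functor `F` between categories of 1-cells (over the functor `H` between the discrete
categories of objects) that induces equivalences between the hom-categories. -/
structure IsLocalEquivalence (F : Q ⥤ Q') (H : P ⥤ P') (s t : Q ⥤ P) (s' t' : Q' ⥤ P') :
    Prop where
  bijective : ∀ x y : Q, s.obj x = s.obj y → t.obj x = t.obj y →
    Function.Bijective (F.map (X := x) (Y := y))
  exists_iso : ∀ (a b : P) (y : Q'), s'.obj y = H.obj a → t'.obj y = H.obj b →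
    ∃ x, s.obj x = a ∧ t.obj x = b ∧ Nonempty (F.obj x ≅ y)

variable {F : Q ⥤ Q'} {H : P ⥤ P'} {s t : Q ⥤ P} {s' t' : Q' ⥤ P'} {F' : Q' ⥤ Q''} {H' : P' ⥤ P''}
  {s'' t'' : Q'' ⥤ P''}

lemma obj_injective_of_isEquivalence [IsDiscrete P] (H : P ⥤ P') [H.IsEquivalence] :
    Function.Injective H.obj := fun _ _ h => IsDiscrete.eq_of_hom (H.preimage (eqToHom h))

lemma obj_surjective_of_isEquivalence [IsDiscrete P'] (H : P ⥤ P') [H.IsEquivalence] :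
    Function.Surjective H.obj := fun a =>
  ⟨H.objPreimage a, IsDiscrete.eq_of_hom (H.objObjPreimageIso a).hom⟩

lemma obj_eq_of_iso [IsDiscrete P] (s : Q ⥤ P) {x y : Q} (e : x ≅ y) : s.obj x = s.obj y :=
  IsDiscrete.eq_of_hom (s.map e.hom)

lemma IsLocalEquivalence.of_isEquivalence [IsDiscrete P] [IsDiscrete P'] [F.IsEquivalence]
    [H.IsEquivalence] (hs : F ⋙ s' = s ⋙ H) (ht : F ⋙ t' = t ⋙ H) :
    IsLocalEquivalence F H s t s' t' where
  bijective _ _ _ _ := ⟨F.map_injective, F.map_surjective⟩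
  exists_iso a b y ha hb := by
    have e := F.objObjPreimageIso y
    exact ⟨F.objPreimage y, obj_injective_of_isEquivalence H
      ((Functor.congr_obj hs _).symm.trans ((obj_eq_of_iso s' e).trans ha)),
      obj_injective_of_isEquivalence H
        ((Functor.congr_obj ht _).symm.trans ((obj_eq_of_iso t' e).trans hb)), ⟨e⟩⟩

lemma IsLocalEquivalence.comp (h : IsLocalEquivalence F H s t s' t')
    (h' : IsLocalEquivalence F' H' s' t' s'' t'') (hs : F ⋙ s' = s ⋙ H) (ht : F ⋙ t' = t ⋙ H) :
    IsLocalEquivalence (F ⋙ F') (H ⋙ H') s t s'' t'' where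
  bijective x y h₁ h₂ := (h'.bijective _ _
    ((Functor.congr_obj hs x).trans ((congrArg H.obj h₁).trans (Functor.congr_obj hs y).symm))
    ((Functor.congr_obj ht x).trans ((congrArg H.obj h₂).trans (Functor.congr_obj ht y).symm))).comp
      (h.bijective x y h₁ h₂)
  exists_iso a b z ha hb := by
    obtain ⟨y, hy₁, hy₂, ⟨e⟩⟩ := h'.exists_iso _ _ z ha hb
    obtain ⟨x, hx₁, hx₂, ⟨e'⟩⟩ := h.exists_iso _ _ y hy₁ hy₂
    exact ⟨x, hx₁, hx₂, ⟨F'.mapIso e' ≪≫ e⟩⟩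

lemma IsLocalEquivalence.of_comp_right [F'.IsEquivalence]
    (h : IsLocalEquivalence (F ⋙ F') (H ⋙ H') s t s'' t'') (hs : F' ⋙ s'' = s' ⋙ H')
    (ht : F' ⋙ t'' = t' ⋙ H') : IsLocalEquivalence F H s t s' t' where
  bijective x y h₁ h₂ := (Function.Bijective.of_comp_iff'
    ⟨F'.map_injective, F'.map_surjective⟩ _).1 (h.bijective x y h₁ h₂)
  exists_iso a b y ha hb := by
    obtain ⟨x, hx₁, hx₂, ⟨e⟩⟩ := h.exists_iso a b (F'.obj y)
      ((Functor.congr_obj hs y).trans (congrArg H'.obj ha))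
      ((Functor.congr_obj ht y).trans (congrArg H'.obj hb))
    exact ⟨x, hx₁, hx₂, ⟨F'.preimageIso e⟩⟩

lemma bijective_map_of_iso (F : Q ⥤ Q') {x y x' y' : Q} (e : x ≅ x') (e' : y ≅ y')
    (h : Function.Bijective (F.map (X := x) (Y := y))) :
    Function.Bijective (F.map (X := x') (Y := y')) := by
  have h₁ : (F.map (X := x') (Y := y')) = ((F.mapIso e).homCongr (F.mapIso e')) ∘
      (F.map (X := x) (Y := y)) ∘ (e.homCongr e').symm := by
    ext f
    change F.map f = F.map e.inv ≫ F.map (e.hom ≫ f ≫ e'.inv) ≫ F.map e'.hom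
    rw [← F.map_comp, ← F.map_comp]
    simp only [Category.assoc, Iso.inv_hom_id, Category.comp_id, Iso.inv_hom_id_assoc]
  rw [h₁]
  exact ((Iso.homCongr _ _).bijective.comp h).comp (Equiv.bijective _)

lemma IsLocalEquivalence.of_comp_left [F.IsEquivalence] [H.IsEquivalence] [IsDiscrete P]
    [IsDiscrete P'] (h : IsLocalEquivalence (F ⋙ F') (H ⋙ H') s t s'' t'') (hs : F ⋙ s' = s ⋙ H)
    (ht : F ⋙ t' = t ⋙ H) : IsLocalEquivalence F' H' s' t' s'' t'' where
  bijective x y h₁ h₂ := by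
    have e := F.objObjPreimageIso x
    have e' := F.objObjPreimageIso y
    refine bijective_map_of_iso F' e e' ?_
    have h₃ := h.bijective (F.objPreimage x) (F.objPreimage y)
      (obj_injective_of_isEquivalence H ((Functor.congr_obj hs _).symm.trans
        ((obj_eq_of_iso s' e).trans (h₁.trans ((obj_eq_of_iso s' e').symm.trans
          (Functor.congr_obj hs _))))))
      (obj_injective_of_isEquivalence H ((Functor.congr_obj ht _).symm.trans
        ((obj_eq_of_iso t' e).trans (h₂.trans ((obj_eq_of_iso t' e').symm.trans
          (Functor.congr_obj ht _))))))
    exact (Function.Bijective.of_comp_iff _ ⟨F.map_injective, F.map_surjective⟩).1 h₃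
  exists_iso a b z ha hb := by
    obtain ⟨a, rfl⟩ := obj_surjective_of_isEquivalence H a
    obtain ⟨b, rfl⟩ := obj_surjective_of_isEquivalence H b
    obtain ⟨x, rfl, rfl, e⟩ := h.exists_iso a b z ha hb
    exact ⟨F.obj x, Functor.congr_obj hs x, Functor.congr_obj ht x, e⟩

end LocalEquivalence

section LocalEquivalenceDiagrams

variable {J : Type} [Category.{0} J] {X Y : Jᵒᵖ ⥤ Cat.{u, u}} (f : X ⟶ Y) {o e : J} (s t : o ⟶ e)

lemma isEquivalence_homCatMap_iff :
    (∀ a b, (homCatMap f s t a b).IsEquivalence) ↔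
      IsLocalEquivalence (f.app (op e)).toFunctor (f.app (op o)).toFunctor (X.map s.op).toFunctor
        (X.map t.op).toFunctor (Y.map s.op).toFunctor (Y.map t.op).toFunctor := by
  constructor
  · intro h
    refine ⟨fun x y h₁ h₂ => ?_, fun a b y ha hb => ?_⟩
    · have := h ((X.map s.op).toFunctor.obj y) ((X.map t.op).toFunctor.obj y)
      let x' : HomCat X s t _ _ := ⟨x, h₁, h₂⟩
      let y' : HomCat X s t _ _ := ⟨y, rfl, rfl⟩
      refine ⟨fun g g' hg => ?_, fun g => ?_⟩
      · have := (homCatMap f s t _ _).map_injective (X := x') (Y := y')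
          (a₁ := ObjectProperty.homMk g) (a₂ := ObjectProperty.homMk g')
          (ObjectProperty.hom_ext _ hg)
        exact congrArg (fun g => g.hom) this
      · obtain ⟨g', hg'⟩ := (homCatMap f s t _ _).map_surjective (X := x') (Y := y')
          (ObjectProperty.homMk g)
        exact ⟨g'.hom, congrArg (fun g => g.hom) hg'⟩
    · have := h a b
      let y' : HomCat Y s t _ _ := ⟨y, ha, hb⟩
      let x := (homCatMap f s t a b).objPreimage y'
      exact ⟨x.obj, x.property.1, x.property.2,
        ⟨(ObjectProperty.ι _).mapIso ((homCatMap f s t a b).objObjPreimageIso y')⟩⟩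
  · intro h a b
    have hb := fun x y : HomCat X s t a b => h.bijective x.obj y.obj
      (x.property.1.trans y.property.1.symm) (x.property.2.trans y.property.2.symm)
    refine { faithful := ⟨fun {x y} g g' hg => ?_⟩, full := ⟨fun {x y} g => ?_⟩,
             essSurj := ⟨fun y => ?_⟩ }
    · exact ObjectProperty.hom_ext _ ((hb x y).1 (congrArg (fun g => g.hom) hg))
    · obtain ⟨g', hg'⟩ := (hb x y).2 g.hom
      exact ⟨ObjectProperty.homMk g', ObjectProperty.hom_ext _ hg'⟩
    · obtain ⟨x, h₁, h₂, ⟨κ⟩⟩ := h.exists_iso a b y.obj y.property.1 y.property.2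
      exact ⟨⟨x, h₁, h₂⟩, ⟨ObjectProperty.isoMk _ κ⟩⟩

end LocalEquivalenceDiagrams

/-! ### Invariance of 2-equivalences -/

namespace FatDelta

variable {X Y X' Y' : FatDeltaᵒᵖ ⥤ Cat.{u, u}}

lemma isIso_fairTruncation_map (α : X ⟶ Y) (hα : ∀ m, (α.app m).toFunctor.IsEquivalence) :
    IsIso (fairTruncation.map α) := by
  have : ∀ n, IsIso ((fairTruncation.map α).app n) := fun n => by
    have := hα (ofSemiSimplex.op.obj n)
    rw [isIso_iff_bijective]
    exact isomorphismClasses_map_bijective (α.app (ofSemiSimplex.op.obj n))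
  exact NatIso.isIso_of_isIso_app _

/-- The 2-equivalences are invariant under levelwise equivalences. -/
lemma isFairTwoEquivalence_iff_of_square (α : X' ⟶ X) (β : Y' ⟶ Y) (f : X ⟶ Y) (f' : X' ⟶ Y')
    (w : α ≫ f = f' ≫ β) (hα : ∀ m, (α.app m).toFunctor.IsEquivalence)
    (hβ : ∀ m, (β.app m).toFunctor.IsEquivalence) (hX : IsDiscrete (X.obj (op pt)))
    (hX' : IsDiscrete (X'.obj (op pt))) (hY : IsDiscrete (Y.obj (op pt)))
    (hY' : IsDiscrete (Y'.obj (op pt))) :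
    IsFairTwoEquivalence f ↔ IsFairTwoEquivalence f' := by
  have hα₀ := hα (op pt)
  have hα₁ := hα (op arrow)
  have hβ₀ := hβ (op pt)
  have hβ₁ := hβ (op arrow)
  have w' : ∀ m, (α.app m).toFunctor ⋙ (f.app m).toFunctor =
      (f'.app m).toFunctor ⋙ (β.app m).toFunctor := fun m =>
    congrArg (fun g : X' ⟶ Y => (g.app m).toFunctor) w
  have hom : (∀ a b, (homCatMap f (arrow.dot 0) (arrow.dot 1) a b).IsEquivalence) ↔
      ∀ a b, (homCatMap f' (arrow.dot 0) (arrow.dot 1) a b).IsEquivalence := by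
    rw [isEquivalence_homCatMap_iff, isEquivalence_homCatMap_iff]
    have eα := IsLocalEquivalence.of_isEquivalence (app_naturality α (arrow.dot 0))
      (app_naturality α (arrow.dot 1))
    have eβ := IsLocalEquivalence.of_isEquivalence (app_naturality β (arrow.dot 0))
      (app_naturality β (arrow.dot 1))
    constructor
    · intro h
      have h₁ := eα.comp h (app_naturality α (arrow.dot 0)) (app_naturality α (arrow.dot 1))
      rw [w', w'] at h₁
      exact h₁.of_comp_right (app_naturality β (arrow.dot 0)) (app_naturality β (arrow.dot 1))
    · intro h
      have h₁ := h.comp eβ (app_naturality f' (arrow.dot 0)) (app_naturality f' (arrow.dot 1))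
      rw [← w', ← w'] at h₁
      exact h₁.of_comp_left (app_naturality α (arrow.dot 0)) (app_naturality α (arrow.dot 1))
  have i₁ := isIso_fairTruncation_map α hα
  have i₂ := isIso_fairTruncation_map β hβ
  let κ : Arrow.mk (fairTruncation.map f') ≅ Arrow.mk (fairTruncation.map f) :=
    Arrow.isoMk (asIso (fairTruncation.map α)) (asIso (fairTruncation.map β)) (by
      change fairTruncation.map α ≫ fairTruncation.map f =
        fairTruncation.map f' ≫ fairTruncation.map β
      rw [← Functor.map_comp, ← Functor.map_comp, w])
  constructor
  · rintro ⟨h, C, D, F, hF, ⟨e⟩⟩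
    exact ⟨hom.1 h, C, D, F, hF, ⟨κ ≪≫ e⟩⟩
  · rintro ⟨h, C, D, F, hF, ⟨e⟩⟩
    exact ⟨hom.2 h, C, D, F, hF, ⟨κ.symm ≪≫ e⟩⟩

/-- A levelwise equivalence is a 2-equivalence, provided that the truncation is the nerve of a
category. -/
lemma isFairTwoEquivalence_of_levelwise (α : X ⟶ Y) (hα : ∀ m, (α.app m).toFunctor.IsEquivalence)
    (hX : IsDiscrete (X.obj (op pt))) (hY : IsDiscrete (Y.obj (op pt)))
    (h : ∃ C : Cat.{u, u}, Nonempty (fairTruncation.obj Y ≅ semiNerve.obj C)) :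
    IsFairTwoEquivalence α where
  hom := (isEquivalence_homCatMap_iff _ _ _).2
    (haveI := hα (op pt)
    haveI := hα (op arrow)
    IsLocalEquivalence.of_isEquivalence (app_naturality α (arrow.dot 0))
      (app_naturality α (arrow.dot 1)))
  truncation := by
    have := isIso_fairTruncation_map α hα
    obtain ⟨C, ⟨e⟩⟩ := h
    refine ⟨C, C, 𝟙 C, inferInstanceAs (𝟭 C).IsEquivalence,
      ⟨Arrow.isoMk (asIso (fairTruncation.map α) ≪≫ e) e ?_⟩⟩
    change (fairTruncation.map α ≫ e.hom) ≫ semiNerve.map (𝟙 C) = fairTruncation.map α ≫ e.hom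
    rw [semiNerve.map_id, Category.comp_id]

end FatDelta

/-! ### Simplicial sets that satisfy the strict Segal condition -/

section Segal

/-- The strict Segal condition for a simplicial set, in terms of the first vertex and of the edges
of the spine. -/
structure IsSegalSet (T : SSet.{u}) : Prop where
  ext : ∀ {n : ℕ} {x y : T.obj (op ⦋n⦌)}, T.map (SimplexCategory.const ⦋0⦌ ⦋n⦌ 0).op x =
    T.map (SimplexCategory.const ⦋0⦌ ⦋n⦌ 0).op y →
    (∀ j : Fin n, T.map (SimplexCategory.mkOfSucc j).op x =
      T.map (SimplexCategory.mkOfSucc j).op y) → x = y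
  exists_filler : ∀ {n : ℕ} (a : T.obj (op ⦋0⦌)) (l : Fin n → T.obj (op ⦋1⦌)),
    (∀ j, j.1 = 0 → T.map (SimplexCategory.const ⦋0⦌ ⦋1⦌ 0).op (l j) = a) →
    (∀ i j, i.1 + 1 = j.1 → T.map (SimplexCategory.const ⦋0⦌ ⦋1⦌ 1).op (l i) =
      T.map (SimplexCategory.const ⦋0⦌ ⦋1⦌ 0).op (l j)) →
    ∃ x : T.obj (op ⦋n⦌), T.map (SimplexCategory.const ⦋0⦌ ⦋n⦌ 0).op x = a ∧
      ∀ j, T.map (SimplexCategory.mkOfSucc j).op x = l j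

variable {T : SSet.{u}}

lemma map_map_eq {a b c : SimplexCategory} (f : a ⟶ b) (g : b ⟶ c) (h : a ⟶ c) (e : f ≫ g = h)
    (x : T.obj (op c)) : T.map f.op (T.map g.op x) = T.map h.op x := by
  subst e
  exact (T.map_comp_apply g.op f.op x).symm

namespace IsSegalSet

/-- The category whose nerve is a simplicial set with the strict Segal condition: its objects are
the vertices. -/
structure Obj (_ : IsSegalSet T) : Type u where
  pt : T.obj (op ⦋0⦌)

variable (hT : IsSegalSet T)

/-- The morphisms are the edges with given end points. -/
def Hom (a b : hT.Obj) : Type u :=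
  {f : T.obj (op ⦋1⦌) // T.map (SimplexCategory.const ⦋0⦌ ⦋1⦌ 0).op f = a.pt ∧
    T.map (SimplexCategory.const ⦋0⦌ ⦋1⦌ 1).op f = b.pt}

lemma exists_triangle (hT : IsSegalSet T) (f g : T.obj (op ⦋1⦌))
    (h : T.map (SimplexCategory.const ⦋0⦌ ⦋1⦌ 1).op f =
      T.map (SimplexCategory.const ⦋0⦌ ⦋1⦌ 0).op g) :
    ∃ x : T.obj (op ⦋2⦌), T.map (SimplexCategory.mkOfSucc 0).op x = f ∧
      T.map (SimplexCategory.mkOfSucc 1).op x = g := by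
  obtain ⟨x, -, hx⟩ := hT.exists_filler (T.map (SimplexCategory.const ⦋0⦌ ⦋1⦌ 0).op f) ![f, g]
    (fun j hj => by obtain rfl : j = 0 := Fin.ext hj; rfl) (fun i j hij => by
      obtain rfl : i = 0 := Fin.ext (by change i.1 = 0; omega)
      obtain rfl : j = 1 := Fin.ext hij.symm
      exact h)
  exact ⟨x, hx 0, hx 1⟩

/-- A triangle is determined by its first two edges. -/
lemma triangle_ext (hT : IsSegalSet T) {x y : T.obj (op ⦋2⦌)}
    (h₀ : T.map (SimplexCategory.mkOfSucc 0).op x = T.map (SimplexCategory.mkOfSucc 0).op y)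
    (h₁ : T.map (SimplexCategory.mkOfSucc 1).op x = T.map (SimplexCategory.mkOfSucc 1).op y) :
    x = y := by
  have e : SimplexCategory.const ⦋0⦌ ⦋1⦌ 0 ≫ SimplexCategory.mkOfSucc (0 : Fin 2) =
      SimplexCategory.const ⦋0⦌ ⦋2⦌ 0 := rfl
  refine hT.ext ?_ fun j => ?_
  · rw [← map_map_eq _ _ _ e, ← map_map_eq _ _ _ e, h₀]
  · fin_cases j
    · exact h₀
    · exact h₁

variable {hT}

/-- The composition of edges. -/
noncomputable def Hom.comp {a b c : hT.Obj} (f : hT.Hom a b) (g : hT.Hom b c) : hT.Hom a c := by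
  let x := (hT.exists_triangle f.1 g.1 (f.2.2.trans g.2.1.symm)).choose
  have hx := (hT.exists_triangle f.1 g.1 (f.2.2.trans g.2.1.symm)).choose_spec
  refine ⟨T.map (SimplexCategory.mkOfLe (n := 2) 0 2 (by decide)).op x,
    Eq.trans ?_ f.2.1, Eq.trans ?_ g.2.2⟩
  · refine Eq.trans ?_ (congrArg (T.map (SimplexCategory.const ⦋0⦌ ⦋1⦌ 0).op) hx.1)
    exact (map_map_eq _ _ (SimplexCategory.const ⦋0⦌ ⦋2⦌ 0) rfl _).trans
      (map_map_eq _ _ (SimplexCategory.const ⦋0⦌ ⦋2⦌ 0) rfl _).symm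
  · refine Eq.trans ?_ (congrArg (T.map (SimplexCategory.const ⦋0⦌ ⦋1⦌ 1).op) hx.2)
    exact (map_map_eq _ _ (SimplexCategory.const ⦋0⦌ ⦋2⦌ 2) rfl _).trans
      (map_map_eq _ _ (SimplexCategory.const ⦋0⦌ ⦋2⦌ 2) rfl _).symm

/-- Compositions are computed by triangles. -/
lemma Hom.comp_eq {a b c : hT.Obj} (f : hT.Hom a b) (g : hT.Hom b c) (x : T.obj (op ⦋2⦌))
    (h₀ : T.map (SimplexCategory.mkOfSucc 0).op x = f.1)
    (h₁ : T.map (SimplexCategory.mkOfSucc 1).op x = g.1) :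
    (f.comp g).1 = T.map (SimplexCategory.mkOfLe (n := 2) 0 2 (by decide)).op x := by
  have hx := (hT.exists_triangle f.1 g.1 (f.2.2.trans g.2.1.symm)).choose_spec
  exact congrArg _ (hT.triangle_ext (hx.1.trans h₀.symm) (hx.2.trans h₁.symm))

/-- The edges of a simplex are composed along its triangles. -/
lemma Hom.comp_eq_of_simplex {a b c : hT.Obj} (f : hT.Hom a b) (g : hT.Hom b c) {n : ℕ}
    (x : T.obj (op ⦋n⦌)) (i j k : Fin (n + 1)) (h : i ≤ j) (h' : j ≤ k)
    (h₀ : T.map (SimplexCategory.mkOfLe i j h).op x = f.1)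
    (h₁ : T.map (SimplexCategory.mkOfLe j k h').op x = g.1) :
    (f.comp g).1 = T.map (SimplexCategory.mkOfLe i k (h.trans h')).op x := by
  refine (f.comp_eq g (T.map (SimplexCategory.mkOfLeComp i j k h h').op x) ?_ ?_).trans ?_
  · exact (map_map_eq _ _ _ (SimplexCategory.Hom.ext_one_left _ _) x).trans h₀
  · exact (map_map_eq _ _ _ (SimplexCategory.Hom.ext_one_left _ _) x).trans h₁
  · exact map_map_eq _ _ _ (SimplexCategory.Hom.ext_one_left _ _) x

lemma map_mkOfLe_self {n : ℕ} (i : Fin (n + 1)) (x : T.obj (op ⦋n⦌)) :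
    T.map (SimplexCategory.mkOfLe i i le_rfl).op x =
      T.map (SimplexCategory.const ⦋1⦌ ⦋0⦌ 0).op
        (T.map (SimplexCategory.const ⦋0⦌ ⦋n⦌ i).op x) :=
  (map_map_eq _ _ _ (SimplexCategory.Hom.ext_one_left _ _) x).symm

lemma map_mkOfLe_one (x : T.obj (op ⦋1⦌)) :
    T.map (SimplexCategory.mkOfLe (n := 1) 0 1 (by decide)).op x = x := by
  rw [show SimplexCategory.mkOfLe (n := 1) 0 1 (by decide) = 𝟙 _ from
    SimplexCategory.Hom.ext_one_left _ _]
  exact T.map_id_apply _ x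

noncomputable instance : Category.{u} hT.Obj where
  Hom := hT.Hom
  id a := ⟨T.map (SimplexCategory.const ⦋1⦌ ⦋0⦌ 0).op a.pt,
    (map_map_eq _ _ (𝟙 _) (Subsingleton.elim _ _) _).trans (T.map_id_apply _ _),
    (map_map_eq _ _ (𝟙 _) (Subsingleton.elim _ _) _).trans (T.map_id_apply _ _)⟩
  comp f g := f.comp g
  id_comp f := Subtype.ext ((Hom.comp_eq_of_simplex _ _ f.1 0 0 1 le_rfl (by decide)
    ((map_mkOfLe_self _ _).trans (congrArg _ f.2.1)) (map_mkOfLe_one _)).trans (map_mkOfLe_one _))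
  comp_id f := Subtype.ext ((Hom.comp_eq_of_simplex _ _ f.1 0 1 1 (by decide) le_rfl
    (map_mkOfLe_one _) ((map_mkOfLe_self _ _).trans (congrArg _ f.2.2))).trans (map_mkOfLe_one _))
  assoc {a b c d} f g h := by
    obtain ⟨x, -, hx⟩ := hT.exists_filler a.pt ![f.1, g.1, h.1]
      (fun j hj => by obtain rfl : j = 0 := Fin.ext hj; exact f.2.1) (fun i j hij => by
        have hi : i.1 < 2 := by omega
        have hi' : i = 0 ∨ i = 1 := by
          rcases Nat.lt_succ_iff_lt_or_eq.1 hi with h | h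
          · exact Or.inl (Fin.ext (by change i.1 = 0; omega))
          · exact Or.inr (Fin.ext h)
        rcases hi' with rfl | rfl
        · obtain rfl : j = 1 := Fin.ext hij.symm
          exact f.2.2.trans g.2.1.symm
        · obtain rfl : j = 2 := Fin.ext hij.symm
          exact g.2.2.trans h.2.1.symm)
    have e₀ : T.map (SimplexCategory.mkOfLe (n := 3) 0 1 (by decide)).op x = f.1 := hx 0
    have e₁ : T.map (SimplexCategory.mkOfLe (n := 3) 1 2 (by decide)).op x = g.1 := hx 1
    have e₂ : T.map (SimplexCategory.mkOfLe (n := 3) 2 3 (by decide)).op x = h.1 := hx 2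
    refine Subtype.ext ?_
    have h₁ := Hom.comp_eq_of_simplex (f.comp g) h x 0 2 3 (by decide) (by decide)
      (Hom.comp_eq_of_simplex f g x 0 1 2 (by decide) (by decide) e₀ e₁).symm e₂
    have h₂ := Hom.comp_eq_of_simplex f (g.comp h) x 0 1 3 (by decide) (by decide) e₀
      (Hom.comp_eq_of_simplex g h x 1 2 3 (by decide) (by decide) e₁ e₂).symm
    exact h₁.trans h₂.symm

variable (hT)

/-- The composable sequence of edges of a simplex. -/
@[reducible]
noncomputable def edges {n : ℕ} (x : T.obj (op ⦋n⦌)) : ComposableArrows hT.Obj n where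
  obj i := ⟨T.map (SimplexCategory.const ⦋0⦌ ⦋n⦌ i).op x⟩
  map {i j} f := ⟨T.map (SimplexCategory.mkOfLe i j f.le).op x, map_map_eq _ _ _ rfl _,
    map_map_eq _ _ _ rfl _⟩
  map_id i := Subtype.ext (map_mkOfLe_self i x)
  map_comp {i j k} f g :=
    Subtype.ext (Hom.comp_eq_of_simplex _ _ x i j k f.le g.le rfl rfl).symm

lemma hom_heq {a b a' b' : hT.Obj} (f : a ⟶ b) (g : a' ⟶ b') (h : a = a') (h' : b = b')
    (hfg : f.1 = g.1) : f ≍ g := by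
  subst h h'
  exact heq_of_eq (Subtype.ext hfg)

/-- The comparison with the nerve. -/
noncomputable def toNerve : T ⟶ nerve hT.Obj where
  app n := ↾fun x => hT.edges (n := n.unop.len) x
  naturality n m α := by
    ext x
    have h : ∀ i, (hT.edges (n := m.unop.len) (T.map α x)).obj i =
        (hT.edges (n := n.unop.len) x).obj (α.unop.toOrderHom i) := fun i =>
      congrArg Obj.mk (map_map_eq (T := T) _ α.unop _ rfl x)
    exact CategoryTheory.Functor.hext h fun i j f => hT.hom_heq _ _ (h i) (h j)
      (map_map_eq (T := T) _ α.unop _ (SimplexCategory.Hom.ext_one_left _ _) x)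

lemma bijective_edges (n : ℕ) : Function.Bijective (hT.edges (n := n)) := by
  constructor
  · intro x y h
    refine hT.ext (congrArg (fun F : ComposableArrows hT.Obj n => (F.obj 0).pt) h) fun j => ?_
    exact congrArg (fun F : ComposableArrows hT.Obj n =>
      (F.map (homOfLE (Fin.castSucc_lt_succ (i := j)).le)).1) h
  · intro F
    let l : Fin n → T.obj (op ⦋1⦌) := fun j =>
      (F.map (homOfLE (Fin.castSucc_lt_succ (i := j)).le)).1
    have hl : ∀ j, T.map (SimplexCategory.const ⦋0⦌ ⦋1⦌ 0).op (l j) = (F.obj j.castSucc).pt :=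
      fun j => (F.map (homOfLE (Fin.castSucc_lt_succ (i := j)).le)).2.1
    have hl' : ∀ j, T.map (SimplexCategory.const ⦋0⦌ ⦋1⦌ 1).op (l j) = (F.obj j.succ).pt :=
      fun j => (F.map (homOfLE (Fin.castSucc_lt_succ (i := j)).le)).2.2
    obtain ⟨x, hx, hx'⟩ := hT.exists_filler (F.obj 0).pt l
      (fun j hj => (hl j).trans (congrArg (fun i => (F.obj i).pt) (Fin.ext hj)))
      (fun i j hij => (hl' i).trans
        ((congrArg (fun i => (F.obj i).pt) (Fin.ext hij)).trans (hl j).symm))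
    have h : ∀ i, (hT.edges x).obj i = F.obj i := fun i => by
      refine congrArg Obj.mk (?_ : _ = (F.obj i).pt)
      induction i using Fin.cases with
      | zero => exact hx
      | succ j =>
        refine Eq.trans ?_ (hl' j)
        rw [← hx' j]
        exact (map_map_eq _ _ (SimplexCategory.const ⦋0⦌ ⦋n⦌ j.succ) rfl x).symm
    refine ⟨x, ComposableArrows.ext h fun i hi => ?_⟩
    have key : ∀ {a b a' b' : hT.Obj} (e : a = a') (e' : b' = b) (f : a ⟶ b) (g : a' ⟶ b'),
        f.1 = g.1 → f = eqToHom e ≫ g ≫ eqToHom e' := by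
      rintro a b _ _ rfl rfl f g hfg
      rw [eqToHom_refl, eqToHom_refl, Category.id_comp, Category.comp_id]
      exact Subtype.ext hfg
    exact key _ _ _ _ (hx' ⟨i, hi⟩)

/-- A simplicial set with the strict Segal condition is the nerve of a category. -/
lemma exists_iso_nerve (hT : IsSegalSet T) :
    ∃ C : Cat.{u, u}, Nonempty (T ≅ nerveFunctor.obj C) := by
  have : ∀ n, IsIso (hT.toNerve.app n) := fun n => by
    rw [isIso_iff_bijective]
    exact hT.bijective_edges n.unop.len
  have := NatIso.isIso_of_isIso_app hT.toNerve
  let e : T ≅ nerve hT.Obj := asIso hT.toNerve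
  exact ⟨Cat.of hT.Obj, ⟨e⟩⟩

end IsSegalSet

end Segal

/-! ### Semi-simplicial nerves determine categories -/

section SemiNerve

open ComposableArrows

lemma mk₁_heq {A : Type u} [Category.{u} A] {x y x' y' : A} {f : x ⟶ y} {g : x' ⟶ y'}
    (h : mk₁ f = mk₁ g) : x = x' ∧ y = y' ∧ f ≍ g :=
  ⟨Functor.congr_obj h 0, Functor.congr_obj h 1,
    Functor.hcongr_hom h (homOfLE (show (0 : Fin 2) ≤ 1 by decide))⟩

lemma mk₁_injective {A : Type u} [Category.{u} A] {x y : A} {f g : x ⟶ y}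
    (h : mk₁ f = mk₁ g) : f = g := eq_of_heq (mk₁_heq h).2.2

variable {C D : Cat.{u, u}} (φ : semiNerve.obj C ⟶ semiNerve.obj D)

/-- The map induced on composable sequences by a map of semi-simplicial nerves. -/
def semiApp (n : ℕ) (x : ComposableArrows C n) : ComposableArrows D n := φ.app (op ⦋n⦌ₛ) x

lemma semiApp_map {m n : ℕ} (α : ⦋m⦌ ⟶ ⦋n⦌) [Mono α] (x : ComposableArrows C n) :
    semiApp φ m ((nerve C).map α.op x) = (nerve D).map α.op (semiApp φ n x) := by
  let α' : SemiSimplexCategory.toSimplexCategory.obj ⦋m⦌ₛ ⟶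
    SemiSimplexCategory.toSimplexCategory.obj ⦋n⦌ₛ := α
  have : Mono α' := ‹Mono α›
  let β : ⦋m⦌ₛ ⟶ ⦋n⦌ₛ := SemiSimplexCategory.homOfMono α'
  have hβ : SemiSimplexCategory.toSimplexCategory.map β = α :=
    SemiSimplexCategory.toSimplexCategory_map_homOfMono α'
  have h := ConcreteCategory.congr_hom (φ.naturality β.op) x
  change φ.app _ ((nerve C).map (SemiSimplexCategory.toSimplexCategory.map β).op x) =
    (nerve D).map (SemiSimplexCategory.toSimplexCategory.map β).op (φ.app _ x) at h
  rw [hβ] at h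
  exact h

lemma semiApp_δ {n : ℕ} (i : Fin (n + 2)) (x : ComposableArrows C (n + 1)) :
    semiApp φ n ((nerve C).δ i x) = (nerve D).δ i (semiApp φ (n + 1) x) :=
  semiApp_map φ (SimplexCategory.δ i) x

/-- The map induced on objects by a map of semi-simplicial nerves. -/
def semiObj (x : C) : D := (semiApp φ 0 (mk₀ x)).obj 0

lemma semiApp_mk₀ (x : C) : semiApp φ 0 (mk₀ x) = mk₀ (semiObj φ x) := ext₀ rfl

lemma exists_semiHom {x y : C} (f : x ⟶ y) :
    ∃ g : semiObj φ x ⟶ semiObj φ y, semiApp φ 1 (mk₁ f) = mk₁ g := by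
  obtain ⟨x', y', g, hg⟩ := mk₁_surjective (semiApp φ 1 (mk₁ f))
  have h₁ := semiApp_δ φ 1 (mk₁ f)
  have h₀ := semiApp_δ φ 0 (mk₁ f)
  rw [hg] at h₀ h₁
  have e₁ : (nerve C).δ (1 : Fin 2) (mk₁ f) = mk₀ x := ext₀ rfl
  have e₀ : (nerve C).δ (0 : Fin 2) (mk₁ f) = mk₀ y := ext₀ rfl
  rw [e₁, semiApp_mk₀] at h₁
  rw [e₀, semiApp_mk₀] at h₀
  obtain rfl : semiObj φ x = x' := Functor.congr_obj h₁ 0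
  obtain rfl : semiObj φ y = y' := Functor.congr_obj h₀ 0
  exact ⟨g, hg⟩

/-- The map induced on morphisms by a map of semi-simplicial nerves. -/
noncomputable def semiHom {x y : C} (f : x ⟶ y) : semiObj φ x ⟶ semiObj φ y :=
  (exists_semiHom φ f).choose

lemma semiApp_mk₁ {x y : C} (f : x ⟶ y) : semiApp φ 1 (mk₁ f) = mk₁ (semiHom φ f) :=
  (exists_semiHom φ f).choose_spec

lemma semiHom_comp {x y z : C} (f : x ⟶ y) (g : y ⟶ z) :
    semiHom φ (f ≫ g) = semiHom φ f ≫ semiHom φ g := by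
  obtain ⟨x', y', z', f', g', h⟩ := mk₂_surjective (semiApp φ 2 (mk₂ f g))
  have h₀ := semiApp_δ φ 0 (mk₂ f g)
  have h₁ := semiApp_δ φ 1 (mk₂ f g)
  have h₂ := semiApp_δ φ 2 (mk₂ f g)
  rw [h] at h₀ h₁ h₂
  rw [nerve.δ₀_mk₂_eq, nerve.δ₀_mk₂_eq, semiApp_mk₁] at h₀
  rw [nerve.δ₁_mk₂_eq, nerve.δ₁_mk₂_eq, semiApp_mk₁] at h₁
  rw [nerve.δ₂_mk₂_eq, nerve.δ₂_mk₂_eq, semiApp_mk₁] at h₂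
  obtain ⟨rfl, rfl, h₂⟩ := mk₁_heq h₂
  obtain ⟨-, rfl, h₀⟩ := mk₁_heq h₀
  rw [eq_of_heq h₂, eq_of_heq h₀]
  exact mk₁_injective h₁

section Iso

variable (φ : semiNerve.obj C ≅ semiNerve.obj D)

lemma semiApp_bijective (n : ℕ) : Function.Bijective (semiApp φ.hom n) :=
  (isIso_iff_bijective _).1 (inferInstanceAs (IsIso (φ.hom.app (op ⦋n⦌ₛ))))

lemma semiObj_bijective : Function.Bijective (semiObj φ.hom) := by
  refine ⟨fun x y h => ?_, fun y => ?_⟩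
  · have h₁ : semiApp φ.hom 0 (mk₀ x) = semiApp φ.hom 0 (mk₀ y) := by
      rw [semiApp_mk₀, semiApp_mk₀, h]
    exact Functor.congr_obj ((semiApp_bijective φ 0).1 h₁) 0
  · obtain ⟨x, hx⟩ := (semiApp_bijective φ 0).2 (mk₀ y)
    obtain ⟨x, rfl⟩ := mk₀_surjective x
    exact ⟨x, congrArg (fun z : ComposableArrows D 0 => z.obj 0) hx⟩

lemma semiHom_bijective (x y : C) :
    Function.Bijective (semiHom φ.hom : (x ⟶ y) → _) := by
  refine ⟨fun f g h => ?_, fun g => ?_⟩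
  · refine mk₁_injective ((semiApp_bijective φ 1).1 ?_)
    rw [semiApp_mk₁, semiApp_mk₁, h]
  · obtain ⟨f, hf⟩ := (semiApp_bijective φ 1).2 (mk₁ g)
    obtain ⟨x', y', f, rfl⟩ := mk₁_surjective f
    rw [semiApp_mk₁] at hf
    obtain ⟨h₀, h₁, h⟩ := mk₁_heq hf
    obtain rfl := (semiObj_bijective φ).1 h₀
    obtain rfl := (semiObj_bijective φ).1 h₁
    exact ⟨f, eq_of_heq h⟩

/-- An isomorphism of semi-simplicial nerves comes from a functor; it preserves the identities since
these are determined by the composition. -/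
@[reducible]
noncomputable def semiFunctor : C ⥤ D where
  obj := semiObj φ.hom
  map := semiHom φ.hom
  map_id x := by
    obtain ⟨f, hf⟩ := (semiHom_bijective φ x x).2 (𝟙 _)
    rw [← Category.comp_id (semiHom φ.hom (𝟙 x)), ← hf, ← semiHom_comp, Category.id_comp]
  map_comp := semiHom_comp φ.hom

instance : (semiFunctor φ).IsEquivalence where
  faithful := ⟨fun h => (semiHom_bijective φ _ _).1 h⟩
  full := ⟨fun g => (semiHom_bijective φ _ _).2 g⟩
  essSurj := ⟨fun y => by
    obtain ⟨x, rfl⟩ := (semiObj_bijective φ).2 y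
    exact ⟨x, ⟨Iso.refl _⟩⟩⟩

end Iso

lemma semiApp_semiNerve_map (F : C ⟶ D) {x y : C} (f : x ⟶ y) :
    semiApp (semiNerve.map F) 1 (mk₁ f) = mk₁ (F.toFunctor.map f) :=
  nerveMap_app_mk₁ F.toFunctor f

/-- The equivalences of categories can be recognized on semi-simplicial nerves. -/
lemma isEquivalence_of_semiNerve {C' D' : Cat.{u, u}} (F : C ⟶ D) (F' : C' ⟶ D')
    (e : Arrow.mk (semiNerve.map F) ≅ Arrow.mk (semiNerve.map F'))
    (hF : F.toFunctor.IsEquivalence) : F'.toFunctor.IsEquivalence := by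
  let φ : semiNerve.obj C ≅ semiNerve.obj C' := Arrow.leftFunc.mapIso e
  let ψ : semiNerve.obj D ≅ semiNerve.obj D' := Arrow.rightFunc.mapIso e
  have w : φ.hom ≫ semiNerve.map F' = semiNerve.map F ≫ ψ.hom := e.hom.w
  have w₁ : ∀ {x y : C} (f : x ⟶ y), mk₁ (F'.toFunctor.map (semiHom φ.hom f)) =
      mk₁ (semiHom ψ.hom (F.toFunctor.map f)) := fun f => by
    rw [← semiApp_semiNerve_map, ← semiApp_mk₁, ← semiApp_mk₁, ← semiApp_semiNerve_map]
    exact ConcreteCategory.congr_hom (congrArg (fun g => NatTrans.app g (op ⦋1⦌ₛ)) w) (mk₁ f)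
  have h : semiFunctor φ ⋙ F'.toFunctor = F.toFunctor ⋙ semiFunctor ψ :=
    CategoryTheory.Functor.hext (fun x => (mk₁_heq (w₁ (𝟙 x))).1) fun x y f =>
      (mk₁_heq (w₁ f)).2.2
  have : (semiFunctor φ ⋙ F'.toFunctor).IsEquivalence := by
    rw [h]
    infer_instance
  exact Functor.isEquivalence_of_comp_left (semiFunctor φ) F'.toFunctor

end SemiNerve

/-! ### Truncations -/

section Truncation

/-- The truncation of a Tamsamani 2-category satisfies the strict Segal condition. -/
lemma isSegalSet_tamsamaniTruncation {Z : SimplexCategoryᵒᵖ ⥤ Cat.{u, u}}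
    (hZ : IsTamsamaniTwoCategory Z) : IsSegalSet (tamsamaniTruncation.obj Z) where
  ext {n x y} h₀ h := by
    have hd := hZ.discrete
    obtain ⟨x, rfl⟩ := Quotient.exists_rep x
    obtain ⟨y, rfl⟩ := Quotient.exists_rep y
    obtain ⟨κ₀⟩ := Quotient.exact h₀
    obtain ⟨κ⟩ := ((isTamsamaniTwoCategory_iff.1 hZ).2 n).nonempty_iso
      (IsDiscrete.eq_of_hom κ₀.hom) (fun j => (Quotient.exact (h j)).some)
    exact Quotient.sound ⟨κ⟩
  exists_filler {n} a l h₀ h₁ := by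
    have hd := hZ.discrete
    obtain ⟨a, rfl⟩ := Quotient.exists_rep a
    have hδ₁ : SimplexCategory.δ (n := 0) 1 = SimplexCategory.const ⦋0⦌ ⦋1⦌ 0 := by
      ext i; fin_cases i; rfl
    have hδ₀ : SimplexCategory.δ (n := 0) 0 = SimplexCategory.const ⦋0⦌ ⦋1⦌ 1 := by
      ext i; fin_cases i; rfl
    choose l' hl' using fun j => Quotient.exists_rep (l j)
    obtain rfl : (fun j => Quotient.mk _ (l' j)) = l := funext hl'
    obtain ⟨x, hx, hx'⟩ := ((isTamsamaniTwoCategory_iff.1 hZ).2 n).exists_filler a l'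
      (fun j hj => by
        rw [hδ₁]
        exact IsDiscrete.eq_of_hom (Quotient.exact (h₀ j hj)).some.hom)
      (fun i j hij => by
        rw [hδ₁, hδ₀]
        exact IsDiscrete.eq_of_hom (Quotient.exact (h₁ i j hij)).some.hom)
    exact ⟨Quotient.mk _ x, congrArg (Quotient.mk _) hx, fun j => Quotient.sound (hx' j)⟩

namespace FatDelta

/-- On the semi-ordinals without links, the contraction is the embedding of the injective monotone
maps in all the monotone maps. -/
noncomputable def ofSemiSimplexCompContract :
    ofSemiSimplex ⋙ contract ≅ SemiSimplexCategory.toSimplexCategory :=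
  NatIso.ofComponents (fun n => contractOrdIso n.len) fun f =>
    contract_map_comp_contractOrdIso (ofSemiSimplex.map f)
      (SemiSimplexCategory.toSimplexCategory.map f) fun _ => rfl

/-- The truncation of a Tamsamani 2-category, and that of its restriction to the fat delta. -/
noncomputable def truncationIso :
    (Functor.whiskeringLeft _ _ Cat.{u, u}).obj contract.op ⋙ fairTruncation ≅
      tamsamaniTruncation ⋙
        (Functor.whiskeringLeft _ _ _).obj SemiSimplexCategory.toSimplexCategory.op :=
  NatIso.ofComponents (fun Z => Functor.isoWhiskerRight
    (NatIso.op ofSemiSimplexCompContract).symm (Z ⋙ isomorphismClasses)) fun {Z Z'} f => by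
      ext n : 2
      exact ((Functor.whiskerRight f isomorphismClasses).naturality _).symm

lemma exists_iso_semiNerve_of_isTamsamaniTwoCategory {Z : SimplexCategoryᵒᵖ ⥤ Cat.{u, u}}
    (hZ : IsTamsamaniTwoCategory Z) :
    ∃ C : Cat.{u, u}, Nonempty (fairTruncation.obj (contract.op ⋙ Z) ≅ semiNerve.obj C) := by
  obtain ⟨C, ⟨e⟩⟩ := (isSegalSet_tamsamaniTruncation hZ).exists_iso_nerve
  exact ⟨C, ⟨truncationIso.app Z ≪≫ Functor.isoWhiskerLeft _ e⟩⟩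

/-- A diagram that sends the vertical morphisms to isomorphisms is the restriction of a simplicial
diagram. -/
lemma exists_iso_contract {X : FatDeltaᵒᵖ ⥤ Cat.{u, u}}
    (h : ∀ {m n : FatDelta} (f : m ⟶ n), vertical f → IsIso (X.map f.op)) :
    ∃ Z : SimplexCategoryᵒᵖ ⥤ Cat.{u, u}, Nonempty (contract.op ⋙ Z ≅ X) := by
  have := contract_isLocalization
  have hX : vertical.op.IsInvertedBy X := fun _ _ f hf => h f.unop hf
  exact ⟨Localization.lift X hX contract.op, ⟨Localization.fac X hX contract.op⟩⟩

lemma isWeakTwoCategory_of_iso {X Y : FatDeltaᵒᵖ ⥤ Cat.{u, u}} (e : X ≅ Y)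
    (hY : IsWeakTwoCategory Y) : IsWeakTwoCategory X :=
  hY.of_levelwise e.hom (fun m => (Cat.equivOfIso (e.app m)).isEquivalence_functor)
    (isDiscrete_of_iso (e.app (op pt)) hY.discrete)

/-- A weak 2-category that sends the vertical morphisms to isomorphisms is the restriction of a
Tamsamani 2-category. -/
lemma exists_iso_contract_of_isWeakTwoCategory {X : FatDeltaᵒᵖ ⥤ Cat.{u, u}}
    (hX : IsWeakTwoCategory X)
    (h : ∀ {m n : FatDelta} (f : m ⟶ n), vertical f → IsIso (X.map f.op)) :
    ∃ Z : SimplexCategoryᵒᵖ ⥤ Cat.{u, u}, IsTamsamaniTwoCategory Z ∧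
      Nonempty (contract.op ⋙ Z ≅ X) := by
  obtain ⟨Z, ⟨e⟩⟩ := exists_iso_contract h
  exact ⟨Z, (isWeakTwoCategory_contract_iff Z).1 (isWeakTwoCategory_of_iso e hX), ⟨e⟩⟩

lemma isWeakTwoCategory_strictify (X : WeakTwoCat.{u}) : IsWeakTwoCategory (strictify.obj X) :=
  isWeakTwoCategory_of_isFairTwoCategory (isFairTwoCategory_strictify X)

/-- The truncation of a weak 2-category is the nerve of a category. -/
lemma exists_iso_semiNerve (X : WeakTwoCat.{u}) :
    ∃ C : Cat.{u, u}, Nonempty (fairTruncation.obj X.obj ≅ semiNerve.obj C) := by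
  obtain ⟨Z, hZ, ⟨e⟩⟩ := exists_iso_contract_of_isWeakTwoCategory (isWeakTwoCategory_strictify X)
    (isIso_strictify_map X)
  obtain ⟨C, ⟨e'⟩⟩ := exists_iso_semiNerve_of_isTamsamaniTwoCategory hZ
  have := isIso_fairTruncation_map _ (isEquivalence_presentedToSelf X)
  have := isIso_fairTruncation_map _ (isEquivalence_presentedToStrictify X)
  exact ⟨C, ⟨(asIso (fairTruncation.map (presentedToSelf.app X))).symm ≪≫
    asIso (fairTruncation.map (presentedToStrictify.app X)) ≪≫
    (fairTruncation.mapIso e).symm ≪≫ e'⟩⟩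

/-! ### Comparison of the classes of 2-equivalences -/

lemma isFairTwoEquivalence_presentedToSelf (X : WeakTwoCat.{u}) :
    IsFairTwoEquivalence (presentedToSelf.app X) :=
  isFairTwoEquivalence_of_levelwise _ (isEquivalence_presentedToSelf X)
    (isDiscrete_presentedCells X) X.property.discrete (exists_iso_semiNerve X)

lemma isFairTwoEquivalence_presentedToStrictify (X : WeakTwoCat.{u}) :
    IsFairTwoEquivalence (presentedToStrictify.app X) :=
  isFairTwoEquivalence_of_levelwise _ (isEquivalence_presentedToStrictify X)
    (isDiscrete_presentedCells X) (isDiscrete_strictify X)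
    (exists_iso_semiNerve ⟨_, isWeakTwoCategory_strictify X⟩)

/-- The strictification preserves and reflects 2-equivalences, because it is linked to the identity
by levelwise equivalences. -/
lemma isFairTwoEquivalence_strictify_map_iff {X Y : WeakTwoCat.{u}} (f : X ⟶ Y) :
    IsFairTwoEquivalence (strictify.map f) ↔ IsFairTwoEquivalence f.hom :=
  (isFairTwoEquivalence_iff_of_square _ _ _ _ (presentedToStrictify.naturality f).symm
    (isEquivalence_presentedToStrictify X) (isEquivalence_presentedToStrictify Y)
    (isDiscrete_strictify X) (isDiscrete_presentedCells X) (isDiscrete_strictify Y)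
    (isDiscrete_presentedCells Y)).trans
  (isFairTwoEquivalence_iff_of_square _ _ _ _ (presentedToSelf.naturality f).symm
    (isEquivalence_presentedToSelf X) (isEquivalence_presentedToSelf Y)
    X.property.discrete (isDiscrete_presentedCells X) Y.property.discrete
    (isDiscrete_presentedCells Y)).symm

section

variable (Z : SimplexCategoryᵒᵖ ⥤ Cat.{u, u})

/-- The comparison of the objects of a simplicial diagram with those of its restriction. -/
noncomputable def contractPt : Z.obj (op ⦋0⦌) ⥤ (contract.op ⋙ Z).obj (op pt) :=
  (contractOrdObjIso Z 0).hom.toFunctor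

/-- The comparison of the 1-cells of a simplicial diagram with those of its restriction. -/
noncomputable def contractArrow : Z.obj (op ⦋1⦌) ⥤ (contract.op ⋙ Z).obj (op arrow) :=
  (contractOrdObjIso Z 1).hom.toFunctor

instance : (contractPt Z).IsEquivalence :=
  inferInstanceAs (contractOrdObjIso Z 0).hom.toFunctor.IsEquivalence

instance : (contractArrow Z).IsEquivalence :=
  inferInstanceAs (contractOrdObjIso Z 1).hom.toFunctor.IsEquivalence

lemma contractArrow_source : contractArrow Z ⋙ res (contract.op ⋙ Z) (arrow.dot 0) =
    (Z.map (SimplexCategory.δ (n := 0) 1).op).toFunctor ⋙ contractPt Z :=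
  contractOrdObjIso_hom_comp Z (k := 0) (l := 1) (arrow.dot 0) _ fun (i : Fin 1) => by
    fin_cases i; rfl

lemma contractArrow_target : contractArrow Z ⋙ res (contract.op ⋙ Z) (arrow.dot 1) =
    (Z.map (SimplexCategory.δ (n := 0) 0).op).toFunctor ⋙ contractPt Z :=
  contractOrdObjIso_hom_comp Z (k := 0) (l := 1) (arrow.dot 1) _ fun (i : Fin 1) => by
    fin_cases i; rfl

lemma isDiscrete_contract (hZ : IsDiscrete (Z.obj (op ⦋0⦌))) :
    IsDiscrete ((contract.op ⋙ Z).obj (op pt)) :=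
  isDiscrete_of_iso (contractOrdObjIso Z 0).symm hZ

variable {Z} {Z' : SimplexCategoryᵒᵖ ⥤ Cat.{u, u}} (f : Z ⟶ Z')

lemma contractPt_naturality : contractPt Z ⋙
    ((Functor.whiskerLeft contract.op f).app (op pt)).toFunctor =
    (f.app (op ⦋0⦌)).toFunctor ⋙ contractPt Z' :=
  congrArg Cat.Hom.toFunctor (f.naturality (contractOrdIso 0).hom.op)

lemma contractArrow_naturality : contractArrow Z ⋙
    ((Functor.whiskerLeft contract.op f).app (op arrow)).toFunctor =
    (f.app (op ⦋1⦌)).toFunctor ⋙ contractArrow Z' :=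
  congrArg Cat.Hom.toFunctor (f.naturality (contractOrdIso 1).hom.op)

lemma isEquivalence_homCatMap_contract_iff (hZ : IsDiscrete (Z.obj (op ⦋0⦌)))
    (hZ' : IsDiscrete (Z'.obj (op ⦋0⦌))) :
    (∀ a b, (homCatMap (Functor.whiskerLeft contract.op f)
      (arrow.dot 0) (arrow.dot 1) a b).IsEquivalence) ↔
    ∀ a b, (homCatMap f (SimplexCategory.δ (n := 0) 1)
      (SimplexCategory.δ (n := 0) 0) a b).IsEquivalence := by
  rw [isEquivalence_homCatMap_iff, isEquivalence_homCatMap_iff]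
  have d := isDiscrete_contract Z hZ
  have d' := isDiscrete_contract Z' hZ'
  have e := IsLocalEquivalence.of_isEquivalence (contractArrow_source Z) (contractArrow_target Z)
  have e' := IsLocalEquivalence.of_isEquivalence (contractArrow_source Z') (contractArrow_target Z')
  have hs : ∀ r : ⦋0⦌ ⟶ ⦋1⦌, (f.app (op ⦋1⦌)).toFunctor ⋙ (Z'.map r.op).toFunctor =
      (Z.map r.op).toFunctor ⋙ (f.app (op ⦋0⦌)).toFunctor := fun r =>
    congrArg Cat.Hom.toFunctor (f.naturality r.op).symm
  constructor
  · intro h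
    have h₁ := e.comp h (contractArrow_source Z) (contractArrow_target Z)
    rw [contractArrow_naturality, contractPt_naturality] at h₁
    exact h₁.of_comp_right (contractArrow_source Z') (contractArrow_target Z')
  · intro h
    have h₁ := h.comp e' (hs _) (hs _)
    rw [← contractArrow_naturality, ← contractPt_naturality] at h₁
    exact IsLocalEquivalence.of_comp_left (F := contractArrow Z)
      (F' := ((Functor.whiskerLeft contract.op f).app (op arrow)).toFunctor) (H := contractPt Z)
      (H' := ((Functor.whiskerLeft contract.op f).app (op pt)).toFunctor) h₁
      (contractArrow_source Z) (contractArrow_target Z)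

/-- The 2-equivalences of Tamsamani 2-categories and those of their restrictions to the fat delta
agree. -/
lemma isFairTwoEquivalence_contract_iff (hZ : IsTamsamaniTwoCategory Z)
    (hZ' : IsTamsamaniTwoCategory Z') :
    IsFairTwoEquivalence (Functor.whiskerLeft contract.op f) ↔ IsTamsamaniTwoEquivalence f := by
  let R : SSet.{u} ⥤ (SemiSimplexCategoryᵒᵖ ⥤ Type u) :=
    (Functor.whiskeringLeft _ _ _).obj SemiSimplexCategory.toSimplexCategory.op
  let κ : Arrow.mk (fairTruncation.map (Functor.whiskerLeft contract.op f)) ≅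
      Arrow.mk (R.map (tamsamaniTruncation.map f)) :=
    Arrow.isoMk (truncationIso.app Z) (truncationIso.app Z') (truncationIso.hom.naturality f).symm
  constructor
  · rintro ⟨h, C, D, F, hF, ⟨e⟩⟩
    refine ⟨(isEquivalence_homCatMap_contract_iff f hZ.discrete hZ'.discrete).1 h, ?_⟩
    obtain ⟨C', ⟨a⟩⟩ := (isSegalSet_tamsamaniTruncation hZ).exists_iso_nerve
    obtain ⟨D', ⟨b⟩⟩ := (isSegalSet_tamsamaniTruncation hZ').exists_iso_nerve
    obtain ⟨F', hF'⟩ := nerveFunctor.map_surjective (a.inv ≫ tamsamaniTruncation.map f ≫ b.hom)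
    let e' : Arrow.mk (tamsamaniTruncation.map f) ≅ Arrow.mk (nerveFunctor.map F') :=
      Arrow.isoMk a b (by
        change a.hom ≫ nerveFunctor.map F' = tamsamaniTruncation.map f ≫ b.hom
        rw [hF', Iso.hom_inv_id_assoc])
    exact ⟨C', D', F', isEquivalence_of_semiNerve F F'
      (e.symm ≪≫ κ ≪≫ R.mapArrow.mapIso e') hF, ⟨e'⟩⟩
  · rintro ⟨h, C, D, F, hF, ⟨e⟩⟩
    exact ⟨(isEquivalence_homCatMap_contract_iff f hZ.discrete hZ'.discrete).2 h, C, D, F, hF,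
      ⟨κ ≪≫ R.mapArrow.mapIso e⟩⟩

end

end FatDelta

end Truncation

/-! ### Comparison of the localizations -/

section Localization

/-- A natural transformation whose components are weak equivalences becomes an isomorphism after
localization. -/
noncomputable def isoOfWeakEquivalences {A : Type*} [Category* A] (W : MorphismProperty A)
    {F G : A ⥤ A} (τ : F ⟶ G) (hτ : ∀ X, W (τ.app X)) : F ⋙ W.Q ≅ G ⋙ W.Q :=
  haveI : ∀ X, IsIso ((Functor.whiskerRight τ W.Q).app X) := fun X => W.Q_inverts _ (hτ X)
  haveI := NatIso.isIso_of_isIso_app (Functor.whiskerRight τ W.Q)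
  asIso (Functor.whiskerRight τ W.Q)

/-- Two categories with weak equivalences have equivalent localizations if there are functors
`I` and `S` between them that preserve the weak equivalences, and if the composites of `I` and `S`
are linked to the identities by zigzags of natural weak equivalences. -/
lemma nonempty_localization_equivalence {A B : Type*} [Category* A] [Category* B]
    (W : MorphismProperty A) (W' : MorphismProperty B) (I : A ⥤ B) (S : B ⥤ A)
    (hI : W ≤ W'.inverseImage I) (hS : W' ≤ W.inverseImage S)
    {E : A ⥤ A} (α : E ⟶ 𝟭 A) (β : E ⟶ I ⋙ S) (hα : ∀ X, W (α.app X)) (hβ : ∀ X, W (β.app X))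
    {E' : B ⥤ B} (α' : E' ⟶ 𝟭 B) (β' : E' ⟶ S ⋙ I) (hα' : ∀ X, W' (α'.app X))
    (hβ' : ∀ X, W' (β'.app X)) : Nonempty (W.Localization ≌ W'.Localization) := by
  have hF : W.IsInvertedBy (I ⋙ W'.Q) := fun _ _ f hf => W'.Q_inverts _ (hI f hf)
  have hG : W'.IsInvertedBy (S ⋙ W.Q) := fun _ _ f hf => W.Q_inverts _ (hS f hf)
  let F := Localization.lift _ hF W.Q
  let G := Localization.lift _ hG W'.Q
  let e : W.Q ⋙ F ≅ I ⋙ W'.Q := Localization.fac _ hF W.Q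
  let e' : W'.Q ⋙ G ≅ S ⋙ W.Q := Localization.fac _ hG W'.Q
  exact ⟨Localization.equivalence W.Q W W'.Q W' (I ⋙ W'.Q) F (S ⋙ W.Q) G
    (Functor.isoWhiskerLeft I e' ≪≫ (isoOfWeakEquivalences W β hβ).symm ≪≫
      isoOfWeakEquivalences W α hα)
    (Functor.isoWhiskerLeft S e ≪≫ (isoOfWeakEquivalences W' β' hβ').symm ≪≫
      isoOfWeakEquivalences W' α' hα')⟩

namespace FatDelta

variable {P : ObjectProperty (FatDeltaᵒᵖ ⥤ Cat.{u, u})}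

variable (P) in
/-- The 2-equivalences between the objects of a full subcategory of diagrams. -/
def twoEquivalences : MorphismProperty P.FullSubcategory := fun _ _ f => IsFairTwoEquivalence f.hom

/-- Inverting the 2-equivalences of a full subcategory of the weak 2-categories that contains the
strictifications yields the same as inverting those of all weak 2-categories. -/
lemma nonempty_localization_equivalence_weak (hP : P ≤ IsWeakTwoCategory)
    (hS : ∀ X : WeakTwoCat.{u}, P (strictify.obj X))
    (hE : ∀ X : WeakTwoCat.{u}, P X.obj → P (presentedCells.obj X)) :
    Nonempty ((twoEquivalences P).Localization ≌
      (twoEquivalences IsWeakTwoCategory.{u}).Localization) := by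
  let I : P.FullSubcategory ⥤ WeakTwoCat.{u} := ObjectProperty.ιOfLE hP
  refine nonempty_localization_equivalence _ _ I
    (P.lift strictify hS) (fun _ _ f hf => hf)
    (fun _ _ f hf => (isFairTwoEquivalence_strictify_map_iff f).2 hf)
    (E := P.lift (I ⋙ presentedCells) fun X => hE _ X.property)
    { app X := ⟨presentedToSelf.app (I.obj X)⟩
      naturality X Y f := ObjectProperty.hom_ext _ (presentedToSelf.naturality (I.map f)) }
    { app X := ⟨presentedToStrictify.app (I.obj X)⟩
      naturality X Y f := ObjectProperty.hom_ext _ (presentedToStrictify.naturality (I.map f)) }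
    (fun X => isFairTwoEquivalence_presentedToSelf _)
    (fun X => isFairTwoEquivalence_presentedToStrictify _)
    (E' := ObjectProperty.lift _ presentedCells isWeakTwoCategory_presentedCells)
    { app X := ⟨presentedToSelf.app X⟩
      naturality X Y f := ObjectProperty.hom_ext _ (presentedToSelf.naturality f) }
    { app X := ⟨presentedToStrictify.app X⟩
      naturality X Y f := ObjectProperty.hom_ext _ (presentedToStrictify.naturality f) }
    (fun X => isFairTwoEquivalence_presentedToSelf _)
    (fun X => isFairTwoEquivalence_presentedToStrictify _)

/-- The weak 2-categories that send the vertical morphisms to isomorphisms. Up to isomorphism, they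
are the restrictions of the Tamsamani 2-categories to the fat delta. -/
def InvertsVertical : ObjectProperty (FatDeltaᵒᵖ ⥤ Cat.{u, u}) := fun X =>
  IsWeakTwoCategory X ∧ ∀ {m n : FatDelta} (f : m ⟶ n), vertical f → IsIso (X.map f.op)

lemma invertsVertical_contract {Z : SimplexCategoryᵒᵖ ⥤ Cat.{u, u}}
    (hZ : IsTamsamaniTwoCategory Z) : InvertsVertical (contract.op ⋙ Z) :=
  ⟨(isWeakTwoCategory_contract_iff Z).2 hZ, fun f hf => by
    have := (isIso_contract_map_iff f).2 hf
    exact inferInstanceAs (IsIso (Z.map (contract.map f).op))⟩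

/-- The restriction of the Tamsamani 2-categories to the fat delta. -/
noncomputable def restrictToFatDelta :
    TamsamaniTwoCat.{u} ⥤ InvertsVertical.{u}.FullSubcategory :=
  ObjectProperty.lift _
    (ObjectProperty.ι _ ⋙ (Functor.whiskeringLeft _ _ Cat.{u, u}).obj contract.op)
    fun X => invertsVertical_contract X.property

instance : restrictToFatDelta.{u}.IsEquivalence := by
  have := contract_isLocalization
  let L : (SimplexCategoryᵒᵖ ⥤ Cat.{u, u}) ⥤ (FatDeltaᵒᵖ ⥤ Cat.{u, u}) :=
    (Functor.whiskeringLeft _ _ Cat.{u, u}).obj contract.op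
  have h : L.FullyFaithful :=
    (Functor.FullyFaithful.ofFullyFaithful
      (Localization.whiskeringLeftFunctor contract.op vertical.op Cat.{u, u})).comp
      (ObjectProperty.fullyFaithfulι _)
  have := h.full
  have := h.faithful
  exact
    { faithful := inferInstanceAs (ObjectProperty.lift _ (ObjectProperty.ι _ ⋙ L) _).Faithful
      full := inferInstanceAs (ObjectProperty.lift _ (ObjectProperty.ι _ ⋙ L) _).Full
      essSurj := ⟨fun X => by
        obtain ⟨Z, hZ, ⟨e⟩⟩ := exists_iso_contract_of_isWeakTwoCategory X.property.1 X.property.2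
        exact ⟨⟨Z, hZ⟩, ⟨ObjectProperty.isoMk _ e⟩⟩⟩ }

/-- The Tamsamani 2-categories have the same localization as their restrictions to the fat delta,
because the two categories are equivalent and have the same 2-equivalences. -/
lemma nonempty_localization_equivalence_tamsamani :
    Nonempty (tamsamaniTwoEquivalences.{u}.Localization ≌
      (twoEquivalences InvertsVertical.{u}).Localization) := by
  let Φ : LocalizerMorphism tamsamaniTwoEquivalences.{u} (twoEquivalences InvertsVertical.{u}) :=
    { functor := restrictToFatDelta
      map := fun X Y f hf =>
        (isFairTwoEquivalence_contract_iff f.hom X.property Y.property).2 hf }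
  have : Φ.functor.IsEquivalence := inferInstanceAs restrictToFatDelta.IsEquivalence
  have := LocalizerMorphism.IsLocalizedEquivalence.of_equivalence Φ fun X Y f hf => by
    let e := restrictToFatDelta.objObjPreimageIso X
    let e' := restrictToFatDelta.objObjPreimageIso Y
    let g := restrictToFatDelta.preimage (e.hom ≫ f ≫ e'.inv)
    have hg : restrictToFatDelta.map g = e.hom ≫ f ≫ e'.inv := restrictToFatDelta.map_preimage _
    have w : e.hom ≫ f = restrictToFatDelta.map g ≫ e'.hom := by simp [hg]
    refine ⟨_, _, g, ?_, ⟨Arrow.isoMk e e' w⟩⟩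
    refine (isFairTwoEquivalence_contract_iff g.hom (ObjectProperty.FullSubcategory.property _)
      (ObjectProperty.FullSubcategory.property _)).1 ?_
    have hl : ∀ {X Y : InvertsVertical.{u}.FullSubcategory} (e : X ≅ Y) m,
        (e.hom.hom.app m).toFunctor.IsEquivalence := fun e m =>
      (Cat.equivOfIso (((ObjectProperty.ι _).mapIso e).app m)).isEquivalence_functor
    exact (isFairTwoEquivalence_iff_of_square e.hom.hom e'.hom.hom f.hom
      (restrictToFatDelta.map g).hom (congrArg (fun h => h.hom) w) (hl e) (hl e')
      X.property.1.discrete (restrictToFatDelta.obj _).property.1.discrete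
      Y.property.1.discrete (restrictToFatDelta.obj _).property.1.discrete).1 hf
  exact ⟨(Φ.localizedFunctor (MorphismProperty.Q _) (MorphismProperty.Q _)).asEquivalence⟩

end FatDelta

end Localization

theorem mainTheorem3 :
    Nonempty (fairTwoEquivalences.{u}.Localization ≌ tamsamaniTwoEquivalences.{u}.Localization) := by
  obtain ⟨e₁⟩ := FatDelta.nonempty_localization_equivalence_weak (P := IsFairTwoCategory.{u})
    (fun _ h => FatDelta.isWeakTwoCategory_of_isFairTwoCategory h)
    FatDelta.isFairTwoCategory_strictify FatDelta.isFairTwoCategory_presentedCells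
  obtain ⟨e₂⟩ := FatDelta.nonempty_localization_equivalence_weak (P := FatDelta.InvertsVertical.{u})
    (fun _ h => h.1)
    (fun X => ⟨FatDelta.isWeakTwoCategory_strictify X, FatDelta.isIso_strictify_map X⟩)
    (fun X h => ⟨FatDelta.isWeakTwoCategory_presentedCells X, fun f hf =>
      FatDelta.isIso_presentedCells_map X f hf (h.2 f hf)⟩)
  obtain ⟨e₃⟩ := FatDelta.nonempty_localization_equivalence_tamsamani.{u}
  exact ⟨e₁.trans (e₂.symm.trans e₃.symm)⟩
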